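/- **Graph-theoretic notions.** All subgraphs are induced. A vertex of a graph is *removable* if its valency is at most $1$, or if its valency is $2$ and its two neighbours are adjacent. Let $T$ be the first-order theory, in the language $L=\{E\}$ of graphs, of the (non-empty) graphs without isolated vertices in which (1) every edge is contained in exactly two triangles, and (2) every non-empty finite subgraph has a removable vertex. **The Farey graph.** The Farey graph $F_1$ of level $1$ is a single black edge contained in two triangles whose other sides are blue. $F_{n+1}$ is obtained from $F_n$ by adding for every blue edge $e$ of $F_n$ a new vertex $v_e$, joined precisely to the two end vertices of $e$ by blue edges, and by colouring all the edges of $F_n$ black. The Farey graph is $G_F=\bigcup_n F_n$ without the colours. **The predicates $P_\delta$.** For $n\ge 1$ let $\mathcal C_n$ be the set of isomorphism types of subgraphs $C$ of $G_F$ induced on the vertex set of a simple cycle and having exactly two removable vertices, these being at distance $n$ in $C$. (Such cycles are automatically triangulated by the edges between their vertices.) Here a single edge counts as a degenerate cycle; it is the only element of $\mathcal C_1$. Put $\mathcal C=\bigcup_n\mathcal C_n$. For $C\in\mathcal C$, $P_C(x,y)$ says that there is an induced subgraph isomorphic to $C$ whose two removable vertices are $x$ and $y$. For a finite sequence $\delta=(C_1,\dots,C_m)$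 with $C_i\in\mathcal C_{k_i}$, $P_\delta(x,y)$ says that there are $z_0=x,z_1,\dots,z_m=y$ such that $P_{C_i}(z_{i-1},z_i)$ holds for $i=1,\dots,m$, and that $d(x,y)=\sum_{i=1}^m k_i$. For the empty sequence, $P_\delta(x,y)$ says $x=y$. **The predicates $Y_\varepsilon$.** For every $n\ge 1$ fix an enumeration $v_1,\dots,v_{|F_n|}$ of the vertices of $F_n$. For a permutation $\sigma$ of $\{1,\dots,|F_n|\}$, $D_{n,\sigma}(x_1,x_2,x_3)$ says that there are $x_4,\dots,x_{|F_n|}$ such that $x_i\mapsto v_{\sigma(i)}$ $(1\le i\le |F_n|)$ is an isomorphism from the subgraph induced on the distinct vertices $x_1,\dots,x_{|F_n|}$ onto $F_n$. For $\varepsilon=(\delta_1,\delta_2,\delta_3,n,\sigma)$ with finite, possibly empty sequences $\delta_1,\delta_2,\delta_3$ in $\mathcal C$, $Y_\varepsilon(x,y,z)$ says that there are $x',y',z'$ such that $D_{n,\sigma}(x',y',z')$, $P_{\delta_1}(x,x')$, $P_{\delta_2}(y,y')$ and $P_{\delta_3}(z,z')$ hold. Let $L'$ be the language of graphs expanded by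 all the binary predicates $P_\delta$ and all the ternary predicates $Y_\varepsilon$; every model of $T$ is regarded as an $L'$-structure by these definitions. **Theorem.** $T$ has quantifier elimination in the language $L'$: for every $n\ge 0$ and every $L'$-formula $\varphi(x_1,\dots,x_n)$ there is a quantifier-free $L'$-formula $\psi(x_1,\dots,x_n)$ such that $M\models\forall \bar x\,(\varphi(\bar x)\leftrightarrow\psi(\bar x))$ for every model $M$ of $T$. -/

import Mathlib

open FirstOrder FirstOrder.Language

/-! ### Removable vertices -/

/-- A vertex `x` of a graph is removable if its valency is at most `1`, or if its valency is `2`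
and its two neighbours form an edge. -/
def IsRemovable {V : Type*} (G : SimpleGraph V) (x : V) : Prop :=
  (G.neighborSet x).encard ≤ 1 ∨ ∃ y z, G.neighborSet x = {y, z} ∧ G.Adj y z

/-! ### The Farey graph -/

/-- A graph whose edges are coloured black or blue. -/
structure BicolouredGraph where
  /-- the vertices -/
  V : Type
  /-- the black edges -/
  black : SimpleGraph V
  /-- the blue edges -/
  blue : SimpleGraph V

namespace BicolouredGraph

/-- The graph of all edges, without the colouring. -/
def total (F : BicolouredGraph) : SimpleGraph F.V := F.black ⊔ F.blue

/-- Colour all edges black, and add for every blue edge `e` a new vertex `Sum.inr e`, joined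
precisely to the two end vertices of `e`, by blue edges. -/
def extend (F : BicolouredGraph) : BicolouredGraph where
  V := F.V ⊕ F.blue.edgeSet
  black := F.total.map Function.Embedding.inl
  blue := SimpleGraph.fromRel fun a b => ∃ (e : F.blue.edgeSet) (v : F.V),
    a = Sum.inr e ∧ b = Sum.inl v ∧ v ∈ e.1

end BicolouredGraph

/-- `fareyLevel k` is the Farey graph `F_{k+1}` of level `k + 1`. The first level is a black edge
`01` in the two triangles `012` and `013`, whose other sides are blue. -/
def fareyLevel : ℕ → BicolouredGraph
  | 0 =>
    { V := Fin 4
      black := SimpleGraph.fromEdgeSet {s(0, 1)}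
      blue := SimpleGraph.fromEdgeSet {s(0, 2), s(1, 2), s(0, 3), s(1, 3)} }
  | k + 1 => (fareyLevel k).extend

instance fareyLevel_finite (k : ℕ) : Finite (fareyLevel k).V := by
  induction k with
  | zero => exact inferInstanceAs (Finite (Fin 4))
  | succ k ih => exact inferInstanceAs (Finite ((fareyLevel k).V ⊕ (fareyLevel k).blue.edgeSet))

/-- The number of vertices of the Farey graph of level `k + 1`. -/
noncomputable def fareyCard (k : ℕ) : ℕ := Nat.card (fareyLevel k).V

theorem four_le_fareyCard (k : ℕ) : 4 ≤ fareyCard k := by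
  induction k with
  | zero => exact (Nat.card_fin 4).ge
  | succ k ih =>
    refine ih.trans (Nat.card_le_card_of_injective (β := (fareyLevel (k + 1)).V)
      (Sum.inl : (fareyLevel k).V → (fareyLevel k).V ⊕ (fareyLevel k).blue.edgeSet)
      Sum.inl_injective)

/-- A fixed enumeration of the vertices of the Farey graph of level `k + 1`. -/
noncomputable def fareyEnum (k : ℕ) : Fin (fareyCard k) ≃ (fareyLevel k).V :=
  (Finite.equivFin (fareyLevel k).V).symm

/-- The vertices of the union of the levels: every vertex of a level is identified with its copy
in the next level. -/
def FareyVertex : Type :=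
  Quot fun a b : Σ k, (fareyLevel k).V => ∃ (k : ℕ) (v : (fareyLevel k).V),
    a = ⟨k, v⟩ ∧ b = ⟨k + 1, (Sum.inl v : (fareyLevel k).V ⊕ (fareyLevel k).blue.edgeSet)⟩

/-- The vertex of the union given by a vertex of level `k + 1`. -/
def FareyVertex.mk (k : ℕ) (v : (fareyLevel k).V) : FareyVertex := Quot.mk _ ⟨k, v⟩

/-- The Farey graph, the union of all levels without their colourings. -/
def fareyGraph : SimpleGraph FareyVertex :=
  SimpleGraph.fromRel fun a b => ∃ (k : ℕ) (u v : (fareyLevel k).V),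
    a = FareyVertex.mk k u ∧ b = FareyVertex.mk k v ∧ (fareyLevel k).total.Adj u v

/-! ### Minimal triangulated cycles -/

/-- `G` is the induced graph on a cycle: it has a Hamiltonian cycle, or it is a single edge on two
vertices, which counts as the (degenerate) cycle of length two. -/
def IsCycleGraph {m : ℕ} (G : SimpleGraph (Fin m)) : Prop :=
  (m = 2 ∧ G = ⊤) ∨ ∃ (a : Fin m) (p : G.Walk a a), p.IsHamiltonianCycle

/-- A finite graph that occurs in the Farey graph as the subgraph induced on a cycle, with exactly
two removable vertices, which have distance `n` in it. Every cycle of the Farey graph is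
triangulated by the edges between its vertices. -/
structure MinimalCycle (n : ℕ) where
  /-- the number of vertices -/
  size : ℕ
  /-- the graph induced on the cycle -/
  graph : SimpleGraph (Fin size)
  isCycleGraph : IsCycleGraph graph
  inFarey : Nonempty (graph ↪g fareyGraph)
  removable : ∃ u w, u ≠ w ∧ {v | IsRemovable graph v} = {u, w} ∧ graph.dist u w = n

/-- Isomorphism of minimal cycles. -/
instance MinimalCycle.setoid (n : ℕ) : Setoid (MinimalCycle n) where
  r C D := Nonempty (C.graph ≃g D.graph)
  iseqv :=
    { refl := fun _ => ⟨SimpleGraph.Iso.refl⟩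
      symm := fun ⟨f⟩ => ⟨f.symm⟩
      trans := fun ⟨f⟩ ⟨g⟩ => ⟨g.comp f⟩ }

/-- The set `𝒞 = ⋃ₙ 𝒞ₙ` of isomorphism types of minimal triangulated cycles in the Farey graph;
the first component of an element is the distance `n` of the two removable vertices. -/
def CycleType : Type := Σ n : ℕ, Quotient (MinimalCycle.setoid n)

/-! ### The new predicates, in an arbitrary graph -/

section Predicates

variable {V : Type*} (G : SimpleGraph V)

/-- `P_C(x, y)`: there is a cycle in `G` isomorphic to `C` whose removable vertices are `x`
and `y`. -/
def PCycle (C : CycleType) (x y : V) : Prop :=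
  ∃ D : MinimalCycle C.1, (⟦D⟧ : Quotient (MinimalCycle.setoid C.1)) = C.2 ∧
    ∃ (f : D.graph ↪g G) (u w : Fin D.size),
      {v | IsRemovable D.graph v} = {u, w} ∧ f u = x ∧ f w = y

/-- `P_δ(x, y)` for `δ = (C₁, …, C_m)`: there are connecting points `z₀ = x, …, z_m = y` with
`P_{C_i}(z_{i-1}, z_i)` for all `i`, and `d(x, y)` is the sum of the distances belonging to
the `C_i`. For the empty sequence this says `x = y`. -/
def PSeq (δ : List CycleType) (x y : V) : Prop :=
  (∃ z : Fin (δ.length + 1) → V, z 0 = x ∧ z (Fin.last δ.length) = y ∧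
    ∀ i : Fin δ.length, PCycle G (δ.get i) (z i.castSucc) (z i.succ)) ∧
  G.dist x y = (δ.map fun C => C.1).sum

/-- `D_{k+1,σ}(x, y, z)`: there is a sequence of vertices of `G`, starting with `x, y, z`, such
that sending its `i`-th member to the vertex `v_{σ(i)}` of the Farey graph of level `k + 1`
is an isomorphism from the subgraph induced on it. -/
def DLevel (k : ℕ) (σ : Equiv.Perm (Fin (fareyCard k))) (x y z : V) : Prop :=
  ∃ t : Fin (fareyCard k) → V,
    t ⟨0, by have := four_le_fareyCard k; omega⟩ = x ∧
    t ⟨1, by have := four_le_fareyCard k; omega⟩ = y ∧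
    t ⟨2, by have := four_le_fareyCard k; omega⟩ = z ∧
    Function.Injective t ∧
    ∀ i j, G.Adj (t i) (t j) ↔
      (fareyLevel k).total.Adj (fareyEnum k (σ i)) (fareyEnum k (σ j))

/-- `Y_{δ₁,δ₂,δ₃,k+1,σ}(x, y, z)`. -/
def YConfig (δ₁ δ₂ δ₃ : List CycleType) (k : ℕ) (σ : Equiv.Perm (Fin (fareyCard k)))
    (x y z : V) : Prop :=
  ∃ x' y' z', DLevel G k σ x' y' z' ∧ PSeq G δ₁ x x' ∧ PSeq G δ₂ y y' ∧ PSeq G δ₃ z z'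

end Predicates

/-! ### The theory of the Farey graph -/

section Theory

/-- The formula `E(xᵢ, xⱼ)`. -/
def edgeFormula {m : ℕ} (i j : Fin m) : Language.graph.BoundedFormula Empty m :=
  adj.boundedFormula₂ (&i) (&j)

/-- The formula `xᵢ = xⱼ`. -/
def eqFormula {m : ℕ} (i j : Fin m) : Language.graph.BoundedFormula Empty m :=
  Term.bdEqual (&i) (&j)

/-- Every vertex lies on an edge: `∀ x₀ ∃ x₁ E(x₀, x₁)`. -/
def noIsolatedVertex : Language.graph.Sentence :=
  ∀' ∃' edgeFormula (m := 2) 0 1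

/-- Every edge `x₀x₁` is contained in exactly two triangles, namely those with third vertex `x₂`
and `x₃`. -/
def exactlyTwoTriangles : Language.graph.Sentence :=
  ∀' ∀' (edgeFormula (m := 2) 0 1 ⟹
    ∃' ∃' (∼(eqFormula (m := 4) 2 3) ⊓ ∀' ((edgeFormula (m := 5) 0 4 ⊓ edgeFormula 1 4) ⇔
      (eqFormula 4 2 ⊔ eqFormula 4 3))))

/-- The vertex `xᵢ` is removable from the subgraph on the distinct vertices `x₀, …, x_{m-1}`:
it has no two neighbours there, or it has exactly two and these form an edge. -/
noncomputable def removableFormula {m : ℕ} (i : Fin m) : Language.graph.BoundedFormula Empty m :=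
  (BoundedFormula.iInf fun p : {p : Fin m × Fin m // p.1 ≠ p.2} =>
      ∼(edgeFormula i p.1.1 ⊓ edgeFormula i p.1.2)) ⊔
  (BoundedFormula.iSup fun p : Fin m × Fin m =>
      edgeFormula i p.1 ⊓ edgeFormula i p.2 ⊓ edgeFormula p.1 p.2 ⊓
        BoundedFormula.iInf fun l : {l : Fin m // l ≠ p.1 ∧ l ≠ p.2} => ∼(edgeFormula i l.1))

/-- Every subgraph on `k + 1` distinct vertices has a removable vertex. -/
noncomputable def someRemovable (k : ℕ) : Language.graph.Sentence :=
  BoundedFormula.alls (n := k + 1)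
    ((BoundedFormula.iInf fun p : {p : Fin (k + 1) × Fin (k + 1) // p.1 ≠ p.2} =>
        ∼(eqFormula p.1.1 p.1.2)) ⟹
      BoundedFormula.iSup fun i => removableFormula i)

/-- The theory `T`, in the language of graphs: graphs without isolated vertices in which every
edge is contained in exactly two triangles and every finite subgraph has a removable vertex. -/
noncomputable def fareyTheory : Language.graph.Theory :=
  Theory.simpleGraph ∪ {noIsolatedVertex, exactlyTwoTriangles} ∪ Set.range someRemovable

instance fareyTheory_simpleGraph (M : Type*) [Language.graph.Structure M] [M ⊨ fareyTheory] :
    M ⊨ Theory.simpleGraph :=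
  Theory.Model.mono (T' := fareyTheory) inferInstance
    (Set.subset_union_left.trans Set.subset_union_left)

end Theory

/-! ### The expanded language -/

/-- The relation symbols of the expanded language: the edge relation, the binary predicates `P_δ`
and the ternary predicates `Y_ε`, where `ε = (δ₁, δ₂, δ₃, k + 1, σ)`. -/
inductive FareyRel : ℕ → Type
  | edge : FareyRel 2
  | P (δ : List CycleType) : FareyRel 2
  | Y (δ₁ δ₂ δ₃ : List CycleType) (k : ℕ) (σ : Equiv.Perm (Fin (fareyCard k))) : FareyRel 3

/-- The expanded language `L'`. -/
def fareyLanguage : Language := ⟨fun _ => Empty, FareyRel⟩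

/-- The expansion of a graph to a structure of the expanded language. -/
@[reducible]
def SimpleGraph.fareyStructure {V : Type*} (G : SimpleGraph V) : fareyLanguage.Structure V where
  funMap f := f.elim
  RelMap
    | FareyRel.edge, v => G.Adj (v 0) (v 1)
    | FareyRel.P δ, v => PSeq G δ (v 0) (v 1)
    | FareyRel.Y δ₁ δ₂ δ₃ k σ, v => YConfig G δ₁ δ₂ δ₃ k σ (v 0) (v 1) (v 2)

/-- Every model of `T` is a structure of the expanded language, in which the new symbols have
their intended meaning. -/
instance fareyExpansion (M : Type*) [Language.graph.Structure M] [M ⊨ fareyTheory] :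
    fareyLanguage.Structure M :=
  (simpleGraphOfStructure M).fareyStructure

/-! A model of the theory is a tree-like arrangement of copies of the Farey graph. Removability is a
form of chordality: neighbours of `x` connected outside `x` are already connected in the link of `x`
(`connIn_link`), and there is no complete graph on four vertices. Hence the ends of an edge separate
the third vertices of its two triangles. Every edge extends, level by level, to an embedded copy of
the Farey graph. Each copy is gated: a vertex connected to it is separated from it by one vertex of
the copy (`gated_range`). Two different copies share at most one vertex.

The partial isomorphisms between countable gated sets (`ClosedIso`) form a back-and-forth system
between countably saturated models. To reach a new vertex one glues on a copy of the Farey graph at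
a single vertex, or adds a point of a new component (`ClosedIso.forth`). They therefore preserve all
graph formulas.

It remains to find such a partial isomorphism from quantifier-free data. The data used are
distances, which are the `P_δ` for sequences of single edges, and the possible distances of three
points from three vertices of a common copy, which are instances of `Y_ε`. Suppose that `d` and `d'`
agree in this respect over a tuple `b`. Let `w` be the vertex farthest from `d` that separates `d`
from all members of `b` connected to it, and let `w'` be its counterpart for `d'`. From a matching
of `w` with `w'`, one moves towards `d` and `d'` copy by copy (`ClosedIso.extend`). If `w` and `w'`
differ, some copy has an automorphism that moves `w` to `w'` and fixes the gates of two members of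
`b`. Rigidity makes one automorphism serve for all members: an automorphism with two fixed points is
an involution, and with three it is trivial (`fix_two`). This is why predicates of three variables
suffice.

Finally, if some formula had no quantifier-free equivalent, there would be pairs of tuples agreeing
on longer and longer lists of quantifier-free formulas but not on the given one. Their ultraproducts
are countably saturated and contradict the above. -/

/-! ### Paths, separating vertices and chordality -/

section Connectivity

variable {V : Type*} {G : SimpleGraph V}

/-- `x` and `y` are joined by a path of `G` inside `S`. -/
def ConnIn (G : SimpleGraph V) (S : Set V) (x y : V) : Prop :=
  x ∈ S ∧ Relation.ReflTransGen (fun a b => G.Adj a b ∧ b ∈ S) x y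

namespace ConnIn

variable {S T : Set V} {x y z w : V}

theorem refl (h : x ∈ S) : ConnIn G S x x := ⟨h, .refl⟩

theorem left_mem (h : ConnIn G S x y) : x ∈ S := h.1

theorem right_mem (h : ConnIn G S x y) : y ∈ S := by
  obtain ⟨hx, h⟩ := h
  induction h with
  | refl => exact hx
  | tail _ h _ => exact h.2

theorem trans (h : ConnIn G S x y) (h' : ConnIn G S y z) : ConnIn G S x z := ⟨h.1, h.2.trans h'.2⟩

theorem tail (h : ConnIn G S x y) (h' : G.Adj y z) (hz : z ∈ S) : ConnIn G S x z :=
  ⟨h.1, h.2.tail ⟨h', hz⟩⟩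

theorem of_adj (h : G.Adj x y) (hx : x ∈ S) (hy : y ∈ S) : ConnIn G S x y := (refl hx).tail h hy

@[elab_as_elim]
theorem rec_tail {P : V → Prop} (h : ConnIn G S x y) (h0 : P x)
    (h1 : ∀ a b, ConnIn G S x a → G.Adj a b → b ∈ S → P a → P b) : P y := by
  obtain ⟨hx, h⟩ := h
  induction h with
  | refl => exact h0
  | tail hab hbc ih => exact h1 _ _ ⟨hx, hab⟩ hbc.1 hbc.2 ih

theorem symm (h : ConnIn G S x y) : ConnIn G S y x := by
  refine h.rec_tail (P := fun y => ConnIn G S y x) (refl h.1) fun a b ha hab hb ih => ?_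
  exact (of_adj hab.symm hb ha.right_mem).trans ih

theorem mono (hST : S ⊆ T) (h : ConnIn G S x y) : ConnIn G T x y := by
  refine h.rec_tail (refl (hST h.1)) fun a b _ hab hb ih => ih.tail hab (hST hb)

/-- A path either avoids `w` or passes through it. -/
theorem avoid_or (h : ConnIn G S x y) (hx : x ≠ w) :
    ConnIn G (S ∩ {w}ᶜ) x y ∨ ConnIn G S x w := by
  refine h.rec_tail (P := fun y => ConnIn G (S ∩ {w}ᶜ) x y ∨ ConnIn G S x w)
    (Or.inl (refl ⟨h.1, hx⟩)) fun a b ha hab hb ih => ?_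
  rcases ih with ih | ih
  · by_cases hw : b = w
    · exact Or.inr (hw ▸ ha.tail hab hb)
    · exact Or.inl (ih.tail hab ⟨hb, hw⟩)
  · exact Or.inr ih

/-- A path between vertices separated by `w` passes through `w`. -/
theorem pass (h : ConnIn G S x y) (hw : ¬ ConnIn G {w}ᶜ x y) : ConnIn G S x w := by
  by_cases hx : x = w
  · exact hx ▸ refl h.1
  · exact (h.avoid_or hx).resolve_left fun h' => hw (h'.mono Set.inter_subset_right)

theorem exists_finset (h : ConnIn G S x y) : ∃ T : Finset V, ↑T ⊆ S ∧ ConnIn G T x y := by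
  classical
  refine h.rec_tail (P := fun y => ∃ T : Finset V, ↑T ⊆ S ∧ ConnIn G T x y)
    ⟨{x}, by simpa using h.1, refl (by simp)⟩ fun a b _ hab hb ⟨T, hT, hc⟩ => ?_
  refine ⟨insert b T, ?_, (hc.mono (by simp)).tail hab (by simp)⟩
  rw [Finset.coe_insert]
  exact Set.insert_subset hb hT

/-- The last step of a nontrivial path towards its end. -/
theorem exists_last (h : ConnIn G S x y) (hxy : x ≠ y) :
    ∃ c, G.Adj c y ∧ ConnIn G (S ∩ {y}ᶜ) x c := by
  refine (h.rec_tail (P := fun z => ConnIn G (S ∩ {y}ᶜ) x z ∨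
    ∃ c, G.Adj c y ∧ ConnIn G (S ∩ {y}ᶜ) x c) (.inl (refl ⟨h.1, hxy⟩))
    fun a b _ hab hb ih => ?_).resolve_left fun h => h.right_mem.2 rfl
  rcases ih with ih | ih
  · by_cases hby : b = y
    · exact .inr ⟨a, hby ▸ hab, ih⟩
    · exact .inl (ih.tail hab ⟨hb, hby⟩)
  · exact .inr ih

/-- Removing a vertex whose neighbours are pairwise adjacent does not disconnect. -/
theorem remove_simplicial {v : V} (hv : ∀ s ∈ S, ∀ t ∈ S, G.Adj v s → G.Adj v t → s ≠ t → G.Adj s t)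
    (h : ConnIn G S x y) (hx : x ≠ v) (hy : y ≠ v) : ConnIn G (S \ {v}) x y := by
  -- While the path stands on `v`, the claim is carried by all neighbours of `v` in `S`: the vertex
  -- before `v` is equal or adjacent to each of them.
  refine (h.rec_tail (P := fun z => (z ≠ v → ConnIn G (S \ {v}) x z) ∧
    (z = v → ∀ t ∈ S, G.Adj v t → ConnIn G (S \ {v}) x t))
    ⟨fun _ => refl ⟨h.1, hx⟩, fun h => absurd h hx⟩ fun a b ha hab hb ih => ?_).1 hy
  by_cases hav : a = v
  · subst hav
    exact ⟨fun _ => ih.2 rfl b hb hab, fun hba => absurd hba hab.ne'⟩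
  · refine ⟨fun hbv => (ih.1 hav).tail hab ⟨hb, hbv⟩, fun hbv t ht hvt => ?_⟩
    subst hbv
    by_cases hat : a = t
    · exact hat ▸ ih.1 hav
    · exact (ih.1 hav).tail (hv a ha.right_mem t ht hab.symm hvt hat) ⟨ht, hvt.ne'⟩

theorem univ_iff : ConnIn G Set.univ x y ↔ G.Reachable x y := by
  constructor
  · intro h
    exact h.rec_tail (.refl _) fun a b _ hab _ ih => ih.trans hab.reachable
  · rintro ⟨p⟩
    induction p with
    | nil => exact refl trivial
    | cons hab _ ih => exact (of_adj (S := Set.univ) hab trivial trivial).trans ih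

theorem reachable (h : ConnIn G S x y) : G.Reachable x y := univ_iff.1 (h.mono (Set.subset_univ _))

theorem of_walk (p : G.Walk x y) (hp : ∀ z ∈ p.support, z ∈ S) : ConnIn G S x y := by
  induction p with
  | nil => exact refl (hp _ (by simp))
  | cons hab p ih =>
    exact (of_adj hab (hp _ (by simp)) (hp _ (by simp))).trans
      (ih fun z hz => hp z (by simp [hz]))

end ConnIn

/-- Every path from `x` to `y` passes through `w`. -/
def Separates (G : SimpleGraph V) (w x y : V) : Prop := ¬ ConnIn G {w}ᶜ x y

namespace Separates

variable {u v w x y z : V}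

theorem symm (h : Separates G w x y) : Separates G w y x := fun h' => h h'.symm

theorem left : Separates G x x y := fun h => h.left_mem rfl

theorem right : Separates G y x y := fun h => h.right_mem rfl

theorem reachable (h : Separates G w x y) (hxy : G.Reachable x y) : G.Reachable x w :=
  ((ConnIn.univ_iff.2 hxy).pass h).reachable

theorem eq_of_adj (h : Separates G w x y) (hxy : G.Adj x y) : x = w ∨ y = w := by
  by_contra! hc
  exact h (.of_adj hxy hc.1 hc.2)

theorem dist_eq (h : Separates G w x y) (hxy : G.Reachable x y) :
    G.dist x y = G.dist x w + G.dist w y := by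
  classical
  obtain ⟨p, hp⟩ := hxy.exists_walk_length_eq_dist
  have hw : w ∈ p.support := by
    by_contra hw
    exact h (ConnIn.of_walk p fun z hz hzw => hw (by rwa [Set.mem_singleton_iff.1 hzw] at hz))
  have h1 := SimpleGraph.dist_le (p.takeUntil w hw)
  have h2 := SimpleGraph.dist_le (p.dropUntil w hw)
  have h3 := congrArg SimpleGraph.Walk.length (p.take_spec hw)
  rw [SimpleGraph.Walk.length_append] at h3
  have h4 : G.dist x y ≤ G.dist x w + G.dist w y := by
    have h5 := (p.takeUntil w hw).reachable
    have h6 := (p.dropUntil w hw).reachable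
    obtain ⟨q, hq⟩ := h5.exists_walk_length_eq_dist
    obtain ⟨q', hq'⟩ := h6.exists_walk_length_eq_dist
    rw [← hq, ← hq', ← SimpleGraph.Walk.length_append]
    exact SimpleGraph.dist_le _
  omega

end Separates

theorem dist_triangle_of_reachable {x y z : V} (h : G.Reachable x y) (h' : G.Reachable y z) :
    G.dist x z ≤ G.dist x y + G.dist y z := by
  obtain ⟨q, hq⟩ := h.exists_walk_length_eq_dist
  obtain ⟨q', hq'⟩ := h'.exists_walk_length_eq_dist
  rw [← hq, ← hq', ← SimpleGraph.Walk.length_append]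
  exact SimpleGraph.dist_le _

theorem eq_of_reachable_of_dist {x y : V} (h : G.Reachable x y) (h0 : G.dist x y = 0) : x = y :=
  h.dist_eq_zero_iff.1 h0

/-- A separating vertex is the only vertex on a geodesic at its distance. -/
theorem Separates.eq_of_geodesic {u v x y : V} (h : Separates G v x y) (hu : G.Reachable x u)
    (hu' : G.Reachable u y) (hg : G.dist x u + G.dist u y ≤ G.dist x y)
    (hd : G.dist x u = G.dist x v) : u = v := by
  have hxy := h.dist_eq (hu.trans hu')
  have hxv := h.reachable (hu.trans hu')
  -- The vertex `v` separates `x` from `u` or `u` from `y`. In either case additivity of distances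
  -- forces `u` and `v` to have distance zero.
  by_cases h1 : Separates G v x u
  · exact (eq_of_reachable_of_dist (hxv.symm.trans hu) (by have := h1.dist_eq hu; omega)).symm
  · have h2 : Separates G v u y := fun h2 => h1 fun h1 => h (h1.trans h2)
    exact eq_of_reachable_of_dist (hu.symm.trans hxv) (by have := h2.dist_eq hu'; omega)

/-! ### Chordal graphs with two triangles at every edge -/

/-- The combinatorial content of the theory of the Farey graph. -/
structure FareyModel (G : SimpleGraph V) : Prop where
  exists_adj : ∀ x, ∃ y, G.Adj x y
  thirds : ∀ x y, G.Adj x y → ∃ a b, a ≠ b ∧ ∀ z, (G.Adj x z ∧ G.Adj y z) ↔ z = a ∨ z = b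
  removable : ∀ T : Finset V, T.Nonempty → ∃ v ∈ T,
    (∀ s ∈ T, ∀ t ∈ T, G.Adj v s → G.Adj v t → s ≠ t → G.Adj s t) ∧
    ∀ r ∈ T, ∀ s ∈ T, ∀ t ∈ T, G.Adj v r → G.Adj v s → G.Adj v t → r = s ∨ r = t ∨ s = t

namespace FareyModel

variable (hG : FareyModel G)
include hG

/-- Delete a removable vertex `v` of `T ∪ {x}` and induct. If `v = x`, then `a` and `b` are
adjacent. If `v = a`, the neighbour `c` of `a` on the path is adjacent to `x`, because `c` and `x`
are both neighbours of `a`, so `a` can be replaced by `c`; likewise for `b`. Any other `v` can be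
removed without disconnecting `a` from `b`. -/
theorem connIn_link_finset (n : ℕ) : ∀ (T : Finset V) (x a b : V), T.card = n → x ∉ T → G.Adj x a →
    G.Adj x b → ConnIn G T a b → ConnIn G (T ∩ G.neighborSet x) a b := by
  classical
  induction n with
  | zero =>
    intro T x a b hT _ _ _ hab
    rw [Finset.card_eq_zero.1 hT] at hab
    simpa using hab.left_mem
  | succ n ih =>
    intro T x a b hT hx hxa hxb hab
    have haT : a ∈ T := hab.left_mem
    have hbT : b ∈ T := hab.right_mem
    have key : ∀ a b, G.Adj x a → G.Adj x b → a ≠ b → ConnIn G T a b →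
        (∀ s ∈ insert x T, ∀ t ∈ insert x T, G.Adj a s → G.Adj a t → s ≠ t → G.Adj s t) →
        (∀ r ∈ insert x T, ∀ s ∈ insert x T, ∀ t ∈ insert x T, G.Adj a r → G.Adj a s →
          G.Adj a t → r = s ∨ r = t ∨ s = t) → ConnIn G (T ∩ G.neighborSet x) a b := by
      intro a b hxa hxb hne hab h1 h2
      have haT : a ∈ T := hab.left_mem
      have hbT : b ∈ T := hab.right_mem
      obtain ⟨c, hca, hbc⟩ := hab.symm.exists_last hne.symm
      have hcT : c ∈ T := hbc.right_mem.1
      have hxc : G.Adj x c := h1 x (by simp) c (by simp [hcT]) hxa.symm hca.symm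
        (fun h => hx (h ▸ hcT))
      have := ih (T.erase a) x c b (by rw [Finset.card_erase_of_mem haT, hT]; rfl)
        (fun h => hx (Finset.mem_of_mem_erase h)) hxc hxb
        (hbc.symm.mono (by rw [Finset.coe_erase]; exact fun _ h => h))
      exact (ConnIn.of_adj (S := T ∩ G.neighborSet x) hca.symm ⟨haT, hxa⟩ ⟨hcT, hxc⟩).trans (this.mono
        (Set.inter_subset_inter_left _ (by simp)))
    by_cases hne : a = b
    · exact hne ▸ ConnIn.refl ⟨Finset.mem_coe.2 haT, hxa⟩
    obtain ⟨v, hv, h1, h2⟩ := hG.removable (insert x T) (by simp)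
    by_cases hvx : v = x
    · subst hvx
      exact ConnIn.of_adj (h1 a (by simp [haT]) b (by simp [hbT]) hxa hxb hne)
        ⟨Finset.mem_coe.2 haT, hxa⟩ ⟨Finset.mem_coe.2 hbT, hxb⟩
    by_cases hva : v = a
    · subst hva
      exact key v b hxa hxb hne hab h1 h2
    by_cases hvb : v = b
    · subst hvb
      exact (key v a hxb hxa (Ne.symm hne) hab.symm h1 h2).symm
    have hvT : v ∈ T := (Finset.mem_insert.1 hv).resolve_left hvx
    refine (ih (T.erase v) x a b (by rw [Finset.card_erase_of_mem hvT, hT]; rfl)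
      (fun h => hx (Finset.mem_of_mem_erase h)) hxa hxb ?_).mono
        (Set.inter_subset_inter_left _ (by simp))
    rw [Finset.coe_erase]
    exact hab.remove_simplicial (fun s hs t ht => h1 s (by simp [Finset.mem_coe.1 hs]) t
      (by simp [Finset.mem_coe.1 ht])) (Ne.symm hva) (Ne.symm hvb)

/-- Neighbours of `x` that are connected outside `x` are connected in the link of `x`. -/
theorem connIn_link {S : Set V} {x a b : V} (hx : x ∉ S) (ha : G.Adj x a) (hb : G.Adj x b)
    (h : ConnIn G S a b) : ConnIn G (S ∩ G.neighborSet x) a b := by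
  obtain ⟨T, hT, h⟩ := h.exists_finset
  exact (hG.connIn_link_finset _ T x a b rfl (fun h => hx (hT h)) ha hb h).mono
    (Set.inter_subset_inter_left _ hT)

/-- In a complete graph on four vertices every vertex has valency three, so none is removable. -/
theorem not_adj_of_clique {a b c d : V} (hab : G.Adj a b) (hac : G.Adj a c) (had : G.Adj a d)
    (hbc : G.Adj b c) (hbd : G.Adj b d) : ¬ G.Adj c d := by
  classical
  intro hcd
  obtain ⟨v, hv, -, h⟩ := hG.removable {a, b, c, d} (by simp)
  simp only [Finset.mem_insert, Finset.mem_singleton] at hv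
  have h1 := hab.ne; have h2 := hac.ne; have h3 := had.ne
  have h4 := hbc.ne; have h5 := hbd.ne; have h6 := hcd.ne
  rcases hv with rfl | rfl | rfl | rfl
  · have := h b (by simp) c (by simp) d (by simp) hab hac had
    tauto
  · have := h a (by simp) c (by simp) d (by simp) hab.symm hbc hbd
    tauto
  · have := h a (by simp) b (by simp) d (by simp) hac.symm hbc.symm hcd
    tauto
  · have := h a (by simp) b (by simp) c (by simp) had.symm hbd.symm hcd.symm
    tauto

/-- The ends of an edge separate the third vertices of its two triangles. -/
theorem not_connIn_thirds {x y a b : V} (hxy : G.Adj x y) (hne : a ≠ b) (hxa : G.Adj x a)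
    (hya : G.Adj y a) (hxb : G.Adj x b) (hyb : G.Adj y b) : ¬ ConnIn G {x, y}ᶜ a b := by
  intro h
  -- Passing to the link of `x` and then to that of `y` pushes the path into the common neighbours
  -- of `x` and `y`. These are only `a` and `b`, which must then be adjacent, giving a clique on
  -- four vertices.
  have h1 := hG.connIn_link (x := x) (by simp) hxa hxb h
  have h2 := hG.connIn_link (x := y) (by simp) hya hyb h1
  obtain ⟨c, hc, h3⟩ := h2.exists_last hne
  obtain ⟨p, q, hpq, hthird⟩ := hG.thirds x y hxy
  have ha := (hthird a).1 ⟨hxa, hya⟩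
  have hb := (hthird b).1 ⟨hxb, hyb⟩
  have hc' := (hthird c).1 ⟨h3.right_mem.1.1.2, h3.right_mem.1.2⟩
  have hcb : c ≠ b := hc.ne
  have hca : c = a := by grind
  subst hca
  exact hG.not_adj_of_clique hxy hxa hxb hya hyb hc

/-- Given one triangle at an edge, the third vertex of the other one. -/
theorem exists_other {x y a : V} (hxy : G.Adj x y) (hxa : G.Adj x a) (hya : G.Adj y a) :
    ∃ b, b ≠ a ∧ G.Adj x b ∧ G.Adj y b ∧ ∀ z, G.Adj x z → G.Adj y z → z = a ∨ z = b := by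
  obtain ⟨p, q, hpq, h⟩ := hG.thirds x y hxy
  rcases (h a).1 ⟨hxa, hya⟩ with rfl | rfl
  · exact ⟨q, hpq.symm, ((h q).2 (.inr rfl)).1, ((h q).2 (.inr rfl)).2,
      fun z h1 h2 => (h z).1 ⟨h1, h2⟩⟩
  · exact ⟨p, hpq, ((h p).2 (.inl rfl)).1, ((h p).2 (.inl rfl)).2,
      fun z h1 h2 => ((h z).1 ⟨h1, h2⟩).symm⟩

theorem exists_third {x y : V} (hxy : G.Adj x y) : ∃ a, G.Adj x a ∧ G.Adj y a := by
  obtain ⟨p, q, hpq, h⟩ := hG.thirds x y hxy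
  exact ⟨p, (h p).2 (.inl rfl)⟩

end FareyModel

end Connectivity

/-! ### Gated sets and partial isomorphisms between them -/

section Gated

variable {V W : Type*} {G : SimpleGraph V} {H : SimpleGraph W}

/-- Every vertex `z` connected to `A` has a gate in `A`, a vertex of `A` that separates it
from `A`. -/
def Gated (G : SimpleGraph V) (A : Set V) : Prop :=
  ∀ z, ∀ a ∈ A, G.Reachable z a → ∃ w ∈ A, ∀ h ∈ A, Separates G w z h

/-- Any two vertices of `R` are connected, also after removing a further vertex. -/
structure TwoConnected (G : SimpleGraph V) (R : Set V) : Prop where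
  reachable : ∀ x ∈ R, ∀ y ∈ R, G.Reachable x y
  connIn : ∀ v, ∀ x ∈ R, ∀ y ∈ R, x ≠ v → y ≠ v → ConnIn G {v}ᶜ x y

namespace Gated

variable {A R S : Set V}

/-- Follow the path and record the gate of the current vertex. An excursion outside `A` keeps its
gate and can only return through it, so excursions can be cut out. -/
theorem connIn (hA : Gated G A) {u v : V} (h : ConnIn G S u v) (hu : u ∈ A) (hv : v ∈ A) :
    ConnIn G (S ∩ A) u v := by
  have key : ∃ g ∈ A, (∀ h ∈ A, Separates G g v h) ∧ ConnIn G (S ∩ A) u g := by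
    refine h.rec_tail ⟨u, hu, fun _ _ => .left, .refl ⟨h.1, hu⟩⟩ fun a b ha hab hb ih => ?_
    obtain ⟨g, hg, hsep, hconn⟩ := ih
    by_cases hgate : ∀ h ∈ A, Separates G g b h
    · exact ⟨g, hg, hgate, hconn⟩
    simp only [Separates, not_forall, not_not] at hgate
    obtain ⟨h', hh', hbh⟩ := hgate
    have hag : a = g := by
      by_contra hag
      exact hsep h' hh' ((ConnIn.of_adj hab hag hbh.left_mem).trans hbh)
    subst hag
    obtain ⟨w, hw, hsw⟩ := hA b a hg hab.symm.reachable
    rcases (hsw a hg).eq_of_adj hab.symm with rfl | rfl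
    · exact ⟨b, hw, fun _ _ => .left, hconn.tail hab ⟨hb, hw⟩⟩
    · exact absurd hbh (hsw h' hh')
  obtain ⟨g, hg, hsep, hconn⟩ := key
  have : v = g := by
    by_contra hne
    exact hsep v hv (.refl hne)
  exact this ▸ hconn

theorem mem_of_separates (hA : Gated G A) {u v w : V} (hu : u ∈ A) (hv : v ∈ A)
    (huv : G.Reachable u v) (hw : Separates G w u v) : w ∈ A := by
  by_contra hwA
  exact hw ((hA.connIn (ConnIn.univ_iff.2 huv) hu hv).mono
    fun z hz (h : z = w) => hwA (h ▸ hz.2))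

/-- The gate in `A` of a vertex of `R` outside `A` would separate it from both `u` and `v`. One of
these differs from the gate, against two-connectedness. -/
theorem subset_of_two (hA : Gated G A) (hR : TwoConnected G R) {u v : V} (huv : u ≠ v)
    (hu : u ∈ A) (hu' : u ∈ R) (hv : v ∈ A) (hv' : v ∈ R) : R ⊆ A := by
  intro c hc
  by_contra hcA
  obtain ⟨w, hw, h⟩ := hA c u hu (hR.reachable c hc u hu')
  have hcw : c ≠ w := fun h => hcA (h ▸ hw)
  by_cases huw : u = w
  · exact h v hv (hR.connIn w c hc v hv' hcw (huw ▸ huv.symm))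
  · exact h u hu (hR.connIn w c hc u hu' hcw huw)

theorem empty : Gated G (∅ : Set V) := fun _ _ h => h.elim

theorem singleton (x : V) : Gated G {x} := by
  rintro z _ rfl _
  exact ⟨_, rfl, fun h hh => hh ▸ .right⟩

/-- The gate of `r` in `A` must be `w`: a path from `r` to `w` inside `R` meets `A` only in `w`, so
it avoids any other candidate. -/
theorem separates_of_inter (hA : Gated G A) (hR : Gated G R) {w : V} (hwA : w ∈ A) (hwR : w ∈ R)
    (hAR : ∀ x ∈ A, x ∈ R → x = w) (hreach : ∀ r ∈ R, G.Reachable r w) {a r : V} (ha : a ∈ A)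
    (hr : r ∈ R) : Separates G w a r := by
  intro h
  obtain ⟨g, hg, hsep⟩ := hA r w hwA (hreach r hr)
  by_cases hgw : g = w
  · exact hsep a ha (hgw ▸ h.symm)
  · refine hsep w hwA ((hR.connIn (ConnIn.univ_iff.2 (hreach r hr)) hr hwR).mono ?_)
    exact fun z hz (hzg : z = g) => hgw (hAR g hg (hzg ▸ hz.2))

/-- If the gate of `z` in `A` is not `w`, it also separates `z` from `R`, which is reached through
`w`. If it is `w`, the gate of `z` in `R` serves for both sets. -/
theorem union (hA : Gated G A) (hR : Gated G R) {w : V} (hwA : w ∈ A) (hwR : w ∈ R)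
    (hAR : ∀ x ∈ A, x ∈ R → x = w) (hreach : ∀ r ∈ R, G.Reachable r w) : Gated G (A ∪ R) := by
  intro z a ha hza
  obtain ⟨a, ha, hza⟩ : ∃ a ∈ A, G.Reachable z a := by
    rcases ha with ha | ha
    · exact ⟨a, ha, hza⟩
    · exact ⟨w, hwA, hza.trans (hreach a ha)⟩
  obtain ⟨g, hg, hsep⟩ := hA z a ha hza
  by_cases hgw : g = w
  · subst hgw
    have hzw : G.Reachable z g := (hsep a ha).reachable hza
    obtain ⟨g', hg', hsep'⟩ := hR z g hwR hzw
    refine ⟨g', .inr hg', fun h hh => hh.elim (fun hh hc => ?_) (hsep' h)⟩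
    exact hsep' g hwR (hc.pass (hsep h hh))
  · refine ⟨g, .inl hg, fun h hh => hh.elim (hsep h) fun hh hc => ?_⟩
    refine hsep w hwA (hc.trans ((hR.connIn (ConnIn.univ_iff.2 (hreach h hh)) hh hwR).mono ?_))
    exact fun z hz (hzg : z = g) => hgw (hAR g hg (hzg ▸ hz.2))

theorem union_of_not_reachable (hA : Gated G A) (hR : Gated G R)
    (h : ∀ a ∈ A, ∀ r ∈ R, ¬ G.Reachable a r) : Gated G (A ∪ R) := by
  rintro z a (ha | ha) hza
  · obtain ⟨g, hg, hsep⟩ := hA z a ha hza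
    refine ⟨g, .inl hg, fun x hx => hx.elim (hsep x) fun hx hc => ?_⟩
    exact h a ha x hx (hza.symm.trans hc.reachable)
  · obtain ⟨g, hg, hsep⟩ := hR z a ha hza
    refine ⟨g, .inr hg, fun x hx => hx.elim (fun hx hc => ?_) (hsep x)⟩
    exact h x hx a ha (hc.reachable.symm.trans hza)

/-- Removing from a gated set components `bad x` of the complements of its vertices `x`. -/
theorem prune (hA : Gated G A) (bad : V → V → Prop)
    (hbad : ∀ x z z', bad x z → ConnIn G {x}ᶜ z z' → bad x z')
    (hmem : ∀ x z, bad x z → x ∈ A ∧ ∀ y, ¬ bad y x) :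
    Gated G {z | z ∈ A ∧ ∀ x, ¬ bad x z} := by
  rintro z a ⟨ha, ha'⟩ hza
  by_cases hz : ∃ x, bad x z
  · obtain ⟨x, hx⟩ := hz
    exact ⟨x, hmem x z hx, fun h hh hc => hh.2 x (hbad x z h hx hc)⟩
  push Not at hz
  obtain ⟨w, hw, hsep⟩ := hA z a ha hza
  by_cases hw' : ∃ x, bad x w
  · obtain ⟨x, hx⟩ := hw'
    refine ⟨x, hmem x w hx, fun h hh hc => hz x ?_⟩
    exact hbad x w z hx (hc.pass (hsep h hh.1)).symm
  · push Not at hw'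
    exact ⟨w, ⟨hw, hw'⟩, fun h hh => hsep h hh.1⟩

end Gated

/-- Let a path leave `R` from `x` to `b`. If `b` could return to `R` without `x`, two-connectedness
and `connIn_link` would give a path in the link of `x` from a neighbour in `R` to `b`. Consecutive
vertices of that path span triangles with `x`, so closure under third vertices would put `b` into
`R`. -/
theorem FareyModel.gated_of_twoConnected (hG : FareyModel G) {R : Set V} (hR : TwoConnected G R)
    (hadj : ∀ x ∈ R, ∃ y ∈ R, G.Adj x y)
    (htri : ∀ u ∈ R, ∀ v ∈ R, ∀ z, G.Adj u v → G.Adj u z → G.Adj v z → z ∈ R) : Gated G R := by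
  intro z a ha hza
  refine (ConnIn.univ_iff.2 hza.symm).rec_tail (P := fun z => ∃ w ∈ R, ∀ h ∈ R, Separates G w z h)
    ⟨a, ha, fun _ _ => .left⟩ fun x b _ hxb _ ih => ?_
  obtain ⟨g, hg, hsep⟩ := ih
  by_cases hb : b ∈ R
  · exact ⟨b, hb, fun _ _ => .left⟩
  refine ⟨g, hg, fun h hh hc => ?_⟩
  have hxg : x = g := by
    by_contra hxg
    exact hsep h hh ((ConnIn.of_adj hxb hxg hc.left_mem).trans hc)
  subst hxg
  obtain ⟨c, hcR, hxc⟩ := hadj x hg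
  have h1 := hR.connIn x h hh c hcR hc.right_mem hxc.ne'
  have h2 := hG.connIn_link (x := x) (by simp) hxc hxb (hc.trans h1).symm
  exact hb (h2.rec_tail hcR fun y z hy hyz hz hyR =>
    htri x hg y hyR z hy.right_mem.2 hz.2 hyz)

/-- A countable partial isomorphism between gated sets. -/
structure ClosedIso (G : SimpleGraph V) (H : SimpleGraph W) (r : Set (V × W)) : Prop where
  countable : r.Countable
  eq_iff : ∀ p ∈ r, ∀ q ∈ r, p.1 = q.1 ↔ p.2 = q.2
  adj_iff : ∀ p ∈ r, ∀ q ∈ r, G.Adj p.1 q.1 ↔ H.Adj p.2 q.2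
  gated_fst : Gated G (Prod.fst '' r)
  gated_snd : Gated H (Prod.snd '' r)

namespace ClosedIso

variable {r s : Set (V × W)}

theorem symm (hr : ClosedIso G H r) : ClosedIso H G (Prod.swap '' r) where
  countable := hr.countable.image _
  eq_iff := by
    rintro _ ⟨p, hp, rfl⟩ _ ⟨q, hq, rfl⟩
    exact (hr.eq_iff p hp q hq).symm
  adj_iff := by
    rintro _ ⟨p, hp, rfl⟩ _ ⟨q, hq, rfl⟩
    exact (hr.adj_iff p hp q hq).symm
  gated_fst := by simpa [Set.image_image] using hr.gated_snd
  gated_snd := by simpa [Set.image_image] using hr.gated_fst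

theorem empty : ClosedIso G H ∅ where
  countable := Set.countable_empty
  eq_iff := by simp
  adj_iff := by simp
  gated_fst := by simpa using Gated.empty
  gated_snd := by simpa using Gated.empty

theorem singleton (x : V) (y : W) : ClosedIso G H {(x, y)} where
  countable := Set.countable_singleton _
  eq_iff := by simp
  adj_iff := by simp
  gated_fst := by simpa using Gated.singleton x
  gated_snd := by simpa using Gated.singleton y

theorem diag {A : Set V} (hA : Gated G A) (hc : A.Countable) :
    ClosedIso G G ((fun z => (z, z)) '' A) where
  countable := hc.image _
  eq_iff := by
    rintro _ ⟨p, hp, rfl⟩ _ ⟨q, hq, rfl⟩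
    rfl
  adj_iff := by
    rintro _ ⟨p, hp, rfl⟩ _ ⟨q, hq, rfl⟩
    rfl
  gated_fst := by simpa [Set.image_image] using hA
  gated_snd := by simpa [Set.image_image] using hA

/-- Gated sets that meet only in `w` have no edges between them except at `w`, so adjacency needs to
be compared only inside `r` and inside `s`. -/
theorem glue (hr : ClosedIso G H r) (hs : ClosedIso G H s) {w : V} {w' : W} (hwr : (w, w') ∈ r)
    (hws : (w, w') ∈ s) (h1 : ∀ p ∈ r, ∀ q ∈ s, p.1 = q.1 → p.1 = w)
    (h2 : ∀ p ∈ r, ∀ q ∈ s, p.2 = q.2 → p.2 = w') (h3 : ∀ q ∈ s, G.Reachable q.1 w)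
    (h4 : ∀ q ∈ s, H.Reachable q.2 w') : ClosedIso G H (r ∪ s) := by
  have e1 : ∀ x ∈ Prod.fst '' r, x ∈ Prod.fst '' s → x = w := by
    rintro _ ⟨p, hp, rfl⟩ ⟨q, hq, h⟩
    exact h1 p hp q hq h.symm
  have e2 : ∀ x ∈ Prod.snd '' r, x ∈ Prod.snd '' s → x = w' := by
    rintro _ ⟨p, hp, rfl⟩ ⟨q, hq, h⟩
    exact h2 p hp q hq h.symm
  have e3 : ∀ x ∈ Prod.fst '' s, G.Reachable x w := by
    rintro _ ⟨q, hq, rfl⟩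
    exact h3 q hq
  have e4 : ∀ x ∈ Prod.snd '' s, H.Reachable x w' := by
    rintro _ ⟨q, hq, rfl⟩
    exact h4 q hq
  have m1 := Set.mem_image_of_mem Prod.fst hwr
  have m2 := Set.mem_image_of_mem Prod.fst hws
  have m3 := Set.mem_image_of_mem Prod.snd hwr
  have m4 := Set.mem_image_of_mem Prod.snd hws
  have keq : ∀ p ∈ r, ∀ q ∈ s, p.1 = q.1 ↔ p.2 = q.2 := by
    intro p hp q hq
    constructor
    · intro h
      have hpw := h1 p hp q hq h
      exact ((hr.eq_iff p hp _ hwr).1 hpw).trans ((hs.eq_iff q hq _ hws).1 (h ▸ hpw)).symm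
    · intro h
      have hpw := h2 p hp q hq h
      exact ((hr.eq_iff p hp _ hwr).2 hpw).trans ((hs.eq_iff q hq _ hws).2 (h ▸ hpw)).symm
  have kadj : ∀ p ∈ r, ∀ q ∈ s, G.Adj p.1 q.1 ↔ H.Adj p.2 q.2 := by
    intro p hp q hq
    have hw : p.1 = w ∨ q.1 = w → (G.Adj p.1 q.1 ↔ H.Adj p.2 q.2) := by
      rintro (h | h)
      · rw [h, (hr.eq_iff p hp _ hwr).1 h]
        exact hs.adj_iff _ hws q hq
      · rw [h, (hs.eq_iff q hq _ hws).1 h]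
        exact hr.adj_iff p hp _ hwr
    constructor
    · intro h
      exact (hw ((hr.gated_fst.separates_of_inter hs.gated_fst m1 m2 e1 e3 ⟨p, hp, rfl⟩
        ⟨q, hq, rfl⟩).eq_of_adj h)).1 h
    · intro h
      refine (hw (((hr.gated_snd.separates_of_inter hs.gated_snd m3 m4 e2 e4 ⟨p, hp, rfl⟩
        ⟨q, hq, rfl⟩).eq_of_adj h).imp ?_ ?_)).2 h
      · exact (hr.eq_iff p hp _ hwr).2
      · exact (hs.eq_iff q hq _ hws).2
  refine ⟨hr.countable.union hs.countable, ?_, ?_, ?_, ?_⟩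
  · rintro p (hp | hp) q (hq | hq)
    · exact hr.eq_iff p hp q hq
    · exact keq p hp q hq
    · exact eq_comm.trans ((keq q hq p hp).trans eq_comm)
    · exact hs.eq_iff p hp q hq
  · rintro p (hp | hp) q (hq | hq)
    · exact hr.adj_iff p hp q hq
    · exact kadj p hp q hq
    · rw [G.adj_comm, H.adj_comm]
      exact kadj q hq p hp
    · exact hs.adj_iff p hp q hq
  · rw [Set.image_union]
    exact hr.gated_fst.union hs.gated_fst m1 m2 e1 e3
  · rw [Set.image_union]
    exact hr.gated_snd.union hs.gated_snd m3 m4 e2 e4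

theorem union_of_not_reachable (hr : ClosedIso G H r) (hs : ClosedIso G H s)
    (h1 : ∀ p ∈ r, ∀ q ∈ s, ¬ G.Reachable p.1 q.1) (h2 : ∀ p ∈ r, ∀ q ∈ s, ¬ H.Reachable p.2 q.2) :
    ClosedIso G H (r ∪ s) := by
  have keq : ∀ p ∈ r, ∀ q ∈ s, p.1 = q.1 ↔ p.2 = q.2 := fun p hp q hq =>
    iff_of_false (fun h => h1 p hp q hq (h ▸ .refl _)) (fun h => h2 p hp q hq (h ▸ .refl _))
  have kadj : ∀ p ∈ r, ∀ q ∈ s, G.Adj p.1 q.1 ↔ H.Adj p.2 q.2 := fun p hp q hq =>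
    iff_of_false (fun h => h1 p hp q hq h.reachable) (fun h => h2 p hp q hq h.reachable)
  refine ⟨hr.countable.union hs.countable, ?_, ?_, ?_, ?_⟩
  · rintro p (hp | hp) q (hq | hq)
    · exact hr.eq_iff p hp q hq
    · exact keq p hp q hq
    · exact eq_comm.trans ((keq q hq p hp).trans eq_comm)
    · exact hs.eq_iff p hp q hq
  · rintro p (hp | hp) q (hq | hq)
    · exact hr.adj_iff p hp q hq
    · exact kadj p hp q hq
    · rw [G.adj_comm, H.adj_comm]
      exact kadj q hq p hp
    · exact hs.adj_iff p hp q hq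
  · rw [Set.image_union]
    refine hr.gated_fst.union_of_not_reachable hs.gated_fst ?_
    rintro _ ⟨p, hp, rfl⟩ _ ⟨q, hq, rfl⟩
    exact h1 p hp q hq
  · rw [Set.image_union]
    refine hr.gated_snd.union_of_not_reachable hs.gated_snd ?_
    rintro _ ⟨p, hp, rfl⟩ _ ⟨q, hq, rfl⟩
    exact h2 p hp q hq

/-- Gatedness pulls the path into the domain, where it can be transported edge by edge. Connectivity
and separation are thus read off inside the domain. -/
theorem connIn (hr : ClosedIso G H r) {w x y : V} {w' x' y' : W} (hw : (w, w') ∈ r)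
    (hx : (x, x') ∈ r) (hy : (y, y') ∈ r) (h : ConnIn G {w}ᶜ x y) : ConnIn H {w'}ᶜ x' y' := by
  have h' := hr.gated_fst.connIn h ⟨_, hx, rfl⟩ ⟨_, hy, rfl⟩
  have hne : ∀ p ∈ r, p.1 ≠ w → p.2 ≠ w' := fun p hp => mt (hr.eq_iff p hp _ hw).2
  refine h'.rec_tail (P := fun y => ∀ y', (y, y') ∈ r → ConnIn H {w'}ᶜ x' y') ?_ ?_ y' hy
  · intro y' hy'
    obtain rfl : x' = y' := (hr.eq_iff _ hx _ hy').1 rfl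
    exact .refl (hne _ hx h.left_mem)
  · intro a b ha hab hb ih y' hy'
    obtain ⟨⟨a, a'⟩, haa, rfl⟩ := ha.right_mem.2
    exact (ih a' haa).tail ((hr.adj_iff _ haa _ hy').1 hab) (hne _ hy' hb.1)

theorem separates (hr : ClosedIso G H r) {w x y : V} {w' x' y' : W} (hw : (w, w') ∈ r)
    (hx : (x, x') ∈ r) (hy : (y, y') ∈ r) (h : Separates G w x y) : Separates H w' x' y' :=
  fun h' => h (hr.symm.connIn (x := x') (y := y') (w := w') ⟨_, hw, rfl⟩ ⟨_, hx, rfl⟩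
    ⟨_, hy, rfl⟩ h')

end ClosedIso

end Gated

/-! ### One step of the construction of the Farey graph -/

namespace BicolouredGraph

variable (F : BicolouredGraph)

/-- A vertex of `F` in the extended graph. -/
def old (v : F.V) : F.extend.V := (Sum.inl v : F.V ⊕ F.blue.edgeSet)

/-- The new vertex over a blue edge. -/
def new (e : F.blue.edgeSet) : F.extend.V := (Sum.inr e : F.V ⊕ F.blue.edgeSet)

theorem old_injective : Function.Injective F.old := Sum.inl_injective

theorem new_injective : Function.Injective F.new := Sum.inr_injective

theorem old_ne_new (v : F.V) (e : F.blue.edgeSet) : F.old v ≠ F.new e := fun h => nomatch h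

theorem extend_cases (a : F.extend.V) : (∃ v, a = F.old v) ∨ ∃ e, a = F.new e := by
  rcases (a : F.V ⊕ F.blue.edgeSet) with v | e
  · exact .inl ⟨v, rfl⟩
  · exact .inr ⟨e, rfl⟩

theorem extend_black_adj (a b : F.extend.V) : F.extend.black.Adj a b ↔
    ∃ u v, F.total.Adj u v ∧ a = F.old u ∧ b = F.old v := by
  refine (SimpleGraph.map_adj _ _ _ _).trans ?_
  exact ⟨fun ⟨u, v, h, h1, h2⟩ => ⟨u, v, h, h1.symm, h2.symm⟩,
    fun ⟨u, v, h, h1, h2⟩ => ⟨u, v, h, h1.symm, h2.symm⟩⟩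

theorem extend_blue_adj (a b : F.extend.V) : F.extend.blue.Adj a b ↔
    ∃ (e : F.blue.edgeSet) (v : F.V), v ∈ e.1 ∧
      (a = F.new e ∧ b = F.old v ∨ a = F.old v ∧ b = F.new e) := by
  refine (SimpleGraph.fromRel_adj _ _ _).trans ⟨?_, ?_⟩
  · rintro ⟨-, ⟨e, v, h1, h2, h⟩ | ⟨e, v, h1, h2, h⟩⟩
    · exact ⟨e, v, h, .inl ⟨h1, h2⟩⟩
    · exact ⟨e, v, h, .inr ⟨h2, h1⟩⟩
  · rintro ⟨e, v, h, ⟨rfl, rfl⟩ | ⟨rfl, rfl⟩⟩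
    · exact ⟨(F.old_ne_new v e).symm, .inl ⟨e, v, rfl, rfl, h⟩⟩
    · exact ⟨F.old_ne_new v e, .inr ⟨e, v, rfl, rfl, h⟩⟩

theorem extend_total_adj (a b : F.extend.V) : F.extend.total.Adj a b ↔
    F.extend.black.Adj a b ∨ F.extend.blue.Adj a b := Iff.rfl

theorem extend_total_inl_inl (u v : F.V) :
    F.extend.total.Adj (F.old u) (F.old v) ↔ F.total.Adj u v := by
  rw [extend_total_adj, extend_black_adj, extend_blue_adj]
  constructor
  · rintro (⟨u', v', h, h1, h2⟩ | ⟨e, v', h, ⟨h1, h2⟩ | ⟨h1, h2⟩⟩)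
    · rwa [F.old_injective h1, F.old_injective h2]
    · exact absurd h1 (F.old_ne_new _ _)
    · exact absurd h2 (F.old_ne_new _ _)
  · exact fun h => .inl ⟨u, v, h, rfl, rfl⟩

theorem extend_total_inr_inl (e : F.blue.edgeSet) (v : F.V) :
    F.extend.total.Adj (F.new e) (F.old v) ↔ v ∈ e.1 := by
  rw [extend_total_adj, extend_black_adj, extend_blue_adj]
  constructor
  · rintro (⟨u', v', h, h1, h2⟩ | ⟨f, v', h, ⟨h1, h2⟩ | ⟨h1, h2⟩⟩)
    · exact absurd h1.symm (F.old_ne_new _ _)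
    · rwa [F.new_injective h1, F.old_injective h2]
    · exact absurd h2 (F.old_ne_new _ _)
  · exact fun h => .inr ⟨e, v, h, .inl ⟨rfl, rfl⟩⟩

theorem extend_total_inl_inr (e : F.blue.edgeSet) (v : F.V) :
    F.extend.total.Adj (F.old v) (F.new e) ↔ v ∈ e.1 :=
  (SimpleGraph.adj_comm _ _ _).trans (F.extend_total_inr_inl e v)

theorem extend_total_inr_inr (e f : F.blue.edgeSet) :
    ¬ F.extend.total.Adj (F.new e) (F.new f) := by
  rw [extend_total_adj, extend_black_adj, extend_blue_adj]
  rintro (⟨u', v', h, h1, h2⟩ | ⟨f, v', h, ⟨h1, h2⟩ | ⟨h1, h2⟩⟩)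
  · exact absurd h1.symm (F.old_ne_new _ _)
  · exact absurd h2.symm (F.old_ne_new _ _)
  · exact absurd h1.symm (F.old_ne_new _ _)

theorem extend_blue_edge {e : Sym2 F.extend.V} (he : e ∈ F.extend.blue.edgeSet) :
    ∃ (f : F.blue.edgeSet) (v : F.V), v ∈ f.1 ∧ e = s(F.new f, F.old v) := by
  induction e with
  | _ a b =>
    obtain ⟨f, v, h, ⟨rfl, rfl⟩ | ⟨rfl, rfl⟩⟩ := (F.extend_blue_adj a b).1 he
    · exact ⟨f, v, h, rfl⟩
    · exact ⟨f, v, h, Sym2.eq_swap⟩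

theorem edge_ends {e : Sym2 F.V} (he : e ∈ F.blue.edgeSet) :
    ∃ x y, e = s(x, y) ∧ F.total.Adj x y := by
  induction e with
  | _ a b => exact ⟨a, b, rfl, .inr he⟩

theorem exists_mem_edge_ne {e : Sym2 F.V} (he : e ∈ F.blue.edgeSet) (v : F.V) :
    ∃ u ∈ e, u ≠ v := by
  obtain ⟨x, y, rfl, h⟩ := F.edge_ends he
  by_cases hx : x = v
  · exact ⟨y, by simp, fun hy => h.ne (hx.trans hy.symm)⟩
  · exact ⟨x, by simp, hx⟩

/-- The connectivity properties of the levels of the Farey graph. -/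
structure Good : Prop where
  exists_adj : ∀ v, ∃ u, F.total.Adj v u
  conn : ∀ x y, ConnIn F.total Set.univ x y
  conn_vertex : ∀ v x y, x ≠ v → y ≠ v → ConnIn F.total {v}ᶜ x y
  conn_edge : ∀ e ∈ F.blue.edgeSet, ∀ x y, x ∉ e → y ∉ e → ConnIn F.total {z | z ∉ e} x y
  third : ∀ e ∈ F.blue.edgeSet, ∃ o, ∀ v ∈ e, F.total.Adj o v

variable {F}

theorem connIn_extend {S : Set F.V} {S' : Set F.extend.V}
    (hS : ∀ x ∈ S, (F.old x) ∈ S') {x y : F.V}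
    (h : ConnIn F.total S x y) : ConnIn F.extend.total S' (F.old x)
      (F.old y) :=
  h.rec_tail (.refl (hS _ h.left_mem)) fun a b _ hab hb ih =>
    ih.tail ((F.extend_total_inl_inl a b).2 hab) (hS _ hb)

/-- Every new vertex in `S'` has an old neighbour in `S`, so connectivity of the old part suffices.
-/
theorem connIn_extend_of_forall (S : Set F.V) (S' : Set F.extend.V)
    (hS : ∀ x ∈ S, F.old x ∈ S') (hl : ∀ x, F.old x ∈ S' → x ∈ S)
    (hr : ∀ e : F.blue.edgeSet, F.new e ∈ S' → ∃ v ∈ e.1, v ∈ S)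
    (h : ∀ x ∈ S, ∀ y ∈ S, ConnIn F.total S x y) (x y : F.extend.V) (hx : x ∈ S') (hy : y ∈ S') :
    ConnIn F.extend.total S' x y := by
  have key : ∀ x, x ∈ S' → ∃ x0 ∈ S, ConnIn F.extend.total S' x (F.old x0) := by
    intro x hx
    rcases F.extend_cases x with ⟨x, rfl⟩ | ⟨e, rfl⟩
    · exact ⟨x, hl x hx, .refl hx⟩
    · obtain ⟨v, hv, hvS⟩ := hr e hx
      exact ⟨v, hvS, .of_adj ((F.extend_total_inr_inl e v).2 hv) hx (hS v hvS)⟩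
  obtain ⟨x0, hx0, h1⟩ := key x hx
  obtain ⟨y0, hy0, h2⟩ := key y hy
  exact h1.trans ((connIn_extend hS (h x0 hx0 y0 hy0)).trans h2.symm)

/-- A blue edge of the extension joins the new vertex over `f` to an end `v` of `f`. Removing its
two ends amounts to removing `v` from the old graph, so `conn_edge` comes from `conn_vertex`; the
other end of `f` is the third vertex. -/
theorem Good.extend (hF : F.Good) : F.extend.Good where
  exists_adj a := by
    rcases F.extend_cases a with ⟨v, rfl⟩ | ⟨e, rfl⟩
    · obtain ⟨u, hu⟩ := hF.exists_adj v
      exact ⟨F.old u, (F.extend_total_inl_inl v u).2 hu⟩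
    · obtain ⟨x, y, he, h⟩ := F.edge_ends e.2
      exact ⟨F.old x, (F.extend_total_inr_inl e x).2 (by simp [he])⟩
  conn x y := by
    refine connIn_extend_of_forall Set.univ Set.univ (fun _ _ => trivial) (fun _ _ => trivial)
      (fun e _ => ?_) (fun x _ y _ => hF.conn x y) x y trivial trivial
    obtain ⟨x, y, he, h⟩ := F.edge_ends e.2
    exact ⟨x, by simp [he], trivial⟩
  conn_vertex a x y hx hy := by
    rcases F.extend_cases a with ⟨v, rfl⟩ | ⟨f, rfl⟩
    · exact connIn_extend_of_forall {v}ᶜ {F.old v}ᶜ (fun x hx h => hx (F.old_injective h))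
        (fun x hx h => hx (congrArg _ h)) (fun e _ => F.exists_mem_edge_ne e.2 v)
        (fun x hx y hy => hF.conn_vertex v x y hx hy) x y hx hy
    · refine connIn_extend_of_forall Set.univ {F.new f}ᶜ (fun x _ => F.old_ne_new x f)
        (fun x _ => trivial) (fun e _ => ?_) (fun x _ y _ => hF.conn x y) x y hx hy
      obtain ⟨x, y, he, h⟩ := F.edge_ends e.2
      exact ⟨x, by simp [he], trivial⟩
  conn_edge e he x y hx hy := by
    obtain ⟨f, v, hv, rfl⟩ := F.extend_blue_edge he
    refine connIn_extend_of_forall {v}ᶜ {z | z ∉ s(F.new f, F.old v)} (fun x hx h => ?_)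
      (fun x hx h => hx ?_) (fun e _ => F.exists_mem_edge_ne e.2 v)
      (fun x hx y hy => hF.conn_vertex v x y hx hy) x y hx hy
    · rcases Sym2.mem_iff.1 h with h | h
      · exact F.old_ne_new x f h
      · exact hx (F.old_injective h)
    · exact Sym2.mem_iff.2 (.inr (congrArg _ h))
  third e he := by
    obtain ⟨f, v, hv, rfl⟩ := F.extend_blue_edge he
    obtain ⟨u, hu, huv⟩ := F.exists_mem_edge_ne f.2 v
    refine ⟨F.old u, fun z hz => ?_⟩
    rcases Sym2.mem_iff.1 hz with rfl | rfl
    · exact (F.extend_total_inl_inr f u).2 hu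
    · refine (F.extend_total_inl_inl u v).2 (.inr ?_)
      have := (Sym2.mem_and_mem_iff huv).1 ⟨hu, hv⟩
      rw [← SimpleGraph.mem_edgeSet, ← this]
      exact f.2

end BicolouredGraph

/-! ### The finite levels of the Farey graph -/

section Levels

open BicolouredGraph

theorem fareyLevel_zero_adj (i j : Fin 4) :
    (fareyLevel 0).total.Adj i j ↔ i ≠ j ∧ (i.1 < 2 ∨ j.1 < 2) := by
  have h : (fareyLevel 0).total.Adj i j ↔ (s(i, j) = s(0, 1) ∧ i ≠ j) ∨
      ((s(i, j) = s(0, 2) ∨ s(i, j) = s(1, 2) ∨ s(i, j) = s(0, 3) ∨ s(i, j) = s(1, 3)) ∧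
        i ≠ j) := by
    change (SimpleGraph.fromEdgeSet _).Adj i j ∨ (SimpleGraph.fromEdgeSet _).Adj i j ↔ _
    rw [SimpleGraph.fromEdgeSet_adj, SimpleGraph.fromEdgeSet_adj]
    rfl
  refine h.trans ?_
  clear h
  revert i j
  decide

theorem fareyLevel_zero_blue {e : Sym2 (Fin 4)} (he : e ∈ (fareyLevel 0).blue.edgeSet) :
    e = s(0, 2) ∨ e = s(1, 2) ∨ e = s(0, 3) ∨ e = s(1, 3) := by
  have : e ∈ (SimpleGraph.fromEdgeSet
    ({s(0, 2), s(1, 2), s(0, 3), s(1, 3)} : Set (Sym2 (Fin 4)))).edgeSet := he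
  rw [SimpleGraph.edgeSet_fromEdgeSet] at this
  simpa using this.1

theorem fareyLevel_zero_connIn (S : Set (Fin 4)) {x y : Fin 4} (hx : x ∈ S) (hy : y ∈ S)
    (h : x = y ∨ (x.1 < 2 ∨ y.1 < 2) ∨ ∃ z ∈ S, z.1 < 2) :
    ConnIn (fareyLevel 0).total S x y := by
  have adj : ∀ {x y : Fin 4}, x ∈ S → y ∈ S → (x.1 < 2 ∨ y.1 < 2) →
      ConnIn (fareyLevel 0).total S x y := by
    intro x y hx hy h
    by_cases hxy : x = y
    · exact hxy ▸ ConnIn.refl hx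
    · exact ConnIn.of_adj ((fareyLevel_zero_adj x y).2 ⟨hxy, h⟩) hx hy
  rcases h with rfl | h | ⟨z, hz, h⟩
  · exact .refl hx
  · exact adj hx hy h
  · exact (adj hx hz (.inr h)).trans (adj hz hy (.inl h))

theorem fareyLevel_zero_good : (fareyLevel 0).Good where
  exists_adj v := by
    by_cases hv : v = (0 : Fin 4)
    · exact ⟨(1 : Fin 4), (fareyLevel_zero_adj v 1).2 ⟨hv ▸ (by decide), .inr (by decide)⟩⟩
    · exact ⟨(0 : Fin 4), (fareyLevel_zero_adj v 0).2 ⟨hv, .inr (by decide)⟩⟩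
  conn x y := fareyLevel_zero_connIn _ trivial trivial (.inr (.inr ⟨0, trivial, by decide⟩))
  conn_vertex v x y hx hy := by
    refine fareyLevel_zero_connIn {v}ᶜ hx hy (.inr (.inr ?_))
    by_cases hv : v = (0 : Fin 4)
    · exact ⟨1, by rw [hv]; exact (by decide : (1 : Fin 4) ≠ 0), by decide⟩
    · exact ⟨0, Ne.symm hv, by decide⟩
  conn_edge e he x y hx hy := by
    refine fareyLevel_zero_connIn {z | z ∉ e} hx hy (.inr (.inr ?_))
    rcases fareyLevel_zero_blue he with rfl | rfl | rfl | rfl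
    · exact ⟨(1 : Fin 4), fun h => absurd (Sym2.mem_iff.1 h) (by decide), by decide⟩
    · exact ⟨(0 : Fin 4), fun h => absurd (Sym2.mem_iff.1 h) (by decide), by decide⟩
    · exact ⟨(1 : Fin 4), fun h => absurd (Sym2.mem_iff.1 h) (by decide), by decide⟩
    · exact ⟨(0 : Fin 4), fun h => absurd (Sym2.mem_iff.1 h) (by decide), by decide⟩
  third e he := by
    rcases fareyLevel_zero_blue he with rfl | rfl | rfl | rfl
    · refine ⟨(1 : Fin 4), fun v hv => (fareyLevel_zero_adj 1 v).2 ?_⟩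
      rcases Sym2.mem_iff.1 hv with rfl | rfl <;> decide
    · refine ⟨(0 : Fin 4), fun v hv => (fareyLevel_zero_adj 0 v).2 ?_⟩
      rcases Sym2.mem_iff.1 hv with rfl | rfl <;> decide
    · refine ⟨(1 : Fin 4), fun v hv => (fareyLevel_zero_adj 1 v).2 ?_⟩
      rcases Sym2.mem_iff.1 hv with rfl | rfl <;> decide
    · refine ⟨(0 : Fin 4), fun v hv => (fareyLevel_zero_adj 0 v).2 ?_⟩
      rcases Sym2.mem_iff.1 hv with rfl | rfl <;> decide

theorem fareyLevel_good (k : ℕ) : (fareyLevel k).Good := by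
  induction k with
  | zero => exact fareyLevel_zero_good
  | succ k ih => exact ih.extend

/-- The inclusion of a level of the Farey graph in the next one. -/
def fareyIncl (k : ℕ) (v : (fareyLevel k).V) : (fareyLevel (k + 1)).V := (fareyLevel k).old v

theorem fareyIncl_injective (k : ℕ) : Function.Injective (fareyIncl k) := Sum.inl_injective

theorem fareyIncl_adj (k : ℕ) (u v : (fareyLevel k).V) :
    (fareyLevel (k + 1)).total.Adj (fareyIncl k u) (fareyIncl k v) ↔ (fareyLevel k).total.Adj u v :=
  (fareyLevel k).extend_total_inl_inl u v

/-- The inclusion of a level of the Farey graph in the next one, as an embedding. -/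
def fareyInclEmbedding (k : ℕ) : (fareyLevel k).total ↪g (fareyLevel (k + 1)).total where
  toFun := fareyIncl k
  inj' := fareyIncl_injective k
  map_rel_iff' := fareyIncl_adj k _ _

/-- A blue edge has a third vertex in its own level and a new one in the next. A black edge is the
first edge or was an edge one level earlier, where induction applies. -/
theorem fareyLevel_thirds (k : ℕ) : ∀ u v, (fareyLevel k).total.Adj u v →
    ∃ a b, a ≠ b ∧ (fareyLevel (k + 1)).total.Adj (fareyIncl k u) a ∧
      (fareyLevel (k + 1)).total.Adj (fareyIncl k v) a ∧
      (fareyLevel (k + 1)).total.Adj (fareyIncl k u) b ∧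
      (fareyLevel (k + 1)).total.Adj (fareyIncl k v) b := by
  have blue : ∀ u v, (fareyLevel k).blue.Adj u v →
    ∃ a b, a ≠ b ∧ (fareyLevel (k + 1)).total.Adj (fareyIncl k u) a ∧
      (fareyLevel (k + 1)).total.Adj (fareyIncl k v) a ∧
      (fareyLevel (k + 1)).total.Adj (fareyIncl k u) b ∧
      (fareyLevel (k + 1)).total.Adj (fareyIncl k v) b := by
    intro u v h
    obtain ⟨o, ho⟩ := (fareyLevel_good k).third s(u, v) h
    refine ⟨fareyIncl k o,
      (fareyLevel k).new ⟨s(u, v), h⟩,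
      (fareyLevel k).old_ne_new _ _, (fareyIncl_adj k _ _).2 (ho u (by simp)).symm,
      (fareyIncl_adj k _ _).2 (ho v (by simp)).symm,
      ((fareyLevel k).extend_total_inl_inr _ _).2 (by simp),
      ((fareyLevel k).extend_total_inl_inr _ _).2 (by simp)⟩
  induction k with
  | zero =>
    rintro u v (h | h)
    · have h' : s(u, v) ∈ ({s(0, 1)} : Set (Sym2 (Fin 4))) :=
        ((SimpleGraph.fromEdgeSet_adj _).1 h).1
      have h2 : (fareyLevel 0).total.Adj u (2 : Fin 4) ∧ (fareyLevel 0).total.Adj v (2 : Fin 4) ∧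
          (fareyLevel 0).total.Adj u (3 : Fin 4) ∧ (fareyLevel 0).total.Adj v (3 : Fin 4) := by
        have h3 : ∀ i j : Fin 4, s(i, j) = s(0, 1) → (i ≠ 2 ∧ (i.1 < 2 ∨ (2 : Fin 4).1 < 2)) ∧
            (j ≠ 2 ∧ (j.1 < 2 ∨ (2 : Fin 4).1 < 2)) ∧ (i ≠ 3 ∧ (i.1 < 2 ∨ (3 : Fin 4).1 < 2)) ∧
            (j ≠ 3 ∧ (j.1 < 2 ∨ (3 : Fin 4).1 < 2)) := by decide
        obtain ⟨h4, h5, h6, h7⟩ := h3 u v h'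
        exact ⟨(fareyLevel_zero_adj u 2).2 h4, (fareyLevel_zero_adj v 2).2 h5,
          (fareyLevel_zero_adj u 3).2 h6, (fareyLevel_zero_adj v 3).2 h7⟩
      exact ⟨fareyIncl 0 (2 : Fin 4), fareyIncl 0 (3 : Fin 4),
        fun h => (by decide : (2 : Fin 4) ≠ 3) (fareyIncl_injective 0 h),
        (fareyIncl_adj 0 _ _).2 h2.1, (fareyIncl_adj 0 _ _).2 h2.2.1,
        (fareyIncl_adj 0 _ _).2 h2.2.2.1, (fareyIncl_adj 0 _ _).2 h2.2.2.2⟩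
    · exact blue u v h
  | succ k ih =>
    rintro u v (h | h)
    · obtain ⟨u, v, huv, rfl, rfl⟩ := ((fareyLevel k).extend_black_adj _ _).1 h
      obtain ⟨a, b, hab, h1, h2, h3, h4⟩ := ih (fun u v h => by
        obtain ⟨o, ho⟩ := (fareyLevel_good k).third s(u, v) h
        exact ⟨fareyIncl k o, (fareyLevel k).new ⟨s(u, v), h⟩,
          (fareyLevel k).old_ne_new _ _, (fareyIncl_adj k _ _).2 (ho u (by simp)).symm,
          (fareyIncl_adj k _ _).2 (ho v (by simp)).symm,
          ((fareyLevel k).extend_total_inl_inr _ _).2 (by simp),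
          ((fareyLevel k).extend_total_inl_inr _ _).2 (by simp)⟩) u v huv
      exact ⟨fareyIncl (k + 1) a, fareyIncl (k + 1) b, fun h => hab (fareyIncl_injective _ h),
        (fareyIncl_adj (k + 1) _ _).2 h1, (fareyIncl_adj (k + 1) _ _).2 h2,
        (fareyIncl_adj (k + 1) _ _).2 h3, (fareyIncl_adj (k + 1) _ _).2 h4⟩
    · exact blue u v h

end Levels

/-! ### Copies of the Farey graph in models -/

section Embeddings

open BicolouredGraph

variable {V : Type*} {G : SimpleGraph V}

theorem connIn_map {W : Type*} {H : SimpleGraph W} (t : H ↪g G) {S : Set W} {S' : Set V}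
    (hS : ∀ x ∈ S, t x ∈ S') {x y : W} (h : ConnIn H S x y) : ConnIn G S' (t x) (t y) :=
  h.rec_tail (.refl (hS _ h.left_mem)) fun _ _ _ hab hb ih =>
    ih.tail (t.map_adj_iff.2 hab) (hS _ hb)

/-- The new vertex over a blue edge `e` goes to the third vertex in `G` on the side not yet used.
All old vertices off `e` are connected to the used side outside `e`, so the ends of `e` separate
them from the new vertex. This excludes every unwanted coincidence or edge. -/
theorem FareyModel.exists_extend (hG : FareyModel G) {F : BicolouredGraph} (hF : F.Good)
    (t : F.total ↪g G) : ∃ t' : F.extend.total ↪g G,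
      ∀ v, t' (F.old v) = t v := by
  have key : ∀ e : F.blue.edgeSet, ∃ z, (∀ v ∈ e.1, z ≠ t v) ∧ (∀ v ∈ e.1, G.Adj z (t v)) ∧
      ∀ u ∉ e.1, ¬ ConnIn G {x | ∀ v ∈ e.1, x ≠ t v} z (t u) := by
    intro e
    obtain ⟨x, y, he, hxy⟩ := F.edge_ends e.2
    obtain ⟨o, ho⟩ := hF.third e.1 e.2
    have hox := ho x (by simp [he])
    have hoy := ho y (by simp [he])
    obtain ⟨b, hbo, hxb, hyb, -⟩ := hG.exists_other (t.map_adj_iff.2 hxy)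
      (t.map_adj_iff.2 hox.symm) (t.map_adj_iff.2 hoy.symm)
    refine ⟨b, ?_, ?_, fun u hu hc => ?_⟩
    · rw [he]
      simpa using ⟨hxb.ne', hyb.ne'⟩
    · rw [he]
      simpa using ⟨hxb.symm, hyb.symm⟩
    · have h1 := hF.conn_edge e.1 e.2 o u (fun h => (ho o h).ne rfl) hu
      have h2 := connIn_map t (S' := {t x, t y}ᶜ) (fun z hz => ?_) h1
      · refine hG.not_connIn_thirds (t.map_adj_iff.2 hxy) hbo.symm (t.map_adj_iff.2 hox.symm)
          (t.map_adj_iff.2 hoy.symm) hxb hyb (h2.trans (hc.symm.mono fun z hz => ?_))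
        rw [he] at hz
        simpa using hz
      · rw [he] at hz
        simpa [t.injective.eq_iff] using hz
  choose z hz1 hz2 hz3 using key
  have hz4 : ∀ e u, z e ≠ t u := fun e u h => by
    by_cases hu : u ∈ e.1
    · exact hz1 e u hu h
    · refine hz3 e u hu (h ▸ .refl ?_)
      exact fun v hv => hz1 e v hv
  have hz5 : ∀ e u, G.Adj (z e) (t u) ↔ u ∈ e.1 := fun e u => by
    refine ⟨fun h => ?_, hz2 e u⟩
    by_contra hu
    exact hz3 e u hu (.of_adj h (fun v hv => hz1 e v hv)
      fun v hv hvu => hu (t.injective hvu ▸ hv))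
  -- For two new vertices, an end of `f` outside `e` is an old vertex adjacent to one of them. If
  -- the new vertices were equal or adjacent, the other would be connected to it outside `e`.
  have hz6 : ∀ e f : F.blue.edgeSet, e ≠ f → ∃ u ∈ f.1, u ∉ e.1 := by
    intro e f hef
    obtain ⟨x, y, hf, hxy⟩ := F.edge_ends f.2
    by_contra! h
    refine hef (Subtype.ext ?_)
    rw [hf]
    exact (Sym2.mem_and_mem_iff hxy.ne).1 ⟨h x (by simp [hf]), h y (by simp [hf])⟩
  have hz7 : ∀ e f, z e = z f → e = f := by
    intro e f h
    by_contra hef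
    obtain ⟨u, huf, hue⟩ := hz6 e f hef
    exact hue ((hz5 e u).1 (h ▸ (hz5 f u).2 huf))
  have hz8 : ∀ e f, ¬ G.Adj (z e) (z f) := by
    intro e f h
    by_cases hef : e = f
    · exact (hef ▸ h).ne rfl
    obtain ⟨u, huf, hue⟩ := hz6 e f hef
    refine hz3 e u hue ((ConnIn.of_adj (S := {x | ∀ v ∈ e.1, x ≠ t v}) h
      (fun v hv => hz1 e v hv) (fun v _ => hz4 f v)).tail ((hz5 f u).2 huf) fun v hv hvu => hue (t.injective hvu ▸ hv))
  let g : F.extend.V → V := (Sum.elim t z : F.V ⊕ F.blue.edgeSet → V)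
  have hg1 : ∀ v, g (F.old v) = t v := fun v => rfl
  have hg2 : ∀ e, g (F.new e) = z e := fun v => rfl
  clear_value g
  refine ⟨⟨⟨g, fun a b h => ?_⟩, fun {a b} => ?_⟩, hg1⟩
  · rcases F.extend_cases a with ⟨u, rfl⟩ | ⟨e, rfl⟩ <;>
      rcases F.extend_cases b with ⟨v, rfl⟩ | ⟨f, rfl⟩ <;> simp only [hg1, hg2] at h
    · exact congrArg _ (t.injective h)
    · exact absurd h.symm (hz4 f u)
    · exact absurd h (hz4 e v)
    · exact congrArg _ (hz7 e f h)
  · change G.Adj (g a) (g b) ↔ _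
    rcases F.extend_cases a with ⟨u, rfl⟩ | ⟨e, rfl⟩ <;>
      rcases F.extend_cases b with ⟨v, rfl⟩ | ⟨f, rfl⟩ <;> simp only [hg1, hg2]
    · exact t.map_adj_iff.trans (F.extend_total_inl_inl u v).symm
    · exact (G.adj_comm _ _).trans ((hz5 f u).trans (F.extend_total_inl_inr f u).symm)
    · exact (hz5 e v).trans (F.extend_total_inr_inl e v).symm
    · exact iff_of_false (hz8 e f) (F.extend_total_inr_inr e f)

/-- There is no choice for a new vertex: the ends of its blue edge have only two common neighbours,
and one of them is occupied by an old vertex. -/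
theorem FareyModel.extend_unique (hG : FareyModel G) {F : BicolouredGraph} (hF : F.Good)
    (t t' : F.extend.total ↪g G) (h : ∀ v : F.V, t (F.old v) =
      t' (F.old v)) : t = t' := by
  refine DFunLike.ext _ _ ?_
  intro a
  rcases F.extend_cases a with ⟨v, rfl⟩ | ⟨e, rfl⟩
  · exact h v
  obtain ⟨x, y, he, hxy⟩ := F.edge_ends e.2
  obtain ⟨o, ho⟩ := hF.third e.1 e.2
  have hx : x ∈ e.1 := by simp [he]
  have hy : y ∈ e.1 := by simp [he]
  have hxo := t.map_adj_iff.2 ((F.extend_total_inl_inl x o).2 (ho x hx).symm)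
  have hyo := t.map_adj_iff.2 ((F.extend_total_inl_inl y o).2 (ho y hy).symm)
  obtain ⟨b, hbo, hxb, hyb, hb⟩ := hG.exists_other
    (t.map_adj_iff.2 ((F.extend_total_inl_inl x y).2 hxy)) hxo hyo
  have h1 := (hb _ (t.map_adj_iff.2 ((F.extend_total_inl_inr e x).2 hx))
    (t.map_adj_iff.2 ((F.extend_total_inl_inr e y).2 hy))).resolve_left
      fun h => F.old_ne_new _ _ (t.injective h).symm
  rw [h1]
  rw [h x] at hxb hxo
  rw [h y] at hyb hyo
  refine ((hb _ ?_ ?_).resolve_left ?_).symm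
  · rw [h x]
    exact t'.map_adj_iff.2 ((F.extend_total_inl_inr e x).2 hx)
  · rw [h y]
    exact t'.map_adj_iff.2 ((F.extend_total_inl_inr e y).2 hy)
  · rw [h o]
    exact fun h => F.old_ne_new _ _ (t'.injective h).symm

/-- Every embedding of a level of the Farey graph belongs to a compatible family of embeddings of
all levels. -/
theorem FareyModel.exists_family (hG : FareyModel G) (k : ℕ) (t : (fareyLevel k).total ↪g G) :
    ∃ τ : ∀ l, (fareyLevel l).total ↪g G, τ k = t ∧ ∀ l v, τ (l + 1) (fareyIncl l v) = τ l v := by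
  induction k with
  | zero =>
    choose ext hext using fun (k : ℕ) (t : (fareyLevel k).total ↪g G) =>
      hG.exists_extend (fareyLevel_good k) t
    exact ⟨fun l => Nat.rec t ext l, rfl, fun l v => hext l _ v⟩
  | succ k ih =>
    -- Restrict `t` to the lower level and extend the restriction. Uniqueness shows that the
    -- resulting family contains `t` itself.
    obtain ⟨τ, h1, h2⟩ := ih (t.comp (fareyInclEmbedding k))
    refine ⟨τ, hG.extend_unique (fareyLevel_good k) _ _ fun v => ?_, h2⟩
    exact (h2 k v).trans (DFunLike.congr_fun h1 v)

theorem FareyVertex.mk_incl (k : ℕ) (v : (fareyLevel k).V) :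
    FareyVertex.mk (k + 1) (fareyIncl k v) = FareyVertex.mk k v :=
  (Quot.sound ⟨k, v, rfl, rfl⟩).symm

theorem FareyVertex.exists_mk (a : FareyVertex) : ∃ k v, a = FareyVertex.mk k v := by
  induction a using Quot.ind with
  | _ a => exact ⟨a.1, a.2, rfl⟩

theorem FareyVertex.lift_level {k l : ℕ} (h : k ≤ l) (v : (fareyLevel k).V) :
    ∃ v', FareyVertex.mk k v = FareyVertex.mk l v' := by
  induction l, h using Nat.le_induction with
  | base => exact ⟨v, rfl⟩
  | succ l _ ih =>
    obtain ⟨v', h⟩ := ih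
    exact ⟨fareyIncl l v', by rw [h, mk_incl]⟩

/-- Finitely many vertices of the Farey graph occur in a common level. -/
theorem FareyVertex.exists_level (s : Finset FareyVertex) :
    ∃ k, ∀ a ∈ s, ∃ v, a = FareyVertex.mk k v := by
  choose lev v hv using FareyVertex.exists_mk
  refine ⟨s.sup lev, fun a ha => ?_⟩
  obtain ⟨v', h⟩ := FareyVertex.lift_level (Finset.le_sup ha : lev a ≤ _) (v a)
  exact ⟨v', (hv a).trans h⟩

theorem fareyGraph_adj_mk {k : ℕ} {u v : (fareyLevel k).V} (h : (fareyLevel k).total.Adj u v)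
    (hne : FareyVertex.mk k u ≠ FareyVertex.mk k v) :
    fareyGraph.Adj (FareyVertex.mk k u) (FareyVertex.mk k v) :=
  (SimpleGraph.fromRel_adj _ _ _).2 ⟨hne, .inl ⟨k, u, v, rfl, rfl, h⟩⟩

theorem fareyGraph_adj_exists {a b : FareyVertex} (h : fareyGraph.Adj a b) :
    ∃ k u v, a = FareyVertex.mk k u ∧ b = FareyVertex.mk k v ∧ (fareyLevel k).total.Adj u v := by
  obtain ⟨-, ⟨k, u, v, h1, h2, h⟩ | ⟨k, u, v, h1, h2, h⟩⟩ := (SimpleGraph.fromRel_adj _ _ _).1 h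
  · exact ⟨k, u, v, h1, h2, h⟩
  · exact ⟨k, v, u, h2, h1, h.symm⟩

theorem exists_embedding_of_family (τ : ∀ l, (fareyLevel l).total ↪g G)
    (hτ : ∀ l v, τ (l + 1) (fareyIncl l v) = τ l v) :
    ∃ Φ : fareyGraph ↪g G, ∀ l v, Φ (FareyVertex.mk l v) = τ l v := by
  classical
  let f : FareyVertex → V := Quot.lift (fun a => τ a.1 a.2) (by
    rintro a b ⟨k, v, rfl, rfl⟩
    exact (hτ k v).symm)
  have hf : ∀ l v, f (FareyVertex.mk l v) = τ l v := fun l v => rfl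
  have hinj : Function.Injective f := by
    intro a b h
    obtain ⟨k, hk⟩ := FareyVertex.exists_level {a, b}
    obtain ⟨u, rfl⟩ := hk a (by simp)
    obtain ⟨v, rfl⟩ := hk b (by simp)
    exact congrArg _ ((τ k).injective h)
  refine ⟨⟨⟨f, hinj⟩, fun {a b} => ⟨fun h => ?_, fun h => ?_⟩⟩, hf⟩
  · obtain ⟨k, hk⟩ := FareyVertex.exists_level {a, b}
    obtain ⟨u, rfl⟩ := hk a (by simp)
    obtain ⟨v, rfl⟩ := hk b (by simp)
    have h' : G.Adj (τ k u) (τ k v) := h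
    exact fareyGraph_adj_mk ((τ k).map_adj_iff.1 h') fun he => h.ne (congrArg f he)
  · obtain ⟨k, u, v, rfl, rfl, huv⟩ := fareyGraph_adj_exists h
    exact (show G.Adj (τ k u) (τ k v) from (τ k).map_adj_iff.2 huv)

theorem FareyModel.exists_embedding (hG : FareyModel G) (k : ℕ) (t : (fareyLevel k).total ↪g G) :
    ∃ Φ : fareyGraph ↪g G, ∀ v, Φ (FareyVertex.mk k v) = t v := by
  obtain ⟨τ, h1, h2⟩ := hG.exists_family k t
  obtain ⟨Φ, h⟩ := exists_embedding_of_family τ h2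
  exact ⟨Φ, fun v => h1 ▸ h k v⟩

theorem FareyModel.exists_level_zero (hG : FareyModel G) {a b : V} (hab : G.Adj a b) :
    ∃ t : (fareyLevel 0).total ↪g G, t (0 : Fin 4) = a ∧ t (1 : Fin 4) = b := by
  obtain ⟨c, d, hcd, h⟩ := hG.thirds a b hab
  obtain ⟨hac, hbc⟩ := (h c).2 (.inl rfl)
  obtain ⟨had, hbd⟩ := (h d).2 (.inr rfl)
  have hncd := hG.not_adj_of_clique hab hac had hbc hbd
  have hndc : ¬ G.Adj d c := fun h => hncd h.symm
  have h1 : ∀ i j : Fin 4, (![a, b, c, d] : Fin 4 → V) i = ![a, b, c, d] j → i = j := by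
    simp [Fin.forall_fin_succ, hab.ne, hab.ne', hac.ne, hac.ne', had.ne, had.ne', hbc.ne, hbc.ne',
      hbd.ne, hbd.ne', hcd, hcd.symm]
  have h2 : ∀ i j : Fin 4, G.Adj ((![a, b, c, d] : Fin 4 → V) i) (![a, b, c, d] j) ↔
      i ≠ j ∧ (i.1 < 2 ∨ j.1 < 2) := by
    simp [Fin.forall_fin_succ, hab, hab.symm, hac, hac.symm, had, had.symm, hbc, hbc.symm,
      hbd, hbd.symm, hncd, hndc]
  exact ⟨⟨⟨(![a, b, c, d] : Fin 4 → V), fun i j => h1 i j⟩,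
    fun {i j} => (h2 i j).trans (fareyLevel_zero_adj i j).symm⟩, rfl, rfl⟩

/-- The edge of the Farey graph at which the construction starts, first end. -/
def fareyZero : FareyVertex := FareyVertex.mk 0 (0 : Fin 4)

/-- The edge of the Farey graph at which the construction starts, second end. -/
def fareyOne : FareyVertex := FareyVertex.mk 0 (1 : Fin 4)

/-- Every edge is the image of the first edge of the Farey graph under an embedding. -/
theorem FareyModel.exists_embedding_edge (hG : FareyModel G) {a b : V} (hab : G.Adj a b) :
    ∃ Φ : fareyGraph ↪g G, Φ fareyZero = a ∧ Φ fareyOne = b := by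
  obtain ⟨t, h0, h1⟩ := hG.exists_level_zero hab
  obtain ⟨Φ, h⟩ := hG.exists_embedding 0 t
  exact ⟨Φ, (h _).trans h0, (h _).trans h1⟩

/-- The levels are induced subgraphs of the Farey graph. -/
theorem FareyModel.exists_mk_embedding [Nonempty V] (hG : FareyModel G) (k : ℕ) :
    ∃ ι : (fareyLevel k).total ↪g fareyGraph, ∀ v, ι v = FareyVertex.mk k v := by
  obtain ⟨a⟩ := ‹Nonempty V›
  obtain ⟨b, hab⟩ := hG.exists_adj a
  obtain ⟨t, -⟩ := hG.exists_level_zero hab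
  obtain ⟨τ, -, h2⟩ := hG.exists_family 0 t
  obtain ⟨Φ, h⟩ := exists_embedding_of_family τ h2
  -- The quotient is controlled through the model: composed with `Φ`, the map from the level into
  -- the union becomes the embedding `τ k`.
  refine ⟨⟨⟨FareyVertex.mk k, fun u v huv => (τ k).injective ?_⟩, fun {u v} => ?_⟩, fun _ => rfl⟩
  · rw [← h, ← h, huv]
  · change fareyGraph.Adj (FareyVertex.mk k u) (FareyVertex.mk k v) ↔ _
    rw [← Φ.map_adj_iff, h, h, (τ k).map_adj_iff]

instance : Countable FareyVertex := by
  have : ∀ k, Countable (fareyLevel k).V := fun k => Finite.to_countable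
  exact inferInstanceAs (Countable (Quot _))

namespace FareyModel

variable [Nonempty V] (hG : FareyModel G)
include hG

theorem exists_level_two (a b : FareyVertex) : ∃ (k : ℕ) (ι : (fareyLevel k).total ↪g fareyGraph)
    (u v : (fareyLevel k).V), a = ι u ∧ b = ι v := by
  classical
  obtain ⟨k, hk⟩ := FareyVertex.exists_level {a, b}
  obtain ⟨ι, hι⟩ := hG.exists_mk_embedding k
  obtain ⟨u, hu⟩ := hk a (by simp)
  obtain ⟨v, hv⟩ := hk b (by simp)
  exact ⟨k, ι, u, v, hu.trans (hι u).symm, hv.trans (hι v).symm⟩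

theorem exists_level_three (a b c : FareyVertex) :
    ∃ (k : ℕ) (ι : (fareyLevel k).total ↪g fareyGraph)
      (u v w : (fareyLevel k).V), a = ι u ∧ b = ι v ∧ c = ι w ∧
      ∀ v, ι v = FareyVertex.mk k v := by
  classical
  obtain ⟨k, hk⟩ := FareyVertex.exists_level {a, b, c}
  obtain ⟨ι, hι⟩ := hG.exists_mk_embedding k
  obtain ⟨u, hu⟩ := hk a (by simp)
  obtain ⟨v, hv⟩ := hk b (by simp)
  obtain ⟨w, hw⟩ := hk c (by simp)
  exact ⟨k, ι, u, v, w, hu.trans (hι u).symm, hv.trans (hι v).symm, hw.trans (hι w).symm, hι⟩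

theorem fareyGraph_thirds {a b : FareyVertex} (h : fareyGraph.Adj a b) : ∃ c d, c ≠ d ∧
    fareyGraph.Adj a c ∧ fareyGraph.Adj b c ∧ fareyGraph.Adj a d ∧ fareyGraph.Adj b d := by
  obtain ⟨k, u, v, rfl, rfl, huv⟩ := fareyGraph_adj_exists h
  obtain ⟨ι, hι⟩ := hG.exists_mk_embedding (k + 1)
  obtain ⟨c, d, hcd, h1, h2, h3, h4⟩ := fareyLevel_thirds k u v huv
  refine ⟨ι c, ι d, fun h => hcd (ι.injective h), ?_⟩
  rw [← FareyVertex.mk_incl k u, ← FareyVertex.mk_incl k v, ← hι, ← hι]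
  exact ⟨ι.map_adj_iff.2 h1, ι.map_adj_iff.2 h2, ι.map_adj_iff.2 h3, ι.map_adj_iff.2 h4⟩

theorem fareyGraph_exists_adj (a : FareyVertex) : ∃ b, fareyGraph.Adj a b := by
  obtain ⟨k, ι, u, v, rfl, -⟩ := hG.exists_level_two a a
  obtain ⟨w, hw⟩ := (fareyLevel_good k).exists_adj u
  exact ⟨ι w, ι.map_adj_iff.2 hw⟩

/-- The Farey graph embeds in `G`. This bounds the number of triangles at an edge by two and
transfers removability; the two triangles themselves come from the levels. -/
theorem fareyGraph_model : FareyModel fareyGraph where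
  exists_adj := hG.fareyGraph_exists_adj
  thirds a b hab := by
    obtain ⟨x⟩ := ‹Nonempty V›
    obtain ⟨y, hxy⟩ := hG.exists_adj x
    obtain ⟨Φ, -⟩ := hG.exists_embedding_edge hxy
    obtain ⟨c, d, hcd, h1, h2, h3, h4⟩ := hG.fareyGraph_thirds hab
    refine ⟨c, d, hcd, fun z => ⟨fun hz => ?_, ?_⟩⟩
    · obtain ⟨p, q, -, h⟩ := hG.thirds _ _ (Φ.map_adj_iff.2 hab)
      have e1 := (h (Φ c)).1 ⟨Φ.map_adj_iff.2 h1, Φ.map_adj_iff.2 h2⟩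
      have e2 := (h (Φ d)).1 ⟨Φ.map_adj_iff.2 h3, Φ.map_adj_iff.2 h4⟩
      have e3 := (h (Φ z)).1 ⟨Φ.map_adj_iff.2 hz.1, Φ.map_adj_iff.2 hz.2⟩
      have e4 : Φ c ≠ Φ d := fun h => hcd (Φ.injective h)
      have e5 : Φ z = Φ c ∨ Φ z = Φ d := by grind
      exact e5.imp (fun h => Φ.injective h) (fun h => Φ.injective h)
    · rintro (rfl | rfl)
      · exact ⟨h1, h2⟩
      · exact ⟨h3, h4⟩
  removable T hT := by
    obtain ⟨x⟩ := ‹Nonempty V›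
    obtain ⟨y, hxy⟩ := hG.exists_adj x
    obtain ⟨Φ, -⟩ := hG.exists_embedding_edge hxy
    obtain ⟨v, hv, h1, h2⟩ := hG.removable (T.map Φ.toEmbedding) (by simpa using hT)
    have hm : ∀ s ∈ T, Φ s ∈ T.map Φ.toEmbedding := fun s hs =>
      Finset.mem_map_of_mem Φ.toEmbedding hs
    obtain ⟨v, hvT, rfl⟩ := Finset.mem_map.1 hv
    refine ⟨v, hvT, fun s hs t ht hvs hvt hst => ?_, fun r hr s hs t ht hvr hvs hvt => ?_⟩
    · exact Φ.map_adj_iff.1 (h1 (Φ s) (hm s hs) (Φ t) (hm t ht) (Φ.map_adj_iff.2 hvs)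
        (Φ.map_adj_iff.2 hvt) fun h => hst (Φ.injective h))
    · exact (h2 (Φ r) (hm r hr) (Φ s) (hm s hs) (Φ t) (hm t ht) (Φ.map_adj_iff.2 hvr)
        (Φ.map_adj_iff.2 hvs) (Φ.map_adj_iff.2 hvt)).imp (fun h => Φ.injective h)
        (Or.imp (fun h => Φ.injective h) (fun h => Φ.injective h))

omit [Nonempty V] hG in
theorem fareyVertex_connIn {W : Type*} [Nonempty W] {H : SimpleGraph W} (hH : FareyModel H)
    (Φ : fareyGraph ↪g G) (v : V) (a b : FareyVertex) (ha : Φ a ≠ v) (hb : Φ b ≠ v) :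
    ConnIn G {v}ᶜ (Φ a) (Φ b) := by
  by_cases hv : ∃ c, Φ c = v
  · obtain ⟨c, rfl⟩ := hv
    obtain ⟨k, ι, u, v, w, rfl, rfl, rfl, -⟩ := hH.exists_level_three a b c
    refine connIn_map Φ (S := {ι w}ᶜ) (S' := {Φ (ι w)}ᶜ) (fun x hx h => hx (Φ.injective h)) (connIn_map ι (S := {w}ᶜ) (S' := {ι w}ᶜ)
      (fun x hx h => hx (ι.injective h)) ((fareyLevel_good k).conn_vertex w u v ?_ ?_))
    · rintro rfl
      exact ha rfl
    · rintro rfl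
      exact hb rfl
  · obtain ⟨k, ι, u, v', rfl, rfl⟩ := hH.exists_level_two a b
    exact connIn_map Φ (S := Set.univ) (S' := {v}ᶜ) (fun x _ h => hv ⟨x, h⟩) (connIn_map ι (S := Set.univ)
      (S' := Set.univ) (fun x hx => trivial) ((fareyLevel_good k).conn u v'))

omit hG [Nonempty V] in
theorem twoConnected_range_aux {W : Type*} [Nonempty W] {H : SimpleGraph W} (hH : FareyModel H)
    (Φ : fareyGraph ↪g G) : TwoConnected G (Set.range Φ) where
  reachable := by
    rintro _ ⟨a, rfl⟩ _ ⟨b, rfl⟩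
    obtain ⟨k, ι, u, v, rfl, rfl⟩ := hH.exists_level_two a b
    exact ConnIn.univ_iff.1 (connIn_map Φ (S := Set.univ) (S' := Set.univ) (fun _ _ => trivial)
      (connIn_map ι (S := Set.univ) (S' := Set.univ) (fun _ _ => trivial) ((fareyLevel_good k).conn u v)))
  connIn := by
    rintro v _ ⟨a, rfl⟩ _ ⟨b, rfl⟩ ha hb
    exact fareyVertex_connIn hH Φ v a b ha hb

theorem twoConnected_range (Φ : fareyGraph ↪g G) : TwoConnected G (Set.range Φ) :=
  twoConnected_range_aux hG Φ

theorem fareyGraph_twoConnected : TwoConnected fareyGraph Set.univ := by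
  have h := twoConnected_range_aux hG (SimpleGraph.Embedding.refl (G := fareyGraph))
  rwa [show Set.range (SimpleGraph.Embedding.refl (G := fareyGraph)) = Set.univ from
    Set.range_id] at h

/-- An edge of the copy already has two triangles inside the copy, hence none leaves it, and
`gated_of_twoConnected` applies. -/
theorem gated_range (Φ : fareyGraph ↪g G) : Gated G (Set.range Φ) := by
  refine hG.gated_of_twoConnected (hG.twoConnected_range Φ) ?_ ?_
  · rintro _ ⟨a, rfl⟩
    obtain ⟨b, hb⟩ := hG.fareyGraph_exists_adj a
    exact ⟨Φ b, ⟨b, rfl⟩, Φ.map_adj_iff.2 hb⟩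
  · rintro _ ⟨a, rfl⟩ _ ⟨b, rfl⟩ z hab haz hbz
    obtain ⟨c, d, hcd, h1, h2, h3, h4⟩ := hG.fareyGraph_thirds (Φ.map_adj_iff.1 hab)
    obtain ⟨p, q, -, h⟩ := hG.thirds _ _ hab
    have e1 := (h (Φ c)).1 ⟨Φ.map_adj_iff.2 h1, Φ.map_adj_iff.2 h2⟩
    have e2 := (h (Φ d)).1 ⟨Φ.map_adj_iff.2 h3, Φ.map_adj_iff.2 h4⟩
    have e3 := (h z).1 ⟨haz, hbz⟩
    have e4 : Φ c ≠ Φ d := fun h => hcd (Φ.injective h)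
    have e5 : z = Φ c ∨ z = Φ d := by grind
    exact e5.elim (fun h => ⟨c, h.symm⟩) (fun h => ⟨d, h.symm⟩)

theorem range_eq {Φ Ψ : fareyGraph ↪g G} {u v : V} (huv : u ≠ v) (hu : u ∈ Set.range Φ)
    (hv : v ∈ Set.range Φ) (hu' : u ∈ Set.range Ψ) (hv' : v ∈ Set.range Ψ) :
    Set.range Φ = Set.range Ψ :=
  Set.Subset.antisymm
    ((hG.gated_range Ψ).subset_of_two (hG.twoConnected_range Φ) huv hu' hu hv' hv)
    ((hG.gated_range Φ).subset_of_two (hG.twoConnected_range Ψ) huv hu hu' hv hv')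

/-- Provides the idle third point when a configuration is used for only two vertices. -/
theorem exists_vertex_ne (p q : FareyVertex) : ∃ r, r ≠ p ∧ r ≠ q := by
  obtain ⟨b, hb⟩ := hG.fareyGraph_exists_adj fareyZero
  obtain ⟨c, d, hcd, h1, h2, h3, h4⟩ := hG.fareyGraph_thirds hb
  have := hb.ne; have := h1.ne; have := h2.ne
  by_cases e1 : b ≠ p ∧ b ≠ q
  · exact ⟨b, e1⟩
  by_cases e2 : c ≠ p ∧ c ≠ q
  · exact ⟨c, e2⟩
  exact ⟨fareyZero, by grind, by grind⟩

/-- Two embeddings of the Farey graph give a partial isomorphism between gated sets. -/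
theorem closedIso_range {W : Type*} [Nonempty W] {H : SimpleGraph W} (hH : FareyModel H)
    (Φ : fareyGraph ↪g G) (Ψ : fareyGraph ↪g H) :
    ClosedIso G H (Set.range fun p => (Φ p, Ψ p)) where
  countable := Set.countable_range _
  eq_iff := by
    rintro _ ⟨p, rfl⟩ _ ⟨q, rfl⟩
    exact Φ.injective.eq_iff.trans Ψ.injective.eq_iff.symm
  adj_iff := by
    rintro _ ⟨p, rfl⟩ _ ⟨q, rfl⟩
    exact Φ.map_adj_iff.trans Ψ.map_adj_iff.symm
  gated_fst := by
    rw [← Set.range_comp]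
    exact hG.gated_range Φ
  gated_snd := by
    rw [← Set.range_comp]
    exact hH.gated_range Ψ

end FareyModel

end Embeddings

/-! ### Automorphisms with fixed points -/

section Rigidity

variable {V : Type*} {G : SimpleGraph V}

namespace FareyModel

variable (hG : FareyModel G) (hC : TwoConnected G Set.univ)

include hG in
/-- No vertex is connected to all three vertices of a triangle outside the opposite edges. -/
theorem triangle_not_center {x y a z : V} (hxy : G.Adj x y) (hxa : G.Adj x a) (hya : G.Adj y a)
    (h1 : ConnIn G {a, x}ᶜ z y) (h2 : ConnIn G {a, y}ᶜ z x) (h3 : ConnIn G {x, y}ᶜ z a) :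
    False := by
  have hzx : z ≠ x := fun h => h1.left_mem (by simp [h])
  have hzy : z ≠ y := fun h => h2.left_mem (by simp [h])
  have hza : z ≠ a := fun h => h1.left_mem (by simp [h])
  obtain ⟨u, huy, hu⟩ := h1.exists_last hzy
  obtain ⟨u', hux, hu'⟩ := h2.exists_last hzx
  obtain ⟨u'', hua, hu''⟩ := h3.exists_last hza
  -- All three vertices of the triangle have a neighbour in the component of `z` outside the
  -- triangle.
  have e1 : ConnIn G {x, y, a}ᶜ z u := hu.mono (by grind)
  have e2 : ConnIn G {x, y, a}ᶜ z u' := hu'.mono (by grind)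
  have e3 : ConnIn G {x, y, a}ᶜ z u'' := hu''.mono (by grind)
  have e4 : ConnIn G {x, a}ᶜ u' y :=
    ((e2.symm.trans e1).mono (by grind)).tail huy (by grind [hxy.ne, hya.ne])
  -- In the link of `x` this produces the third vertex `c ≠ a` at the edge `xy`, inside the
  -- component of `z`. So `c` is connected to `a` outside the edge, which is impossible.
  have e5 := hG.connIn_link (x := x) (by simp) hux.symm hxy e4
  obtain ⟨c, hcy, hc⟩ := e5.exists_last fun h => e2.right_mem (by simp [h])
  have hcm := hc.right_mem
  have hca : c ≠ a := by
    rintro rfl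
    exact hcm.1.1 (by simp)
  have e6 : ConnIn G {x, y, a}ᶜ u' c := hc.mono (by
    rintro w ⟨⟨hw1, hw2⟩, hw3⟩
    grind)
  refine hG.not_connIn_thirds hxy hca hcm.1.2 hcy.symm hxa hya ?_
  exact ((e6.symm.trans (e2.symm.trans e3)).mono (by grind)).tail hua
    (by grind [hxa.ne, hya.ne])

include hG hC

/-- Go from `z` to the link of `y` without `x`, then inside this link towards `x`. The last vertex
before `x` is a common neighbour of `x` and `y`. -/
theorem connIn_third_or {x y a b z : V} (hxy : G.Adj x y)
    (hab : ∀ c, G.Adj x c → G.Adj y c → c = a ∨ c = b) (hzx : z ≠ x) (hzy : z ≠ y) :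
    ConnIn G {x, y}ᶜ z a ∨ ConnIn G {x, y}ᶜ z b := by
  obtain ⟨c, hcy, hc⟩ := (hC.connIn x z trivial y trivial hzx hxy.ne').exists_last hzy
  have hcx : c ≠ x := hc.right_mem.1
  have h1 := hG.connIn_link (x := y) (by simp) hcy.symm hxy.symm
    (hC.connIn y c trivial x trivial hcy.ne hxy.ne)
  obtain ⟨d, hdx, hd⟩ := h1.exists_last hcx
  have h2 : ConnIn G {x, y}ᶜ z d := by
    refine (hc.mono ?_).trans (hd.mono ?_)
    · rintro w ⟨hw1, hw2⟩
      grind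
    · rintro w ⟨⟨hw1, -⟩, hw2⟩
      grind
  rcases hab d hdx.symm hd.right_mem.1.2 with rfl | rfl
  · exact .inl h2
  · exact .inr h2

/-- Let a path from `q` first enter the link of `p` at `u`, and let `c` be the third vertex at the
edge `pu` on the side of `q`. Then `uc` separates, since otherwise `q` would be connected to each
vertex of the triangle `puc` outside the opposite edge, against `triangle_not_center`. -/
theorem exists_separating_edge {p q : V} (hne : p ≠ q) (hpq : ¬ G.Adj p q) :
    ∃ x y, G.Adj p x ∧ G.Adj p y ∧ G.Adj x y ∧ ¬ ConnIn G {x, y}ᶜ q p := by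
  have h0 : ∃ u v, G.Adj p u ∧ G.Adj v u ∧ ConnIn G {z | z ≠ p ∧ ¬ G.Adj p z} q v := by
    have hqp := ConnIn.univ_iff.2 (hC.reachable q trivial p trivial)
    refine (hqp.rec_tail (P := fun z => ConnIn G {z | z ≠ p ∧ ¬ G.Adj p z} q z ∨
      ∃ u v, G.Adj p u ∧ G.Adj v u ∧ ConnIn G {z | z ≠ p ∧ ¬ G.Adj p z} q v)
      (.inl (.refl ⟨hne.symm, hpq⟩)) fun a b _ hab _ ih => ?_).resolve_left
        fun h => h.right_mem.1 rfl
    rcases ih with ih | ih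
    · by_cases hb : b ≠ p ∧ ¬ G.Adj p b
      · exact .inl (ih.tail hab hb)
      · refine .inr ⟨b, a, ?_, hab, ih⟩
        by_contra hpb
        have hbp : b = p := by
          by_contra hbp
          exact hb ⟨hbp, hpb⟩
        exact ih.right_mem.2 (hbp ▸ hab.symm)
    · exact .inr ih
  obtain ⟨u, v, hpu, hvu, hqv⟩ := h0
  have hqu : q ≠ u := fun h => hpq (h ▸ hpu)
  obtain ⟨a, b, hab, h⟩ := hG.thirds p u hpu
  have key : ∀ c, G.Adj p c → G.Adj u c → ConnIn G {p, u}ᶜ q c →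
      ∃ x y, G.Adj p x ∧ G.Adj p y ∧ G.Adj x y ∧ ¬ ConnIn G {x, y}ᶜ q p := by
    intro c hpc huc hc
    refine ⟨u, c, hpu, hpc, huc, fun hcon => ?_⟩
    have h1 : ConnIn G {c, p}ᶜ q u := by
      refine (hqv.mono fun z hz => ?_).tail hvu (by grind [huc.ne, hpu.ne])
      rintro (rfl | rfl)
      · exact hz.2 hpc
      · exact hz.1 rfl
    refine hG.triangle_not_center hpu hpc huc h1 ?_ hc
    rwa [Set.pair_comm]
  rcases hG.connIn_third_or hC hpu (fun c h1 h2 => (h c).1 ⟨h1, h2⟩) hne.symm hqu with h' | h'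
  · exact key a ((h a).2 (.inl rfl)).1 ((h a).2 (.inl rfl)).2 h'
  · exact key b ((h b).2 (.inr rfl)).1 ((h b).2 (.inr rfl)).2 h'

/-- The third vertex `b ≠ p` at `xy` is connected to `q` by a path that contains no neighbour of
`p`. If `x` or `y` were not on the second edge, the path could be continued through it to `p`.
Consequently an automorphism fixing `p` and `q` preserves this edge as a set. -/
theorem separating_edge_unique {p q x y x' y' : V} (hpq : ¬ G.Adj p q)
    (hpx : G.Adj p x) (hpy : G.Adj p y) (hxy : G.Adj x y) (h : ¬ ConnIn G {x, y}ᶜ q p)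
    (hpx' : G.Adj p x') (hpy' : G.Adj p y') (h' : ¬ ConnIn G {x', y'}ᶜ q p) :
    (x = x' ∨ x = y') ∧ (y = x' ∨ y = y') := by
  have hq : ∀ w, G.Adj p w → q ≠ w := fun w hw h => hpq (h ▸ hw)
  obtain ⟨b, hbp, hxb, hyb, hb⟩ := hG.exists_other hxy hpx.symm hpy.symm
  have h1 := (hG.connIn_third_or hC hxy hb (hq x hpx) (hq y hpy)).resolve_left h
  have hpm : p ∈ ({x, y} : Set V)ᶜ := by grind [hpx.ne, hpy.ne]
  have key : ∀ w S, G.Adj p w → S ⊆ ({x, y} : Set V)ᶜ → ConnIn G S q b →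
      ConnIn G (S ∩ {w}ᶜ) q b := by
    intro w S hpw hS hS'
    refine (hS'.avoid_or (hq w hpw)).resolve_right fun hc => h ?_
    exact (hc.mono hS).tail hpw.symm hpm
  have h2 := key y' _ hpy' Set.inter_subset_left (key x' _ hpx' subset_rfl h1)
  have h3 : ConnIn G {x', y'}ᶜ q b := h2.mono (by
    rintro w ⟨⟨-, hw1⟩, hw2⟩
    grind)
  have hpm' : p ∈ ({x', y'} : Set V)ᶜ := by grind [hpx'.ne, hpy'.ne]
  constructor
  · by_contra hx
    exact h' ((h3.tail hxb.symm (by grind)).tail hpx.symm hpm')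
  · by_contra hy
    exact h' ((h3.tail hyb.symm (by grind)).tail hpy.symm hpm')

omit hC in
theorem fix_thirds (σ : G ≃g G) {p u a : V} (hpu : G.Adj p u) (hpa : G.Adj p a) (hua : G.Adj u a)
    (hp : σ p = p) (hu : σ u = u) (ha : σ a = a) (c : V) (hpc : G.Adj p c) (huc : G.Adj u c) :
    σ c = c := by
  obtain ⟨b, hba, hpb, hub, h⟩ := hG.exists_other hpu hpa hua
  rcases h c hpc huc with rfl | rfl
  · exact ha
  · have h1 := σ.map_adj_iff.2 hpb
    have h2 := σ.map_adj_iff.2 hub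
    rw [hp] at h1
    rw [hu] at h2
    refine (h _ h1 h2).resolve_left fun h3 => hba (σ.injective (h3.trans ha.symm))

/-- The link of `p` is connected and each edge at `p` has only two third vertices, so being fixed
spreads from one triangle along the link. -/
theorem fix_link (σ : G ≃g G) {p x y : V} (hpx : G.Adj p x) (hpy : G.Adj p y) (hxy : G.Adj x y)
    (hp : σ p = p) (hx : σ x = x) (hy : σ y = y) (v : V) (hpv : G.Adj p v) : σ v = v := by
  have h := hG.connIn_link (x := p) (by simp) hpx hpv
    (hC.connIn p x trivial v trivial hpx.ne' hpv.ne')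
  refine (h.rec_tail (P := fun u => σ u = u ∧ ∀ c, G.Adj p c → G.Adj u c → σ c = c)
    ⟨hx, hG.fix_thirds σ hpx hpy hxy hp hx hy⟩ fun a b ha hab hb ih => ?_).1
  have hσb := ih.2 b hb.2 hab
  exact ⟨hσb, hG.fix_thirds σ hb.2 ha.right_mem.2 hab.symm hp hσb ih.1⟩

/-- An automorphism that fixes the vertices of a triangle is trivial. -/
theorem fix_all (σ : G ≃g G) {p x y : V} (hpx : G.Adj p x) (hpy : G.Adj p y) (hxy : G.Adj x y)
    (hp : σ p = p) (hx : σ x = x) (hy : σ y = y) (v : V) : σ v = v := by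
  have h := ConnIn.univ_iff.2 (hC.reachable p trivial v trivial)
  refine (h.rec_tail (P := fun u => σ u = u ∧ ∀ c, G.Adj u c → σ c = c)
    ⟨hp, hG.fix_link hC σ hpx hpy hxy hp hx hy⟩ fun a b ha hab hb ih => ?_).1
  have hσb := ih.2 b hab
  obtain ⟨c, hac, hbc⟩ := hG.exists_third hab
  exact ⟨hσb, hG.fix_link hC σ hab.symm hbc hac hσb ih.1 (ih.2 c hac)⟩

/-- An automorphism that fixes an edge and swaps its sides has no further fixed points. -/
theorem not_fixed_of_swap_sides (σ : G ≃g G) {x y a b z : V} (hxy : G.Adj x y) (hxa : G.Adj x a)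
    (hya : G.Adj y a) (hxb : G.Adj x b) (hyb : G.Adj y b) (hab : a ≠ b) (hx : σ x = x)
    (hy : σ y = y) (ha : σ a = b) (hb : σ b = a) (hz : σ z = z) (hzx : z ≠ x) (hzy : z ≠ y) :
    False := by
  obtain ⟨b', hb', -, -, h⟩ := hG.exists_other hxy hxa hya
  obtain rfl : b = b' := (h b hxb hyb).resolve_left hab.symm
  have hS : ∀ w ∈ ({x, y} : Set V)ᶜ, σ w ∈ ({x, y} : Set V)ᶜ := by
    rintro w hw (h | h)
    · exact hw (.inl (σ.injective (h.trans hx.symm)))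
    · exact hw (.inr (σ.injective (h.trans hy.symm)))
  rcases hG.connIn_third_or hC hxy h hzx hzy with h1 | h1
  · have h2 := connIn_map σ.toEmbedding hS h1
    change ConnIn G _ (σ z) (σ a) at h2
    rw [hz, ha] at h2
    exact hG.not_connIn_thirds hxy hab hxa hya hxb hyb (h1.symm.trans h2)
  · have h2 := connIn_map σ.toEmbedding hS h1
    change ConnIn G _ (σ z) (σ b) at h2
    rw [hz, hb] at h2
    exact hG.not_connIn_thirds hxy hab hxa hya hxb hyb (h2.symm.trans h1)

/-- Compare `z` with the edge `ax` and, by `σ`, with `ay`. If `z` lies on the inner side of `ax`, it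
does so for `ay` and contradicts `triangle_not_center`. Otherwise it lies beyond both edges,
although the parts beyond them are disjoint. -/
theorem not_fixed_of_swap_edge_side (σ : G ≃g G) {x y a z : V} (hxy : G.Adj x y) (hxa : G.Adj x a)
    (hya : G.Adj y a) (hx : σ x = y) (hy : σ y = x) (ha : σ a = a) (hz : σ z = z)
    (hza : z ≠ a) (hc : ConnIn G {x, y}ᶜ z a) : False := by
  have hzx : z ≠ x := fun h => hc.left_mem (.inl h)
  have hzy : z ≠ y := fun h => hc.left_mem (.inr h)
  have hS : ∀ w ∈ ({a, x} : Set V)ᶜ, σ w ∈ ({a, y} : Set V)ᶜ := by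
    rintro w hw (h | h)
    · exact hw (.inl (σ.injective (h.trans ha.symm)))
    · exact hw (.inr (σ.injective (h.trans hx.symm)))
  obtain ⟨a1, h1y, haa1, hxa1, h1⟩ := hG.exists_other hxa.symm hya.symm hxy
  obtain ⟨a2, h2x, haa2, hya2, h2⟩ := hG.exists_other hya.symm hxa.symm hxy.symm
  have hσ : σ a1 = a2 := by
    have e1 := σ.map_adj_iff.2 haa1
    have e2 := σ.map_adj_iff.2 hxa1
    rw [ha] at e1
    rw [hx] at e2
    refine (h2 _ e1 e2).resolve_left fun h => h1y (σ.injective (h.trans hy.symm))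
  rcases hG.connIn_third_or hC hxa.symm h1 hza hzx with h3 | h3
  · have h4 := connIn_map σ.toEmbedding hS h3
    change ConnIn G _ (σ z) (σ y) at h4
    rw [hz, hy] at h4
    exact hG.triangle_not_center hxy hxa hya h3 h4 hc
  · have h4 := connIn_map σ.toEmbedding hS h3
    change ConnIn G _ (σ z) (σ a1) at h4
    rw [hz, hσ] at h4
    rcases h4.avoid_or hzx with h5 | h5
    · refine hG.not_connIn_thirds hxa.symm h1y haa1 hxa1 hya.symm hxy
        (h3.symm.trans ((h5.mono ?_).tail hya2.symm ?_))
      · rintro w ⟨hw1, hw2⟩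
        grind
      · grind [hya.ne, hxy.ne]
    · exact hG.not_connIn_thirds hya.symm h2x haa2 hya2 hxa.symm hxy.symm (h4.symm.trans h5)

/-- An automorphism that swaps the ends of an edge has no fixed points outside the third vertices
of the triangles at the edge. -/
theorem not_fixed_of_swap_edge (σ : G ≃g G) {x y a b z : V} (hxy : G.Adj x y) (hxa : G.Adj x a)
    (hya : G.Adj y a) (hxb : G.Adj x b) (hyb : G.Adj y b) (hab : a ≠ b) (hx : σ x = y)
    (hy : σ y = x) (ha : σ a = a) (hb : σ b = b) (hz : σ z = z) (hza : z ≠ a) (hzb : z ≠ b) :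
    False := by
  obtain ⟨b', hb', -, -, h⟩ := hG.exists_other hxy hxa hya
  obtain rfl : b = b' := (h b hxb hyb).resolve_left hab.symm
  have hzx : z ≠ x := by
    rintro rfl
    exact hxy.ne (hz.symm.trans hx)
  have hzy : z ≠ y := by
    rintro rfl
    exact hxy.ne (hy.symm.trans hz)
  rcases hG.connIn_third_or hC hxy h hzx hzy with h1 | h1
  · exact hG.not_fixed_of_swap_edge_side hC σ hxy hxa hya hx hy ha hz hza h1
  · exact hG.not_fixed_of_swap_edge_side hC σ hxy hxb hyb hx hy hb hz hzb h1

/-- An automorphism that fixes two vertices is an involution, and it is trivial if it fixes a third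
vertex. -/
theorem fix_two (σ : G ≃g G) {p q : V} (hpq : p ≠ q) (hp : σ p = p) (hq : σ q = q) :
    (∀ v, σ (σ v) = v) ∧ ∀ r, r ≠ p → r ≠ q → σ r = r → ∀ v, σ v = v := by
  by_cases hadj : G.Adj p q
  · obtain ⟨a, b, hab, h⟩ := hG.thirds p q hadj
    obtain ⟨hpa, hqa⟩ := (h a).2 (.inl rfl)
    obtain ⟨hpb, hqb⟩ := (h b).2 (.inr rfl)
    have hσ : ∀ c, G.Adj p c → G.Adj q c → σ c = a ∨ σ c = b := by
      intro c h1 h2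
      refine (h _).1 ⟨?_, ?_⟩
      · rw [← hp]
        exact σ.map_adj_iff.2 h1
      · rw [← hq]
        exact σ.map_adj_iff.2 h2
    rcases hσ a hpa hqa with ha | ha
    · have := hG.fix_all hC σ hadj hpa hqa hp hq ha
      exact ⟨fun v => by rw [this, this], fun _ _ _ _ => this⟩
    · have hb : σ b = a := (hσ b hpb hqb).resolve_right fun hb =>
        hab (σ.injective (ha.trans hb.symm))
      refine ⟨hG.fix_all hC (σ.trans σ) hadj hpa hqa ?_ ?_ ?_, fun r hrp hrq hr => ?_⟩
      · change σ (σ p) = p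
        rw [hp, hp]
      · change σ (σ q) = q
        rw [hq, hq]
      · change σ (σ a) = a
        rw [ha, hb]
      · exact (hG.not_fixed_of_swap_sides hC σ hadj hpa hqa hpb hqb hab hp hq ha hb hr hrp hrq).elim
  · obtain ⟨x, y, hpx, hpy, hxy, hsep⟩ := hG.exists_separating_edge hC hpq hadj
    have hpx' := σ.map_adj_iff.2 hpx
    have hpy' := σ.map_adj_iff.2 hpy
    rw [hp] at hpx' hpy'
    have hsep' : ¬ ConnIn G {σ x, σ y}ᶜ q p := by
      intro h
      have h' := connIn_map σ.symm.toEmbedding (S' := {x, y}ᶜ) ?_ h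
      · change ConnIn G _ (σ.symm q) (σ.symm p) at h'
        rw [σ.symm_apply_eq.2 hp.symm, σ.symm_apply_eq.2 hq.symm] at h'
        exact hsep h'
      · rintro w hw (h1 | h1)
        · exact hw (.inl (σ.symm_apply_eq.1 h1))
        · exact hw (.inr (σ.symm_apply_eq.1 h1))
    obtain ⟨h1, h2⟩ := hG.separating_edge_unique hC hadj hpx' hpy' (σ.map_adj_iff.2 hxy) hsep'
      hpx hpy hsep
    by_cases hx : σ x = x
    · have hy : σ y = y := h2.resolve_left fun h => hxy.ne (σ.injective (hx.trans h.symm))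
      have := hG.fix_all hC σ hpx hpy hxy hp hx hy
      exact ⟨fun v => by rw [this, this], fun _ _ _ _ => this⟩
    · have hx : σ x = y := h1.resolve_left hx
      have hy : σ y = x := h2.resolve_right fun h => hxy.ne (σ.injective (hx.trans h.symm))
      refine ⟨hG.fix_all hC (σ.trans σ) hpx hpy hxy ?_ ?_ ?_, fun r hrp hrq hr => ?_⟩
      · change σ (σ p) = p
        rw [hp, hp]
      · change σ (σ x) = x
        rw [hx, hy]
      · change σ (σ y) = y
        rw [hy, hx]
      · obtain ⟨b, hbp, hxb, hyb, h⟩ := hG.exists_other hxy hpx.symm hpy.symm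
        have hσb : σ b = b := by
          have e1 := σ.map_adj_iff.2 hyb
          have e2 := σ.map_adj_iff.2 hxb
          rw [hy] at e1
          rw [hx] at e2
          exact (h _ e1 e2).resolve_left fun h => hbp (σ.injective (h.trans hp.symm))
        -- When the ends `x`, `y` are swapped, the only possible fixed points are the two third
        -- vertices `p` and `b`. Hence `q = b`, and no further point is fixed.
        have key : ∀ z, σ z = z → z ≠ p → z = b := fun z hz hzp => by
          by_contra hzb
          exact hG.not_fixed_of_swap_edge hC σ hxy hpx.symm hpy.symm hxb hyb hbp.symm hx hy hp
            hσb hz hzp hzb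
        exact (hrq ((key r hr hrp).trans (key q hq hpq.symm).symm)).elim

end FareyModel

end Rigidity

/-! ### The new predicates are first-order in the graph -/

section Definability

universe u

/-- The formula `φ` of the language of graphs holds in the graph `G` at `v`. -/
def Holds {V : Type*} (G : SimpleGraph V) {α : Type*} (φ : Language.graph.Formula α)
    (v : α → V) : Prop :=
  letI := G.structure
  φ.Realize v

/-- The predicate `R` is defined by a formula of the language of graphs. -/
def FODef {α : Type} (R : ∀ V : Type u, SimpleGraph V → (α → V) → Prop) : Prop :=
  ∃ φ : Language.graph.Formula α, ∀ (V : Type u) (G : SimpleGraph V) (v : α → V),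
    Holds G φ v ↔ R V G v

namespace FODef

variable {α β : Type} {R S : ∀ V : Type u, SimpleGraph V → (α → V) → Prop}

theorem congr (hR : FODef R) (h : ∀ V G v, R V G v ↔ S V G v) : FODef S := by
  obtain ⟨φ, hφ⟩ := hR
  exact ⟨φ, fun V G v => (hφ V G v).trans (h V G v)⟩

theorem imp (hR : FODef R) (hS : FODef S) : FODef fun V G v => R V G v → S V G v := by
  obtain ⟨φ, hφ⟩ := hR
  obtain ⟨ψ, hψ⟩ := hS
  exact ⟨φ.imp ψ, fun V G v => imp_congr (hφ V G v) (hψ V G v)⟩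

theorem const (p : Prop) : FODef fun (V : Type u) (_ : SimpleGraph V) (_ : α → V) => p := by
  by_cases hp : p
  · exact ⟨⊤, fun V G v => iff_of_true (by
      let := G.structure
      exact (Formula.realize_top).2 trivial) hp⟩
  · exact ⟨⊥, fun V G v => iff_of_false id hp⟩

theorem not (hR : FODef R) : FODef fun V G v => ¬ R V G v := hR.imp (const False)

theorem and (hR : FODef R) (hS : FODef S) : FODef fun V G v => R V G v ∧ S V G v :=
  (hR.imp hS.not).not.congr fun V G v => by tauto

theorem iff (hR : FODef R) (hS : FODef S) : FODef fun V G v => R V G v ↔ S V G v :=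
  ((hR.imp hS).and (hS.imp hR)).congr fun V G v => by tauto

theorem all_finite {ι : Type} [Finite ι] {R : ι → ∀ V : Type u, SimpleGraph V → (α → V) → Prop}
    (hR : ∀ i, FODef (R i)) : FODef fun V G v => ∀ i, R i V G v := by
  choose φ hφ using hR
  refine ⟨Formula.iInf φ, fun V G v => ?_⟩
  let := G.structure
  exact Formula.realize_iInf.trans (forall_congr' fun i => hφ i V G v)

theorem ex_finite {ι : Type} [Finite ι] {R : ι → ∀ V : Type u, SimpleGraph V → (α → V) → Prop}
    (hR : ∀ i, FODef (R i)) : FODef fun V G v => ∃ i, R i V G v :=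
  (all_finite fun i => (hR i).not).not.congr fun V G v => by simp

theorem relabel (hR : FODef R) (f : α → β) : FODef fun V G (v : β → V) => R V G (v ∘ f) := by
  obtain ⟨φ, hφ⟩ := hR
  refine ⟨Formula.relabel f φ, fun V G v => ?_⟩
  let := G.structure
  exact Formula.realize_relabel.trans (hφ V G (v ∘ f))

theorem ex [Finite β] {R : ∀ V : Type u, SimpleGraph V → (α ⊕ β → V) → Prop} (hR : FODef R) :
    FODef fun V G v => ∃ w : β → V, R V G (Sum.elim v w) := by
  obtain ⟨φ, hφ⟩ := hR
  refine ⟨φ.iExs β, fun V G v => ?_⟩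
  let := G.structure
  exact Formula.realize_iExs.trans (exists_congr fun w => hφ V G _)

theorem ex_one {R : ∀ V : Type u, SimpleGraph V → (α → V) → V → Prop}
    (hR : FODef fun V G (v : α ⊕ Unit → V) => R V G (v ∘ Sum.inl) (v (Sum.inr ()))) :
    FODef fun V G v => ∃ x, R V G v x :=
  hR.ex.congr fun _ _ _ => ⟨fun ⟨w, h⟩ => ⟨w (), h⟩, fun ⟨x, h⟩ => ⟨fun _ => x, h⟩⟩

theorem eq (a b : α) : FODef fun (V : Type u) (_ : SimpleGraph V) v => v a = v b := by
  refine ⟨Term.equal (Term.var a) (Term.var b), fun V G v => ?_⟩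
  let := G.structure
  exact Formula.realize_equal

theorem adj (a b : α) : FODef fun (V : Type u) (G : SimpleGraph V) v => G.Adj (v a) (v b) := by
  refine ⟨Relations.formula₂ FirstOrder.Language.adj (Term.var a) (Term.var b), fun V G v => ?_⟩
  let := G.structure
  exact Formula.realize_rel₂

theorem walk (n : ℕ) (a b : α) :
    FODef fun (V : Type u) (G : SimpleGraph V) v => ∃ p : G.Walk (v a) (v b), p.length = n := by
  induction n generalizing α with
  | zero =>
    refine (eq a b).congr fun V G v => ⟨fun h => ?_, fun ⟨p, hp⟩ => ?_⟩
    · exact h ▸ ⟨.nil, rfl⟩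
    · exact SimpleGraph.Walk.eq_of_length_eq_zero hp
  | succ n ih =>
    refine (ex_one (R := fun V G v x => G.Adj (v a) x ∧ ∃ p : G.Walk x (v b), p.length = n)
      ((adj (Sum.inl a) (Sum.inr ())).and (ih (Sum.inr ()) (Sum.inl b)))).congr fun V G v =>
      ⟨fun ⟨x, h, p, hp⟩ => ⟨.cons h p, by simp [hp]⟩, fun ⟨p, hp⟩ => ?_⟩
    generalize v a = x, v b = y at p
    cases p with
    | nil => simp at hp
    | cons h p => exact ⟨_, h, p, by simpa using hp⟩

/-- The vertices `x` and `y` are connected and have distance `k`. -/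
def _root_.DistEq {V : Type*} (G : SimpleGraph V) (k : ℕ) (x y : V) : Prop :=
  G.Reachable x y ∧ G.dist x y = k

theorem _root_.distEq_iff_walk {V : Type*} {G : SimpleGraph V} {k : ℕ} {x y : V} :
    DistEq G k x y ↔ (∃ p : G.Walk x y, p.length = k) ∧
      ∀ j : Fin k, ¬ ∃ p : G.Walk x y, p.length = j := by
  constructor
  · rintro ⟨h, hk⟩
    obtain ⟨p, hp⟩ := h.exists_walk_length_eq_dist
    refine ⟨⟨p, hp.trans hk⟩, fun ⟨j, hj⟩ ⟨q, hq⟩ => ?_⟩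
    have := SimpleGraph.dist_le q
    simp only at hq
    omega
  · rintro ⟨⟨p, hp⟩, h⟩
    refine ⟨p.reachable, le_antisymm (hp ▸ SimpleGraph.dist_le p) ?_⟩
    by_contra! hlt
    obtain ⟨q, hq⟩ := p.reachable.exists_walk_length_eq_dist
    exact h ⟨_, hlt⟩ ⟨q, hq⟩

theorem distEq (k : ℕ) (a b : α) :
    FODef fun (V : Type u) (G : SimpleGraph V) v => DistEq G k (v a) (v b) :=
  ((walk k a b).and (all_finite fun j : Fin k => (walk j a b).not)).congr
    fun _ _ _ => distEq_iff_walk.symm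

/-- The existence of a map from a finite graph with a given adjacency pattern and prescribed
values. -/
theorem pattern {m : ℕ} (A : Fin m → Fin m → Prop) {k : ℕ} (i : Fin k → Fin m) (a : Fin k → α) :
    FODef fun (V : Type u) (G : SimpleGraph V) v => ∃ f : Fin m → V, Function.Injective f ∧
      (∀ i j, G.Adj (f i) (f j) ↔ A i j) ∧ ∀ l, f (i l) = v (a l) := by
  refine (ex (β := Fin m) (R := fun V G v => (∀ i j : Fin m, v (.inr i) = v (.inr j) → i = j) ∧
    (∀ i j : Fin m, G.Adj (v (.inr i)) (v (.inr j)) ↔ A i j) ∧ ∀ l, v (.inr (i l)) = v (.inl (a l)))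
    (.and ?_ (.and ?_ ?_))).congr fun V G v => Iff.rfl
  · exact all_finite fun i => all_finite fun j => (eq _ _).imp (const _)
  · exact all_finite fun i => all_finite fun j => (adj _ _).iff (const _)
  · exact all_finite fun l => eq _ _

end FODef

theorem MinimalCycle.reachable {n : ℕ} (D : MinimalCycle n) (x y : Fin D.size) :
    D.graph.Reachable x y := by
  obtain ⟨-, h⟩ | ⟨a, p, hp⟩ := D.isCycleGraph
  · rw [h]
    by_cases hxy : x = y
    · exact hxy ▸ .rfl
    · exact ((SimpleGraph.top_adj x y).2 hxy).reachable
  · exact (p.takeUntil x (hp.mem_support x)).reachable.symm.trans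
      (p.takeUntil y (hp.mem_support y)).reachable

theorem PCycle.reachable {V : Type*} {G : SimpleGraph V} {C : CycleType} {x y : V}
    (h : PCycle G C x y) : G.Reachable x y := by
  obtain ⟨D, -, f, u, w, -, rfl, rfl⟩ := h
  exact (D.reachable u w).map f.toHom

theorem PSeq.reachable {V : Type*} {G : SimpleGraph V} {δ : List CycleType} {x y : V}
    (h : PSeq G δ x y) : G.Reachable x y := by
  obtain ⟨⟨z, rfl, rfl, h⟩, -⟩ := h
  suffices ∀ i, G.Reachable (z 0) (z i) from this _
  intro i
  induction i using Fin.induction with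
  | zero => rfl
  | succ i ih => exact ih.trans (h i).reachable

/-- Fixes one representative of the isomorphism type, so that only finitely many positions of the
two removable vertices remain to be listed. -/
theorem pCycle_iff {V : Type*} {G : SimpleGraph V} (C : CycleType) {x y : V} :
    PCycle G C x y ↔ ∃ c : {c : Fin C.2.out.size × Fin C.2.out.size //
      ∃ (D : MinimalCycle C.1) (e : D.graph ≃g C.2.out.graph) (u w : Fin D.size),
        {v | IsRemovable D.graph v} = {u, w} ∧ e u = c.1 ∧ e w = c.2},
      ∃ f : Fin C.2.out.size → V, Function.Injective f ∧
        (∀ i j, G.Adj (f i) (f j) ↔ C.2.out.graph.Adj i j) ∧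
          ∀ l, f (![c.1.1, c.1.2] l) = ![x, y] l := by
  constructor
  · rintro ⟨D, hD, f, u, w, hr, rfl, rfl⟩
    obtain ⟨e⟩ : Nonempty (D.graph ≃g C.2.out.graph) :=
      Quotient.exact (hD.trans (Quotient.out_eq _).symm)
    refine ⟨⟨(e u, e w), D, e, u, w, hr, rfl, rfl⟩, f ∘ e.symm,
      f.injective.comp e.symm.injective, fun i j => ?_, ?_⟩
    · exact f.map_adj_iff.trans e.symm.map_adj_iff
    · simp [Fin.forall_fin_two]
  · rintro ⟨⟨c, D, e, u, w, hr, hu, hw⟩, f, hf, hadj, hl⟩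
    refine ⟨D, ?_, e.toRelEmbedding.trans (⟨⟨f, hf⟩, fun {i j} => hadj i j⟩ : C.2.out.graph ↪g G),
      u, w, hr, (congrArg f hu).trans (hl 0), (congrArg f hw).trans (hl 1)⟩
    rw [← Quotient.out_eq C.2]
    exact Quotient.sound ⟨e⟩

namespace FODef

variable {α : Type}

theorem pCycle (C : CycleType) (a b : α) :
    FODef fun (V : Type u) (G : SimpleGraph V) v => PCycle G C (v a) (v b) := by
  refine (ex_finite fun c : {c : Fin C.2.out.size × Fin C.2.out.size //
      ∃ (D : MinimalCycle C.1) (e : D.graph ≃g C.2.out.graph) (u w : Fin D.size),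
        {v | IsRemovable D.graph v} = {u, w} ∧ e u = c.1 ∧ e w = c.2} => pattern (C.2.out.graph.Adj) (k := 2) ![c.1.1, c.1.2] ![a, b]).congr
    fun V G v => ((pCycle_iff C).trans (exists_congr fun c => exists_congr fun f => ?_)).symm
  refine and_congr Iff.rfl (and_congr Iff.rfl (forall_congr' fun l => ?_))
  revert l
  simp [Fin.forall_fin_two]

/-- The condition on `dist` can be replaced by `DistEq`: the value `0` of `dist` at unconnected
vertices does no harm, since the chain of cycles forces a connection. -/
theorem pSeq (δ : List CycleType) (a b : α) :
    FODef fun (V : Type u) (G : SimpleGraph V) v => PSeq G δ (v a) (v b) := by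
  refine ((ex (β := Fin (δ.length + 1)) (R := fun V G v => v (.inr 0) = v (.inl a) ∧
    v (.inr (Fin.last δ.length)) = v (.inl b) ∧ ∀ i : Fin δ.length,
      PCycle G (δ.get i) (v (.inr i.castSucc)) (v (.inr i.succ)))
    ((eq _ _).and ((eq _ _).and (all_finite fun i => pCycle _ _ _)))).and
    (distEq (δ.map fun C => C.1).sum a b)).congr fun V G v => ?_
  constructor
  · rintro ⟨h1, h2⟩
    exact ⟨h1, h2.2⟩
  · intro h
    exact ⟨h.1, h.reachable, h.2⟩

theorem dLevel (k : ℕ) (σ : Equiv.Perm (Fin (fareyCard k))) (a b c : α) :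
    FODef fun (V : Type u) (G : SimpleGraph V) v => DLevel G k σ (v a) (v b) (v c) := by
  refine (pattern (fun i j => (fareyLevel k).total.Adj (fareyEnum k (σ i)) (fareyEnum k (σ j)))
    (k := 3) ![⟨0, by have := four_le_fareyCard k; omega⟩,
      ⟨1, by have := four_le_fareyCard k; omega⟩, ⟨2, by have := four_le_fareyCard k; omega⟩]
    ![a, b, c]).congr fun V G v => exists_congr fun f => ?_
  have : (∀ l : Fin 3, f (![⟨0, by have := four_le_fareyCard k; omega⟩,
      ⟨1, by have := four_le_fareyCard k; omega⟩,
      ⟨2, by have := four_le_fareyCard k; omega⟩] l) = v (![a, b, c] l)) ↔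
      f ⟨0, by have := four_le_fareyCard k; omega⟩ = v a ∧
      f ⟨1, by have := four_le_fareyCard k; omega⟩ = v b ∧
      f ⟨2, by have := four_le_fareyCard k; omega⟩ = v c := by
    simp [Fin.forall_fin_succ]
  rw [this]
  tauto

theorem yConfig (δ₁ δ₂ δ₃ : List CycleType) (k : ℕ) (σ : Equiv.Perm (Fin (fareyCard k)))
    (a b c : α) :
    FODef fun (V : Type u) (G : SimpleGraph V) v =>
      YConfig G δ₁ δ₂ δ₃ k σ (v a) (v b) (v c) := by
  refine (ex (β := Fin 3) (R := fun V G v => DLevel G k σ (v (.inr 0)) (v (.inr 1)) (v (.inr 2)) ∧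
    PSeq G δ₁ (v (.inl a)) (v (.inr 0)) ∧ PSeq G δ₂ (v (.inl b)) (v (.inr 1)) ∧
      PSeq G δ₃ (v (.inl c)) (v (.inr 2)))
    ((dLevel _ _ _ _ _).and ((pSeq _ _ _).and ((pSeq _ _ _).and (pSeq _ _ _))))).congr
    fun V G v => ⟨fun ⟨w, h⟩ => ⟨w 0, w 1, w 2, h⟩, fun ⟨x, y, z, h⟩ => ⟨![x, y, z], h⟩⟩

theorem exists_var {γ : Type} {n : ℕ} (ts : Fin n → fareyLanguage.Term γ) :
    ∃ a : Fin n → γ, ts = fun i => Term.var (a i) := by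
  have : ∀ t : fareyLanguage.Term γ, ∃ a, t = Term.var a := by
    rintro (a | ⟨f, -⟩)
    · exact ⟨a, rfl⟩
    · exact f.elim
  choose a ha using fun i => this (ts i)
  exact ⟨a, funext ha⟩

/-- Every formula of the expanded language is equivalent to a formula of the language of graphs. -/
theorem boundedFormula {n : ℕ} (φ : fareyLanguage.BoundedFormula α n) :
    FODef fun (V : Type u) (G : SimpleGraph V) (v : α ⊕ Fin n → V) =>
      letI := G.fareyStructure
      φ.Realize (v ∘ Sum.inl) (v ∘ Sum.inr) := by
  induction φ with
  | falsum => exact const False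
  | equal t₁ t₂ =>
    obtain ⟨a, ha⟩ := exists_var ![t₁, t₂]
    have h1 : t₁ = Term.var (a 0) := congrFun ha 0
    have h2 : t₂ = Term.var (a 1) := congrFun ha 1
    subst h1 h2
    refine (eq (a 0) (a 1)).congr fun V G v => ?_
    simp only [BoundedFormula.Realize, Term.realize_var, Sum.elim_comp_inl_inr]
  | rel R ts =>
    obtain ⟨a, rfl⟩ := exists_var ts
    cases R with
    | edge =>
      refine (adj (a 0) (a 1)).congr fun V G v => ?_
      simp only [BoundedFormula.Realize, Term.realize_var, Sum.elim_comp_inl_inr]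
      rfl
    | P δ =>
      refine (pSeq δ (a 0) (a 1)).congr fun V G v => ?_
      simp only [BoundedFormula.Realize, Term.realize_var, Sum.elim_comp_inl_inr]
      rfl
    | Y δ₁ δ₂ δ₃ k σ =>
      refine (yConfig δ₁ δ₂ δ₃ k σ (a 0) (a 1) (a 2)).congr fun V G v => ?_
      simp only [BoundedFormula.Realize, Term.realize_var, Sum.elim_comp_inl_inr]
      rfl
  | imp φ ψ h1 h2 => exact h1.imp h2
  | @all n φ ih =>
    refine (ex_one (R := fun V G v x => ¬ (letI := G.fareyStructure
      φ.Realize (v ∘ Sum.inl) (Fin.snoc (v ∘ Sum.inr) x))) ?_).not.congr fun V G v => ?_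
    · refine (ih.relabel (β := (α ⊕ Fin n) ⊕ Unit) (Sum.elim (fun a => .inl (.inl a))
        (Fin.snoc (fun i => .inl (.inr i)) (.inr ())))).not.congr fun V G v => not_congr ?_
      have : (v ∘ Sum.elim (fun a => .inl (.inl a)) (Fin.snoc (fun i => .inl (.inr i)) (.inr ()))) ∘
          Sum.inr = (Fin.snoc ((v ∘ Sum.inl) ∘ Sum.inr) (v (.inr ())) : Fin (n + 1) → V) := by
        funext i
        refine Fin.lastCases ?_ (fun i => ?_) i <;> simp
      rw [this]
      rfl
    · simp only [not_exists, not_not, BoundedFormula.Realize]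

theorem formula (φ : fareyLanguage.Formula α) :
    FODef fun (V : Type u) (G : SimpleGraph V) (v : α → V) =>
      letI := G.fareyStructure
      φ.Realize v := by
  refine ((boundedFormula φ).relabel (Sum.elim id Fin.elim0)).congr fun V G v => ?_
  let := G.fareyStructure
  change BoundedFormula.Realize _ _ _ ↔ BoundedFormula.Realize _ _ _
  exact iff_of_eq (congrArg _ (Subsingleton.elim _ _))

end FODef

end Definability

/-! ### Saturated models and back-and-forth -/

section Saturation

universe u

variable {V : Type u} {G : SimpleGraph V}

/-- Every countable set of formulas in one variable with parameters is realized if it is finitely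
realized. -/
def CountablySaturated (G : SimpleGraph V) : Prop :=
  ∀ θ : ℕ → Language.graph.Formula (V ⊕ Unit),
    (∀ n, ∃ x, ∀ j < n, Holds G (θ j) (Sum.elim id fun _ => x)) →
    ∃ x, ∀ j, Holds G (θ j) (Sum.elim id fun _ => x)

theorem Holds.relabel_iff {α β : Type*} {φ : Language.graph.Formula α} {f : α → β} {v : β → V} :
    Holds G (φ.relabel f) v ↔ Holds G φ (v ∘ f) := by
  let := G.structure
  exact Formula.realize_relabel

theorem CountablySaturated.realize (hsat : CountablySaturated G) {ι : Type*} [Countable ι]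
    {β : Type*} (θ : ι → Language.graph.Formula (β ⊕ Unit)) (p : ι → β → V)
    (h : ∀ s : Finset ι, ∃ x, ∀ j ∈ s, Holds G (θ j) (Sum.elim (p j) fun _ => x)) :
    ∃ x, ∀ j, Holds G (θ j) (Sum.elim (p j) fun _ => x) := by
  classical
  rcases isEmpty_or_nonempty ι with hι | hι
  · obtain ⟨x, -⟩ := h ∅
    exact ⟨x, fun j => hι.elim j⟩
  obtain ⟨e, he⟩ := exists_surjective_nat ι
  have key : ∀ j x, Holds G ((θ j).relabel (Sum.map (p j) id)) (Sum.elim id fun _ => x) ↔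
      Holds G (θ j) (Sum.elim (p j) fun _ => x) := by
    intro j x
    rw [Holds.relabel_iff, Sum.elim_comp_map]
    rfl
  obtain ⟨x, hx⟩ := hsat (fun n => (θ (e n)).relabel (Sum.map (p (e n)) id)) fun n => by
    obtain ⟨x, hx⟩ := h ((Finset.range n).image e)
    exact ⟨x, fun j hj => (key _ _).2 (hx _ (Finset.mem_image_of_mem e (Finset.mem_range.2 hj)))⟩
  refine ⟨x, fun j => ?_⟩
  obtain ⟨n, rfl⟩ := he j
  exact (key _ _).1 (hx n)

theorem CountablySaturated.realize_def (hsat : CountablySaturated G) {ι : Type*} [Countable ι]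
    {β : Type} {R : ι → ∀ V : Type u, SimpleGraph V → (β ⊕ Unit → V) → Prop}
    (hR : ∀ j, FODef (R j)) (p : ι → β → V)
    (h : ∀ s : Finset ι, ∃ x, ∀ j ∈ s, R j V G (Sum.elim (p j) fun _ => x)) :
    ∃ x, ∀ j, R j V G (Sum.elim (p j) fun _ => x) := by
  choose θ hθ using hR
  simp only [← hθ] at h ⊢
  exact hsat.realize θ p h

namespace FareyModel

variable (hG : FareyModel G)
include hG

/-- A finite link of `w` would contain a removable vertex `v`. The two third vertices at the edge
`wv` are neighbours of `v` in the link, but they are not adjacent. -/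
theorem exists_neighbor_notMem_finset (w : V) (B : Finset V) : ∃ c, G.Adj w c ∧ c ∉ B := by
  classical
  by_contra! h
  obtain ⟨c, hc⟩ := hG.exists_adj w
  obtain ⟨v, hv, h1, -⟩ := hG.removable (B.filter (G.Adj w))
    ⟨c, Finset.mem_filter.2 ⟨h c hc, hc⟩⟩
  have hwv := (Finset.mem_filter.1 hv).2
  obtain ⟨a, b, hab, h2⟩ := hG.thirds w v hwv
  obtain ⟨hwa, hva⟩ := (h2 a).2 (.inl rfl)
  obtain ⟨hwb, hvb⟩ := (h2 b).2 (.inr rfl)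
  exact hG.not_adj_of_clique hwv hwa hwb hva hvb (h1 a (Finset.mem_filter.2 ⟨h a hwa, hwa⟩) b
    (Finset.mem_filter.2 ⟨h b hwb, hwb⟩) hva hvb hab)

omit hG in
theorem _root_.exists_geodesic_mem {S : Set V} {x y : V} (h : ¬ ConnIn G Sᶜ x y)
    (hxy : G.Reachable x y) : ∃ w ∈ S, G.Reachable x w ∧ G.Reachable w y ∧
      G.dist x w + G.dist w y ≤ G.dist x y := by
  classical
  obtain ⟨p, hp⟩ := hxy.exists_walk_length_eq_dist
  obtain ⟨w, hw, hwS⟩ : ∃ w ∈ p.support, w ∈ S := by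
    by_contra! hw
    exact h (ConnIn.of_walk p fun z hz => hw z hz)
  have h1 := SimpleGraph.dist_le (p.takeUntil w hw)
  have h2 := SimpleGraph.dist_le (p.dropUntil w hw)
  have h3 := congrArg SimpleGraph.Walk.length (p.take_spec hw)
  rw [SimpleGraph.Walk.length_append] at h3
  exact ⟨w, hwS, (p.takeUntil w hw).reachable, (p.dropUntil w hw).reachable, by omega⟩

/-- Pass to an edge `bc` beyond `xy` and disjoint from it. A geodesic from `v` to a vertex beyond
`bc` meets `b` or `c`, whose distance from `v` is at least `m`, and then needs a further step. -/
theorem exists_far_side (v : V) (m : ℕ) : ∃ x y b, G.Adj x y ∧ G.Adj x b ∧ G.Adj y b ∧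
    ¬ ConnIn G {x, y}ᶜ v b ∧ G.Reachable v b ∧
    ∀ z, ConnIn G {x, y}ᶜ b z → m ≤ G.dist v z := by
  induction m with
  | zero =>
    obtain ⟨y, hy⟩ := hG.exists_adj v
    obtain ⟨b, hvb, hyb⟩ := hG.exists_third hy
    exact ⟨v, y, b, hy, hvb, hyb, fun h => h.left_mem (.inl rfl), hvb.reachable,
      fun _ _ => Nat.zero_le _⟩
  | succ m ih =>
    obtain ⟨x, y, b, hxy, hxb, hyb, hsep, hreach, hd⟩ := ih
    obtain ⟨c, hcy, hxc, hbc, -⟩ := hG.exists_other hxb hxy hyb.symm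
    obtain ⟨e, hex, hbe, hce, -⟩ := hG.exists_other hbc hxb.symm hxc.symm
    have hbS : b ∈ ({x, y} : Set V)ᶜ := by
      rintro (h | h)
      · exact hxb.ne' h
      · exact hyb.ne' h
    have hcS : c ∈ ({x, y} : Set V)ᶜ := by
      rintro (h | h)
      · exact hxc.ne' h
      · exact hcy h
    have heS : e ∈ ({x, y} : Set V)ᶜ := by
      rintro (h | h)
      · exact hex h
      · rw [Set.mem_singleton_iff] at h
        subst h
        exact hG.not_adj_of_clique hxb hxc hxy hbc hbe hce
    have hxS : x ∈ ({b, c} : Set V)ᶜ := by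
      rintro (h | h)
      · exact hxb.ne h
      · exact hxc.ne h
    have hyS : y ∈ ({b, c} : Set V)ᶜ := by
      rintro (h | h)
      · exact hyb.ne h
      · exact hcy h.symm
    have hbc' : ConnIn G {x, y}ᶜ b c := .of_adj hbc hbS hcS
    have hbe' : ConnIn G {x, y}ᶜ b e := .of_adj hbe hbS heS
    have hthird : ¬ ConnIn G {b, c}ᶜ x e :=
      hG.not_connIn_thirds hbc hex.symm hxb.symm hxc.symm hbe hce
    have hthird' : ¬ ConnIn G {b, c}ᶜ y e := fun h => hthird ((ConnIn.of_adj hxy hxS hyS).trans h)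
    have hsep' : ¬ ConnIn G {b, c}ᶜ v e := by
      intro h
      have hvx : v ≠ x := fun hv => hthird (hv ▸ h)
      have hvy : v ≠ y := fun hv => hthird' (hv ▸ h)
      have h1 := (h.avoid_or hvx).resolve_right fun h' => hthird (h'.symm.trans h)
      have h2 := (h1.avoid_or hvy).resolve_right fun h' =>
        hthird' ((h'.symm.mono Set.inter_subset_left).trans h)
      refine hsep ((h2.mono ?_).trans hbe'.symm)
      rintro z ⟨⟨-, h3⟩, h4⟩ (h5 | h5)
      · exact h3 h5
      · exact h4 h5
    refine ⟨b, c, e, hbc, hbe, hce, hsep', hreach.trans hbe.reachable, fun z hz => ?_⟩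
    obtain ⟨w, hw, h1, h2, h3⟩ := exists_geodesic_mem (fun h => hsep' (h.trans hz.symm))
      ((hreach.trans hbe.reachable).trans hz.reachable)
    have h4 : m ≤ G.dist v w := by
      rcases hw with rfl | hw
      · exact hd _ (.refl hbS)
      · rw [Set.mem_singleton_iff] at hw
        exact hw ▸ hd _ hbc'
    have h5 : G.dist w z ≠ 0 := fun h0 => hz.right_mem (eq_of_reachable_of_dist h2 h0 ▸ hw)
    omega

theorem exists_neighbor_notMem (hsat : CountablySaturated G) (w : V) {B : Set V}
    (hB : B.Countable) : ∃ c, G.Adj w c ∧ c ∉ B := by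
  classical
  have : Countable B := hB
  obtain ⟨c, hc⟩ := hsat.realize_def (ι := B) (β := Fin 2)
    (R := fun _ V G v => G.Adj (v (.inl 0)) (v (.inr ())) ∧ ¬ v (.inr ()) = v (.inl 1))
    (fun _ => (FODef.adj _ _).and (FODef.eq _ _).not) (fun b => ![w, b]) (fun s => by
      obtain ⟨c, hc, hcs⟩ := hG.exists_neighbor_notMem_finset w (s.map (Function.Embedding.subtype _))
      exact ⟨c, fun j hj => ⟨hc, fun h => hcs (Finset.mem_map.2 ⟨j, hj, h.symm⟩)⟩⟩)
  -- The conditions are indexed by `B`, so for empty `B` the realized set of formulas says nothing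
  -- about adjacency.
  by_cases hne : B.Nonempty
  · obtain ⟨b, hb⟩ := hne
    exact ⟨c, (hc ⟨b, hb⟩).1, fun h => (hc ⟨c, h⟩).2 rfl⟩
  · obtain ⟨c, hc⟩ := hG.exists_adj w
    exact ⟨c, hc, fun h => hne ⟨c, h⟩⟩

/-- Distances are unbounded, so a vertex far enough away avoids any finite number of prescribed
distances; saturation then avoids all of them at once. -/
theorem exists_not_reachable [Nonempty V] (hsat : CountablySaturated G) {B : Set V}
    (hB : B.Countable) : ∃ d, ∀ b ∈ B, ¬ G.Reachable b d := by
  have : Countable B := hB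
  obtain ⟨v⟩ := ‹Nonempty V›
  obtain ⟨d, hd⟩ := hsat.realize_def (ι := B × ℕ) (β := Unit)
    (R := fun j V G v => ¬ DistEq G j.2 (v (.inl ())) (v (.inr ())))
    (fun j => (FODef.distEq _ _ _).not) (fun j _ => j.1) (fun s => by
      obtain ⟨x, y, b, -, hxb, hyb, -, hb, h⟩ :=
        hG.exists_far_side v (s.sup (fun j => G.dist v j.1 + j.2) + 1)
      refine ⟨b, fun j hj hdist => ?_⟩
      have h1 := h b (.refl (by
        rintro (rfl | rfl)
        exacts [hxb.ne rfl, hyb.ne rfl]))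
      have h2 := Finset.le_sup (f := fun j : B × ℕ => G.dist v j.1 + j.2) hj
      have h3 := dist_triangle_of_reachable (hb.trans hdist.1.symm) hdist.1
      have h4 := hdist.2
      simp only [Sum.elim_inl, Sum.elim_inr] at h2 h3 h4
      omega)
  exact ⟨d, fun b hb h => hd (⟨b, hb⟩, G.dist b d) ⟨h, rfl⟩⟩

end FareyModel

namespace ClosedIso

variable {W : Type u} {H : SimpleGraph W} {r : Set (V × W)}

/-- Two copies of the Farey graph meeting a partial isomorphism in corresponding single points can
be glued to it. -/
theorem glue_range [Nonempty V] [Nonempty W] (hG : FareyModel G) (hH : FareyModel H)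
    (hr : ClosedIso G H r) {Φ : fareyGraph ↪g G} {Ψ : fareyGraph ↪g H} {p q : FareyVertex}
    (hp : (Φ p, Ψ p) ∈ r) (hq : Φ q ∉ Prod.fst '' r) (hq' : Ψ q ∉ Prod.snd '' r) :
    ClosedIso G H (r ∪ Set.range fun p => (Φ p, Ψ p)) := by
  refine hr.glue (hG.closedIso_range hH Φ Ψ) hp ⟨p, rfl⟩ ?_ ?_ ?_ ?_
  · rintro a ha _ ⟨b, rfl⟩ h
    by_contra hne
    exact hq (hr.gated_fst.subset_of_two (hG.twoConnected_range Φ) hne ⟨a, ha, rfl⟩ ⟨b, h.symm⟩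
      ⟨_, hp, rfl⟩ ⟨p, rfl⟩ ⟨q, rfl⟩)
  · rintro a ha _ ⟨b, rfl⟩ h
    by_contra hne
    exact hq' (hr.gated_snd.subset_of_two (hH.twoConnected_range Ψ) hne ⟨a, ha, rfl⟩ ⟨b, h.symm⟩
      ⟨_, hp, rfl⟩ ⟨p, rfl⟩ ⟨q, rfl⟩)
  · rintro _ ⟨b, rfl⟩
    exact (hG.twoConnected_range Φ).reachable _ ⟨b, rfl⟩ _ ⟨p, rfl⟩
  · rintro _ ⟨b, rfl⟩
    exact (hH.twoConnected_range Ψ).reachable _ ⟨b, rfl⟩ _ ⟨p, rfl⟩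

/-- Walk from the domain to `c`. At an edge `xy` leaving the domain, the whole copy through `xy` is
added and matched with a copy through a fresh neighbour of the image of `x`. Each copy meets the old
set in one vertex, so gluing applies. A vertex in a new component is matched with a vertex
unconnected to the range. -/
theorem forth [Nonempty V] [Nonempty W] (hG : FareyModel G) (hH : FareyModel H)
    (hsat : CountablySaturated H) (hr : ClosedIso G H r) (c : V) :
    ∃ s, r ⊆ s ∧ ClosedIso G H s ∧ ∃ d, (c, d) ∈ s := by
  by_cases hc : ∃ p ∈ r, G.Reachable p.1 c
  · obtain ⟨⟨a, a'⟩, ha, hac⟩ := hc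
    refine (ConnIn.univ_iff.2 hac).rec_tail (P := fun c => ∃ s, r ⊆ s ∧ ClosedIso G H s ∧
      ∃ d, (c, d) ∈ s) ⟨r, subset_rfl, hr, a', ha⟩ fun x y _ hxy _ ih => ?_
    obtain ⟨s, hrs, hs, x', hx⟩ := ih
    by_cases hy : y ∈ Prod.fst '' s
    · obtain ⟨⟨y, d⟩, hy, rfl⟩ := hy
      exact ⟨s, hrs, hs, d, hy⟩
    obtain ⟨y', hxy', hy'⟩ := hH.exists_neighbor_notMem hsat x' (hs.countable.image Prod.snd)
    obtain ⟨Φ, rfl, rfl⟩ := hG.exists_embedding_edge hxy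
    obtain ⟨Ψ, rfl, rfl⟩ := hH.exists_embedding_edge hxy'
    exact ⟨_, hrs.trans Set.subset_union_left, hs.glue_range hG hH hx hy hy', _, .inr ⟨fareyOne, rfl⟩⟩
  · push Not at hc
    obtain ⟨d, hd⟩ := hH.exists_not_reachable hsat (hr.countable.image Prod.snd)
    refine ⟨r ∪ {(c, d)}, Set.subset_union_left, hr.union_of_not_reachable (.singleton c d) ?_ ?_,
      d, .inr rfl⟩
    · rintro p hp _ rfl
      exact hc p hp
    · rintro p hp _ rfl
      exact hd _ ⟨p, hp, rfl⟩

theorem exists_graph_var {γ : Type*} (t : Language.graph.Term γ) : ∃ a, t = Term.var a := by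
  rcases t with a | ⟨f, -⟩
  · exact ⟨a, rfl⟩
  · exact (IsEmpty.false f).elim

/-- The usual back-and-forth induction, with `forth` and its mirror image under `symm` at the
quantifier. -/
theorem realize_iff [Nonempty V] [Nonempty W] (hG : FareyModel G) (hH : FareyModel H)
    (hsG : CountablySaturated G) (hsH : CountablySaturated H) {α : Type*} {n : ℕ}
    (φ : Language.graph.BoundedFormula α n) (hr : ClosedIso G H r) (v : α → V) (v' : α → W)
    (x : Fin n → V) (x' : Fin n → W) (hv : ∀ i, (v i, v' i) ∈ r) (hx : ∀ i, (x i, x' i) ∈ r) :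
    (letI := G.structure; φ.Realize v x) ↔ (letI := H.structure; φ.Realize v' x') := by
  induction φ generalizing r with
  | falsum => exact Iff.rfl
  | equal t₁ t₂ =>
    obtain ⟨a, rfl⟩ := exists_graph_var t₁
    obtain ⟨b, rfl⟩ := exists_graph_var t₂
    have key : ∀ i, (Sum.elim v x i, Sum.elim v' x' i) ∈ r := Sum.rec hv hx
    exact hr.eq_iff _ (key a) _ (key b)
  | rel R ts =>
    choose a ha using fun i => exists_graph_var (ts i)
    obtain rfl := funext ha
    have key : ∀ i, (Sum.elim v x i, Sum.elim v' x' i) ∈ r := Sum.rec hv hx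
    cases R
    exact hr.adj_iff _ (key (a 0)) _ (key (a 1))
  | imp φ ψ h1 h2 => exact imp_congr (h1 hr x x' hv hx) (h2 hr x x' hv hx)
  | @all n φ ih =>
    have key : ∀ {s : Set (V × W)} {c : V} {d : W}, r ⊆ s → (c, d) ∈ s →
        (∀ i, ((Fin.snoc x c : Fin (n + 1) → V) i, (Fin.snoc x' d : Fin (n + 1) → W) i) ∈ s) := by
      intro s c d hrs hcd i
      refine Fin.lastCases ?_ (fun i => ?_) i
      · simpa using hcd
      · simpa using hrs (hx i)
    constructor
    · intro h d
      obtain ⟨s, hrs, hs, c, hcd⟩ := hr.symm.forth hH hG hsG d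
      have hrs' : r ⊆ Prod.swap '' s := fun p hp => ⟨p.swap, hrs ⟨p, hp, rfl⟩, by simp⟩
      have hcd' : (c, d) ∈ Prod.swap '' s := ⟨_, hcd, rfl⟩
      exact (ih hs.symm _ _ (fun i => hrs' (hv i)) (key hrs' hcd')).1 (h c)
    · intro h c
      obtain ⟨s, hrs, hs, d, hcd⟩ := hr.forth hG hH hsH c
      exact (ih hs _ _ (fun i => hrs (hv i)) (key hrs hcd)).2 (h d)

theorem holds_iff [Nonempty V] [Nonempty W] (hG : FareyModel G) (hH : FareyModel H)
    (hsG : CountablySaturated G) (hsH : CountablySaturated H) {α : Type*}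
    (φ : Language.graph.Formula α) (hr : ClosedIso G H r) (v : α → V) (v' : α → W)
    (hv : ∀ i, (v i, v' i) ∈ r) : Holds G φ v ↔ Holds H φ v' :=
  hr.realize_iff hG hH hsG hsH φ v v' _ _ hv fun i => i.elim0

end ClosedIso

end Saturation

/-! ### Extending a partial isomorphism towards a vertex -/

section Extension

universe u

theorem ClosedIso.distEq_iff {V W : Type u} {G : SimpleGraph V} {H : SimpleGraph W}
    {r : Set (V × W)} [Nonempty V] [Nonempty W]
    (hG : FareyModel G) (hH : FareyModel H) (hsG : CountablySaturated G)
    (hsH : CountablySaturated H) (hr : ClosedIso G H r) {x y : V} {x' y' : W} (hx : (x, x') ∈ r)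
    (hy : (y, y') ∈ r) (k : ℕ) : DistEq G k x y ↔ DistEq H k x' y' := by
  obtain ⟨φ, hφ⟩ := FODef.distEq.{u} (α := Fin 2) k 0 1
  have h := hr.holds_iff hG hH hsG hsH φ ![x, y] ![x', y'] (by simp [Fin.forall_fin_two, hx, hy])
  rwa [hφ, hφ] at h

/-- Some copy of the Farey graph in `G` has its vertices `p`, `q`, `r` at prescribed distances from
`x`, `y`, `z`. -/
def FareyConfig {V : Type u} (G : SimpleGraph V) (p q r : FareyVertex) (k l m : ℕ) (x y z : V) :
    Prop :=
  ∃ Φ : fareyGraph ↪g G, DistEq G k x (Φ p) ∧ DistEq G l y (Φ q) ∧ DistEq G m z (Φ r)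

/-- `d` and `d'` are indistinguishable over the family `b` by distances and positions relative to
copies of the Farey graph. -/
structure SameConfig {V : Type u} (G : SimpleGraph V) {ι : Type*} (b : ι → V) (d d' : V) :
    Prop where
  dist : ∀ i k, DistEq G k (b i) d ↔ DistEq G k (b i) d'
  config : ∀ i j p q r k l m, p ≠ q → p ≠ r → q ≠ r →
    (FareyConfig G p q r k l m (b i) (b j) d ↔ FareyConfig G p q r k l m (b i) (b j) d')
  config_mid : ∀ i p q r k l m, p ≠ q → p ≠ r → q ≠ r →
    (FareyConfig G p q r k l m (b i) d (b i) ↔ FareyConfig G p q r k l m (b i) d' (b i))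

variable {V : Type u} {G : SimpleGraph V} {ι : Type*} {b : ι → V} {d d' : V}

theorem SameConfig.symm (h : SameConfig G b d d') : SameConfig G b d' d where
  dist i k := (h.dist i k).symm
  config i j p q r k l m h1 h2 h3 := (h.config i j p q r k l m h1 h2 h3).symm
  config_mid i p q r k l m h1 h2 h3 := (h.config_mid i p q r k l m h1 h2 h3).symm

theorem SameConfig.reachable (h : SameConfig G b d d') {i : ι} (hi : G.Reachable (b i) d) :
    G.Reachable (b i) d' :=
  ((h.dist i _).1 ⟨hi, rfl⟩).1

theorem SameConfig.dist_eq (h : SameConfig G b d d') {i : ι} (hi : G.Reachable (b i) d) :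
    G.dist (b i) d' = G.dist (b i) d :=
  ((h.dist i _).1 ⟨hi, rfl⟩).2

/-- Vertices that separate each other from a third one are equal. -/
theorem Separates.eq_of_separates {x y z : V} (h : Separates G x z y) (h' : Separates G y z x)
    (hxz : G.Reachable z x) (hyz : G.Reachable z y) : x = y := by
  have h1 := h.dist_eq hyz
  have h2 := h'.dist_eq hxz
  exact eq_of_reachable_of_dist (hxz.symm.trans hyz) (by omega)

/-- The embedding `Φ` of the Farey graph maps `p` to `w` and `q` to a different vertex on a geodesic
from `w` to `d`, at distance `k` from `d`. -/
structure Hop (G : SimpleGraph V) (w d : V) (Φ : fareyGraph ↪g G) (p q : FareyVertex) (k : ℕ) :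
    Prop where
  ne : p ≠ q
  left : Φ p = w
  distEq : DistEq G k d (Φ q)
  geodesic : G.dist w (Φ q) + k = G.dist w d

variable [Nonempty V] (hG : FareyModel G)
include hG

/-- Take the copy through the last edge `cw` of a path from `d`. The gate of `d` in it is not `w`,
since `d` reaches `c` without `w`. -/
theorem exists_hop {w d : V} (h : G.Reachable d w) (hne : d ≠ w) :
    ∃ Φ p q k, Hop G w d Φ p q k := by
  obtain ⟨c, hcw, hdc⟩ := (ConnIn.univ_iff.2 h).exists_last hne
  obtain ⟨Φ, h0, h1⟩ := hG.exists_embedding_edge hcw.symm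
  obtain ⟨_, ⟨q, rfl⟩, hq⟩ := hG.gated_range Φ d w ⟨_, h0⟩ h
  have hdq := (hq w ⟨_, h0⟩).reachable h
  have := (hq w ⟨_, h0⟩).symm.dist_eq h.symm
  refine ⟨Φ, fareyZero, q, _, fun he => ?_, h0, ⟨hdq, rfl⟩, ?_⟩
  · rw [← he, h0] at hq
    exact hq c ⟨_, h1⟩ (hdc.mono Set.inter_subset_right)
  · rw [this, G.dist_comm (u := d)]

/-- The gate of `d` in the copy is itself the end of a hop unless it is `Φ p`, and it lies between
`d` and `Φ q`. Minimality of `k` makes the two coincide; the case `Φ p` is settled by the geodesic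
condition. -/
theorem Hop.gate {w d : V} {Φ : fareyGraph ↪g G} {p q : FareyVertex} {k : ℕ}
    (h : Hop G w d Φ p q k) (hmin : ∀ Φ p q l, Hop G w d Φ p q l → k ≤ l) :
    ∀ x ∈ Set.range Φ, Separates G (Φ q) d x := by
  obtain ⟨hne, rfl, ⟨hr, rfl⟩, hg⟩ := h
  obtain ⟨_, ⟨q', rfl⟩, hq⟩ := hG.gated_range Φ d _ ⟨_, rfl⟩ hr
  have h1 := (hq (Φ q) ⟨_, rfl⟩).dist_eq hr
  have hrq := (hq (Φ q) ⟨_, rfl⟩).reachable hr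
  have hqq := (hG.twoConnected_range Φ).reachable (Φ q') ⟨_, rfl⟩ (Φ q) ⟨_, rfl⟩
  have hpq := (hG.twoConnected_range Φ).reachable (Φ p) ⟨_, rfl⟩ (Φ q) ⟨_, rfl⟩
  suffices G.dist (Φ q') (Φ q) = 0 by rwa [eq_of_reachable_of_dist hqq this] at hq
  by_cases hpq' : p = q'
  · subst hpq'
    have h2 := G.dist_comm (u := d) (v := Φ p)
    omega
  · have h3 := (hq (Φ p) ⟨_, rfl⟩).symm.dist_eq (hpq.trans hr.symm)
    have h4 := G.dist_comm (u := d) (v := Φ q')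
    have h5 := hmin Φ p q' _ ⟨hpq', rfl, ⟨hrq, rfl⟩, by omega⟩
    omega

variable (hsat : CountablySaturated G)
include hsat

/-- Two copies are matched by a `ClosedIso`, which preserves the first-order definable distance of
`G`. -/
theorem dist_embedding (Φ Ψ : fareyGraph ↪g G) (p q : FareyVertex) :
    G.dist (Φ p) (Φ q) = G.dist (Ψ p) (Ψ q) :=
  (((hG.closedIso_range hG Ψ Φ).distEq_iff hG hG hsat hsat ⟨p, rfl⟩ ⟨q, rfl⟩ _).1
    ⟨(hG.twoConnected_range Ψ).reachable _ ⟨p, rfl⟩ _ ⟨q, rfl⟩, rfl⟩).2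

/-- `config_mid`, with an idle third point, gives a copy whose `p` and `q` have the right distances
from `b i` and `d'`. These distances add up to that of `b i` and `d'`, so `p` lies on a geodesic and
must be the separating vertex `w'`. -/
theorem Hop.transfer {w w' : V} {Φ : fareyGraph ↪g G} {p q : FareyVertex} {k : ℕ}
    (h : Hop G w d Φ p q k) (hc : SameConfig G b d d') {i : ι} (hb : G.Reachable (b i) d)
    (hw : Separates G w d (b i)) (hw' : Separates G w' d' (b i))
    (hww' : G.dist (b i) w = G.dist (b i) w') : ∃ Ψ, Hop G w' d' Ψ p q k := by
  obtain ⟨hne, rfl, ⟨hr, rfl⟩, hg⟩ := h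
  obtain ⟨r, hrp, hrq⟩ := hG.exists_vertex_ne p q
  have hR := (hG.twoConnected_range Φ).reachable
  have hdp := hr.trans (hR (Φ q) ⟨_, rfl⟩ (Φ p) ⟨_, rfl⟩)
  obtain ⟨Ψ, ⟨h1, h2⟩, ⟨h3, h4⟩, -⟩ := (hc.config_mid i p q r _ _ _ hne hrp.symm hrq.symm).1
    ⟨Φ, ⟨hb.trans hdp, rfl⟩, ⟨hr, rfl⟩, ⟨hb.trans (hdp.trans (hR _ ⟨_, rfl⟩ _ ⟨r, rfl⟩)), rfl⟩⟩
  have e1 := dist_embedding hG hsat Φ Ψ p q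
  have e2 := hc.dist_eq hb
  have hb' := hc.reachable hb
  have e3 := hw.symm.dist_eq hb
  have e4 := hw'.symm.dist_eq hb'
  have e5 := dist_triangle_of_reachable
    ((hG.twoConnected_range Ψ).reachable (Ψ p) ⟨_, rfl⟩ (Ψ q) ⟨_, rfl⟩) h3.symm
  have e6 := G.dist_comm (u := d') (v := Ψ q)
  have e7 : Ψ p = w' := hw'.symm.eq_of_geodesic h1 (h1.symm.trans hb') (by omega) (by omega)
  refine ⟨Ψ, hne, e7, ⟨h3, h4⟩, ?_⟩
  rw [← e7] at hww' e4 ⊢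
  omega

/-- A partial isomorphism fixing `b i` can be extended to map `d` to `d'` if corresponding vertices
separate these from its domain and range. -/
theorem ClosedIso.extend (hc : SameConfig G b d d') {i : ι} (hb : G.Reachable (b i) d) (n : ℕ) :
    ∀ (s : Set (V × V)) (w w' : V), ClosedIso G G s → (b i, b i) ∈ s → (w, w') ∈ s →
      (∀ x ∈ s, Separates G w d x.1) → (∀ x ∈ s, Separates G w' d' x.2) → G.dist w d = n →
      ∃ t, s ⊆ t ∧ ClosedIso G G t ∧ (d, d') ∈ t := by
  have hb' := hc.reachable hb
  induction n using Nat.strong_induction_on with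
  | h n ih =>
    rintro s w w' hs hbs hws h1 h2 rfl
    have hw : Separates G w d (b i) := h1 _ hbs
    have hw' : Separates G w' d' (b i) := h2 _ hbs
    have hbw := hw.symm.reachable hb
    have hbw' := (hs.distEq_iff hG hG hsat hsat hbs hws _).1 ⟨hbw, rfl⟩
    have e1 := hw.symm.dist_eq hb
    have e2 := hw'.symm.dist_eq hb'
    have e3 := hc.dist_eq hb
    have e4 : G.dist (b i) w' = G.dist (b i) w := hbw'.2
    by_cases hdw : d = w
    · subst hdw
      have : w' = d' := eq_of_reachable_of_dist (hbw'.1.symm.trans hb') (by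
        rw [SimpleGraph.dist_self] at e1
        omega)
      exact ⟨s, subset_rfl, hs, this ▸ hws⟩
    classical
    have hex : ∃ k, ∃ Φ p q, Hop G w d Φ p q k := by
      obtain ⟨Φ, p, q, k, h⟩ := exists_hop hG (hb.symm.trans hbw) hdw
      exact ⟨k, Φ, p, q, h⟩
    -- A hop ending as near to `d` as possible. Since hops transfer in both directions, its
    -- counterpart is also minimal for `d'`, and both end in gates.
    obtain ⟨Φ, p, q, hΦ⟩ := Nat.find_spec hex
    obtain ⟨Ψ, hΨ⟩ := hΦ.transfer hG hsat hc hb hw hw' e4.symm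
    have gΦ := hΦ.gate hG fun Φ p q l h => Nat.find_min' hex ⟨Φ, p, q, h⟩
    have gΨ := hΨ.gate hG fun Ψ p q l h => by
      obtain ⟨Φ, h⟩ := h.transfer hG hsat hc.symm hb' hw' hw e4
      exact Nat.find_min' hex ⟨Φ, p, q, h⟩
    generalize Nat.find hex = k at hΦ hΨ
    obtain ⟨hne, rfl, ⟨hr, rfl⟩, hg⟩ := hΦ
    obtain ⟨-, rfl, ⟨hr', hk⟩, hg'⟩ := hΨ
    have hpos : ∀ (Φ : fareyGraph ↪g G), G.dist (Φ p) (Φ q) ≠ 0 := fun Φ h0 => hne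
      (Φ.injective (eq_of_reachable_of_dist
        ((hG.twoConnected_range Φ).reachable (Φ p) ⟨_, rfl⟩ (Φ q) ⟨_, rfl⟩) h0))
    have f1 := hpos Φ
    have f2 := hpos Ψ
    have f3 := G.dist_comm (u := d) (v := Φ p)
    have f4 := G.dist_comm (u := d') (v := Ψ p)
    have f5 := G.dist_comm (u := d) (v := Φ q)
    -- The end of the hop is nearer to `d` than `w`, while `w` separates `d` from the domain. After
    -- gluing, `Φ q` and `Ψ q` replace `w` and `w'`.
    have hq : Φ q ∉ Prod.fst '' s := by
      rintro ⟨x, hx, hxq⟩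
      have := (h1 x hx).dist_eq (hxq ▸ hr)
      rw [hxq] at this
      omega
    have hq' : Ψ q ∉ Prod.snd '' s := by
      rintro ⟨x, hx, hxq⟩
      have := (h2 x hx).dist_eq (hxq ▸ hr')
      rw [hxq] at this
      omega
    obtain ⟨t, hst, ht, hd⟩ := ih (G.dist (Φ q) d) (by omega) _ (Φ q) (Ψ q)
      (hs.glue_range hG hG hws hq hq') (.inl hbs) (.inr ⟨q, rfl⟩) (by
        rintro x (hx | ⟨y, rfl⟩)
        · exact fun h => gΦ (Φ p) ⟨_, rfl⟩ (h.pass (h1 x hx))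
        · exact gΦ _ ⟨_, rfl⟩) (by
        rintro x (hx | ⟨y, rfl⟩)
        · exact fun h => gΨ (Ψ p) ⟨_, rfl⟩ (h.pass (h2 x hx))
        · exact gΨ _ ⟨_, rfl⟩) rfl
    exact ⟨t, Set.subset_union_left.trans hst, ht, hd⟩

/-- Apply `forth` repeatedly from `G` to itself; the domain of the result is countable and gated. -/
theorem exists_gated_countable (F : Finset V) : ∃ A, Gated G A ∧ A.Countable ∧ ↑F ⊆ A := by
  classical
  suffices ∃ r, ClosedIso G G r ∧ ∀ x ∈ F, ∃ y, (x, y) ∈ r by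
    obtain ⟨r, hr, hF⟩ := this
    exact ⟨Prod.fst '' r, hr.gated_fst, hr.countable.image _, fun x hx => by
      obtain ⟨y, hy⟩ := hF x hx
      exact ⟨_, hy, rfl⟩⟩
  induction F using Finset.induction_on with
  | empty => exact ⟨∅, .empty, by simp⟩
  | insert a F _ ih =>
    obtain ⟨r, hr, hF⟩ := ih
    obtain ⟨s, hrs, hs, y, hy⟩ := hr.forth hG hG hsat a
    refine ⟨s, hs, fun x hx => ?_⟩
    rcases Finset.mem_insert.1 hx with rfl | hx
    · exact ⟨y, hy⟩
    · obtain ⟨y, hy⟩ := hF x hx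
      exact ⟨y, hrs hy⟩

omit hG hsat [Nonempty V] in
theorem Gated.reachable_part {A : Set V} (hA : Gated G A) (P : V → Prop)
    (hP : ∀ x y, G.Reachable x y → P x → P y) : Gated G {z | z ∈ A ∧ P z} := by
  rintro z a ⟨ha, hPa⟩ hza
  obtain ⟨w, hw, hsep⟩ := hA z a ha hza
  exact ⟨w, ⟨hw, hP a w (hza.symm.trans ((hsep a ha).reachable hza)) hPa⟩, fun h hh => hsep h hh.1⟩

omit hG hsat [Nonempty V] in
/-- An automorphism of a copy of the Farey graph, extended by the identity. -/
theorem ClosedIso.diag_union_automorphism {A : Set V} (hA : Gated G A) (hc : A.Countable)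
    (Φ : fareyGraph ↪g G) (σ : fareyGraph ≃g fareyGraph) (hΦ : Set.range Φ ⊆ A)
    (hσ : ∀ v, ∀ z ∈ A, z ∉ Set.range Φ → G.Adj (Φ v) z → σ v = v) :
    ClosedIso G G ((Set.range fun v => (Φ v, Φ (σ v))) ∪ (fun z => (z, z)) '' (A \ Set.range Φ)) := by
  have h1 : Prod.fst '' ((Set.range fun v => (Φ v, Φ (σ v))) ∪
      (fun z => (z, z)) '' (A \ Set.range Φ)) = A := by
    rw [Set.image_union, Set.image_image, Set.image_id', ← Set.range_comp]
    exact Set.union_sdiff_cancel hΦ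
  have h2 : Prod.snd '' ((Set.range fun v => (Φ v, Φ (σ v))) ∪
      (fun z => (z, z)) '' (A \ Set.range Φ)) = A := by
    rw [Set.image_union, Set.image_image, Set.image_id', ← Set.range_comp]
    change Set.range (Φ ∘ σ) ∪ _ = A
    rw [σ.surjective.range_comp]
    exact Set.union_sdiff_cancel hΦ
  have hadj : ∀ v, ∀ z ∈ A, z ∉ Set.range Φ → (G.Adj (Φ v) z ↔ G.Adj (Φ (σ v)) z) := by
    intro v z hz hzR
    constructor
    · intro h
      rwa [hσ v z hz hzR h]
    · intro h
      rwa [σ.injective (hσ _ z hz hzR h)] at h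
  refine ⟨(Set.countable_range _).union ((hc.mono Set.sdiff_subset).image _), ?_, ?_,
    by rwa [h1], by rwa [h2]⟩
  · rintro _ (⟨v, rfl⟩ | ⟨z, hz, rfl⟩) _ (⟨v', rfl⟩ | ⟨z', hz', rfl⟩)
    · simp
    · exact iff_of_false (fun h => hz'.2 ⟨_, h⟩) (fun h => hz'.2 ⟨_, h⟩)
    · exact iff_of_false (fun h => hz.2 ⟨_, h.symm⟩) (fun h => hz.2 ⟨_, h.symm⟩)
    · exact Iff.rfl
  · rintro _ (⟨v, rfl⟩ | ⟨z, hz, rfl⟩) _ (⟨v', rfl⟩ | ⟨z', hz', rfl⟩)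
    · simp [σ.map_adj_iff]
    · exact hadj v z' hz'.1 hz'.2
    · rw [G.adj_comm, G.adj_comm z]
      exact hadj v' z hz.1 hz.2
    · exact Iff.rfl

end Extension

/-! ### Partial isomorphisms fixing a tuple: the separate cases -/

section MainExtension

universe u

variable {V : Type u} {G : SimpleGraph V} {ι : Type*} {b : ι → V} {d d' : V}
variable [Nonempty V]

/-- A vertex off the gate of `y` in a copy of the Farey graph that separates `d` from `y` separates
`d` from the copy. -/
theorem separates_range (hG : FareyModel G) {Φ : fareyGraph ↪g G} {x y g d : V}
    (hx : x ∈ Set.range Φ) (hg : g ∈ Set.range Φ) (hxg : x ≠ g) (hgate : ∀ r ∈ Set.range Φ, Separates G g y r)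
    (hreach : G.Reachable y g) (hsep : Separates G x d y) : ∀ r ∈ Set.range Φ, Separates G x d r := by
  intro r hr h
  have h1 := (hG.twoConnected_range Φ).connIn x r hr g hg h.right_mem hxg.symm
  have h2 : ConnIn G {x}ᶜ y g := by
    by_contra h2
    exact hxg (Separates.eq_of_separates h2 (hgate x hx) (Separates.reachable h2 hreach) hreach)
  exact hsep ((h.trans h1).trans h2.symm)

/-- If all vertices of `b` connected to `d` are separated from `d` by `w` and from `d'` by `w'`, and
some automorphism of a copy of the Farey graph moves `w` to `w'` but fixes the gates of `b`, the
required partial isomorphism exists. -/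
theorem exists_closedIso_of_automorphism (hG : FareyModel G) (hsat : CountablySaturated G)
    [Finite ι] (hc : SameConfig G b d d') {i : ι} (hi : G.Reachable (b i) d)
    (Φ : fareyGraph ↪g G) (σ : fareyGraph ≃g fareyGraph) {w w' : FareyVertex} (hne : w ≠ w')
    (hw : σ w = w') (hw' : σ w' = w) (hsw : Separates G (Φ w) d (b i))
    (hsw' : Separates G (Φ w') d' (b i)) (g : ι → FareyVertex)
    (hg : ∀ j, G.Reachable (b j) d → σ (g j) = g j ∧ ∀ r ∈ Set.range Φ, Separates G (Φ (g j)) (b j) r) :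
    ∃ r, ClosedIso G G r ∧ (∀ j, (b j, b j) ∈ r) ∧ (d, d') ∈ r := by
  classical
  have hdw := hsw.reachable hi.symm
  obtain ⟨c, hwc⟩ := hG.fareyGraph_exists_adj w
  have hfin := Set.finite_range b
  obtain ⟨A, hA, hAc, hFA⟩ := exists_gated_countable hG hsat (hfin.toFinset ∪ {Φ w, Φ c})
  have hbA : ∀ j, b j ∈ A := fun j => hFA (by simp)
  have hRA : Set.range Φ ⊆ A := hA.subset_of_two (hG.twoConnected_range Φ)
    (fun h => hwc.ne (Φ.injective h)) (hFA (by simp)) ⟨w, rfl⟩ (hFA (by simp)) ⟨c, rfl⟩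
  have hgi := hg i hi
  have hgreach : ∀ j, G.Reachable (b j) d → G.Reachable (b j) (Φ (g j)) := fun j hj =>
    ((hg j hj).2 (Φ w) ⟨_, rfl⟩).reachable (hj.trans hdw)
  have hwg : ∀ j, G.Reachable (b j) d → ∀ v, σ v ≠ v → Φ v ≠ Φ (g j) := by
    intro j hj v hv h
    exact hv (Φ.injective h ▸ (hg j hj).1)
  have hσw : σ w ≠ w := fun h => hne (h.symm.trans hw)
  have hσw' : σ w' ≠ w' := fun h => hne (hw'.symm.trans h)
  have hsd := separates_range hG ⟨w, rfl⟩ ⟨g i, rfl⟩ (hwg i hi w hσw) hgi.2 (hgreach i hi) hsw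
  have hsd' := separates_range hG ⟨w', rfl⟩ ⟨g i, rfl⟩ (hwg i hi w' hσw') hgi.2 (hgreach i hi) hsw'
  -- The identity outside the copy is compatible with `σ` only where parts hang at fixed vertices.
  -- The parts hanging at moved vertices are cut off.
  let bad : V → V → Prop := fun x z => (∃ v, Φ v = x ∧ σ v ≠ v) ∧ G.Reachable z x ∧ z ≠ x ∧
    ∀ r ∈ Set.range Φ, Separates G x z r
  have hbadR : ∀ v x, ¬ bad x (Φ v) := fun v x h => h.2.2.2 (Φ v) ⟨v, rfl⟩ (.refl h.2.2.1)
  have hA' : Gated G {z | z ∈ A ∧ ∀ x, ¬ bad x z} := by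
    refine hA.prune bad ?_ ?_
    · rintro x z z' ⟨h1, h2, h3, h4⟩ hzz'
      exact ⟨h1, hzz'.reachable.symm.trans h2, hzz'.right_mem, fun r hr h => h4 r hr (hzz'.trans h)⟩
    · rintro _ z ⟨⟨v, rfl, hv⟩, -⟩
      exact ⟨hRA ⟨v, rfl⟩, hbadR v⟩
  have hs := ClosedIso.diag_union_automorphism hA' (hAc.mono fun z hz => hz.1) Φ σ
    (by
      rintro _ ⟨v, rfl⟩
      exact ⟨hRA ⟨v, rfl⟩, hbadR v⟩) (by
      intro v z hz hzR hvz
      by_contra hv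
      refine hz.2 (Φ v) ⟨⟨v, rfl, hv⟩, hvz.symm.reachable, hvz.ne', ?_⟩
      obtain ⟨x, hx, hsep⟩ := hG.gated_range Φ z _ ⟨v, rfl⟩ hvz.symm.reachable
      rcases (hsep _ ⟨v, rfl⟩).eq_of_adj hvz.symm with rfl | rfl
      · exact absurd hx hzR
      · exact hsep)
  have hsepA : ∀ v e, σ v ≠ v → G.Reachable e (Φ v) → (∀ r ∈ Set.range Φ, Separates G (Φ v) e r) →
      ∀ z, (∀ x, ¬ bad x z) → Separates G (Φ v) e z := by
    intro v e hv he hsep z hz h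
    exact hz (Φ v) ⟨⟨v, rfl, hv⟩, h.reachable.symm.trans he, h.right_mem,
      fun r hr h' => hsep r hr (h.trans h')⟩
  -- The members of `b` survive: those connected to the copy have gates fixed by `σ`.
  have hbs : ∀ j, (b j, b j) ∈ (Set.range fun v => (Φ v, Φ (σ v))) ∪
      (fun z => (z, z)) '' ({z | z ∈ A ∧ ∀ x, ¬ bad x z} \ Set.range Φ) := by
    intro j
    by_cases hjR : b j ∈ Set.range Φ
    · left
      obtain ⟨v, hv⟩ := hjR
      have hj : G.Reachable (b j) d := by
        rw [← hv]
        exact ((hG.twoConnected_range Φ).reachable _ ⟨v, rfl⟩ _ ⟨w, rfl⟩).trans hdw.symm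
      have hgj := hg j hj
      have : b j = Φ (g j) := by
        by_contra hne
        exact hgj.2 (b j) ⟨v, hv⟩ (.refl hne)
      exact ⟨g j, by simp only [hgj.1, this]⟩
    · right
      refine ⟨b j, ⟨⟨hbA j, ?_⟩, hjR⟩, rfl⟩
      rintro _ ⟨⟨v, rfl, hv⟩, h1, h2, h3⟩
      have hj : G.Reachable (b j) d := (h1.trans ((hG.twoConnected_range Φ).reachable _ ⟨v, rfl⟩ _
        ⟨w, rfl⟩)).trans hdw.symm
      exact hwg j hj v hv (Separates.eq_of_separates (h3 _ ⟨_, rfl⟩) ((hg j hj).2 _ ⟨v, rfl⟩) h1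
        (hgreach j hj))
  have hdw' := hsw'.reachable (hc.reachable hi).symm
  obtain ⟨t, hst, ht, hd⟩ := ClosedIso.extend hG hsat hc hi _ _ (Φ w) (Φ w') hs (hbs i)
    (.inl ⟨w, by simp only [hw]⟩) (by
      rintro _ (⟨v, rfl⟩ | ⟨z, hz, rfl⟩)
      · exact hsd _ ⟨v, rfl⟩
      · exact hsepA w d hσw hdw hsd z hz.1.2) (by
      rintro _ (⟨v, rfl⟩ | ⟨z, hz, rfl⟩)
      · exact hsd' _ ⟨σ v, rfl⟩
      · exact hsepA w' d' hσw' hdw' hsd' z hz.1.2) rfl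
  exact ⟨t, ht, fun j => hst (hbs j), hd⟩

/-- The case of a common separating vertex. -/
theorem exists_closedIso_of_separates (hG : FareyModel G) (hsat : CountablySaturated G)
    [Finite ι] (hc : SameConfig G b d d') {i : ι} (hi : G.Reachable (b i) d) {w : V}
    (hw : ∀ j, G.Reachable (b j) d → Separates G w d (b j))
    (hw' : ∀ j, G.Reachable (b j) d → Separates G w d' (b j)) :
    ∃ r, ClosedIso G G r ∧ (∀ j, (b j, b j) ∈ r) ∧ (d, d') ∈ r := by
  classical
  have hfin := Set.finite_range b
  obtain ⟨A, hA, hAc, hFA⟩ := exists_gated_countable hG hsat (hfin.toFinset ∪ {w})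
  have hbA : ∀ j, b j ∈ A := fun j => hFA (by simp)
  have hwA : w ∈ A := hFA (by simp)
  -- Cut off the components of `d` and `d'` outside `w`, so that `w` separates both from the
  -- remaining set; no member of `b` is lost.
  let bad : V → V → Prop := fun x z => x = w ∧ (ConnIn G {w}ᶜ d z ∨ ConnIn G {w}ᶜ d' z)
  have hA' : Gated G {z | z ∈ A ∧ ∀ x, ¬ bad x z} := by
    refine hA.prune bad ?_ ?_
    · rintro x z z' ⟨rfl, h⟩ hzz'
      exact ⟨rfl, h.imp (·.trans hzz') (·.trans hzz')⟩
    · rintro x z ⟨rfl, h⟩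
      exact ⟨hwA, fun y hy => hy.2.elim (fun h => h.right_mem rfl) (fun h => h.right_mem rfl)⟩
  have hbs : ∀ j, b j ∈ {z | z ∈ A ∧ ∀ x, ¬ bad x z} := by
    refine fun j => ⟨hbA j, ?_⟩
    rintro x ⟨rfl, h | h⟩
    · exact hw j h.reachable.symm h
    · exact hw' j (hc.symm.reachable h.reachable.symm) h
  have hws : w ∈ {z | z ∈ A ∧ ∀ x, ¬ bad x z} :=
    ⟨hwA, fun y hy => hy.2.elim (fun h => h.right_mem rfl) (fun h => h.right_mem rfl)⟩
  obtain ⟨t, hst, ht, hd⟩ := ClosedIso.extend hG hsat hc hi _ _ w w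
    (ClosedIso.diag hA' (hAc.mono fun z hz => hz.1)) ⟨_, hbs i, rfl⟩ ⟨_, hws, rfl⟩ (by
      rintro _ ⟨z, hz, rfl⟩ h
      exact hz.2 w ⟨rfl, .inl h⟩) (by
      rintro _ ⟨z, hz, rfl⟩ h
      exact hz.2 w ⟨rfl, .inr h⟩) rfl
  exact ⟨t, ht, fun j => hst ⟨_, hbs j, rfl⟩, hd⟩

/-- The case that `d` is not connected to `b`. -/
theorem exists_closedIso_of_not_reachable (hG : FareyModel G) (hsat : CountablySaturated G)
    [Finite ι] (hc : SameConfig G b d d') (hi : ∀ i, ¬ G.Reachable (b i) d) :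
    ∃ r, ClosedIso G G r ∧ (∀ j, (b j, b j) ∈ r) ∧ (d, d') ∈ r := by
  have hfin := Set.finite_range b
  obtain ⟨A, hA, hAc, hFA⟩ := exists_gated_countable hG hsat hfin.toFinset
  have hA' := hA.reachable_part (fun z => ∃ j, G.Reachable (b j) z)
    fun x y hxy ⟨j, hj⟩ => ⟨j, hj.trans hxy⟩
  refine ⟨_, (ClosedIso.diag hA' (hAc.mono fun z hz => hz.1)).union_of_not_reachable
    (.singleton d d') ?_ ?_, fun j => .inl ⟨b j, ⟨hFA (by simp), j, .refl _⟩, rfl⟩, .inr rfl⟩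
  · rintro _ ⟨z, ⟨-, j, hj⟩, rfl⟩ _ rfl h
    exact hi j (hj.trans h)
  · rintro _ ⟨z, ⟨-, j, hj⟩, rfl⟩ _ rfl h
    exact hi j (hc.symm.reachable (hj.trans h))

omit [Nonempty V] in
/-- Vertices that separate `d'` from members of `b` and have the same distances as one vertex `w` that
separates `d` from all `b i` coincide. -/
theorem separating_eq (hc : SameConfig G b d d') {w w₁ w₂ : V} {i j : ι}
    (hi : G.Reachable (b i) d) (hj : G.Reachable (b j) d)
    (hw : ∀ j, G.Reachable (b j) d → Separates G w d (b j))
    (h1 : Separates G w₁ d' (b i)) (h2 : Separates G w₂ d' (b j))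
    (e1 : G.dist (b i) w₁ = G.dist (b i) w) (e2 : G.dist (b j) w₂ = G.dist (b j) w) :
    w₁ = w₂ := by
  by_contra hne
  have hi' := hc.reachable hi
  have hj' := hc.reachable hj
  have a1 := (hw i hi).symm.dist_eq hi
  have a2 := (hw j hj).symm.dist_eq hj
  have a3 := h1.symm.dist_eq hi'
  have a4 := h2.symm.dist_eq hj'
  have a5 := hc.dist_eq hi
  have a6 := hc.dist_eq hj
  have r1 := h1.symm.reachable hi'
  have r2 := h2.symm.reachable hj'
  have r3 := (hw i hi).symm.reachable hi
  have r4 := (hw j hj).symm.reachable hj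
  have c1 := G.dist_comm (u := d') (v := w₁)
  have c2 := G.dist_comm (u := d') (v := w₂)
  -- Both `w₁` and `w₂` have the distance of `w` and `d` from `d'`. If `w₁` also separated `d'` from
  -- `b j`, it would be the only vertex at that distance on a geodesic, hence `w₂`.
  have k1 : ConnIn G {w₁}ᶜ d' (b j) := by
    by_contra h
    have h' : Separates G w₁ d' (b j) := h
    have := h'.dist_eq hj'.symm
    have c3 := G.dist_comm (u := d') (v := b j)
    have c4 := G.dist_comm (u := w₂) (v := b j)
    refine hne (h2.eq_of_geodesic (hi'.symm.trans r1) (r1.symm.trans (hi'.trans hj'.symm))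
      (by omega) (by omega))
  have k2 : Separates G w₁ (b j) (b i) := fun h => h1 (k1.trans h)
  have k3 : Separates G w₂ (b j) w₁ := by
    intro h
    have k : Separates G w₂ d' w₁ := fun h' => h2 (h'.trans h.symm)
    have := k.dist_eq (hi'.symm.trans r1)
    have : G.dist w₂ w₁ = 0 := by omega
    exact hne (eq_of_reachable_of_dist (r2.symm.trans (hj'.trans (hi'.symm.trans r1))) this).symm
  have hji : G.Reachable (b j) (b i) := hj.trans hi.symm
  -- The path from `b j` to `b i` now runs through `w₂` and then `w₁`, so it is longer than the
  -- detour through `w` permits.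
  have b1 := k2.dist_eq hji
  have b2 := k3.dist_eq (hji.trans r1)
  have b3 := dist_triangle_of_reachable r4 r3.symm
  have b4 : G.dist w₂ w₁ ≠ 0 := fun h =>
    hne (eq_of_reachable_of_dist (r2.symm.trans (hji.trans r1)) h).symm
  have c5 := G.dist_comm (u := w₁) (v := b i)
  have c6 := G.dist_comm (u := w) (v := b i)
  omega

end MainExtension

/-! ### The extension theorem -/

section MainExtension

universe u

variable {V : Type u} {G : SimpleGraph V} {ι : Type*} {b : ι → V} {d d' : V}

theorem exists_automorphism (Φ Ψ : fareyGraph ↪g G) (h : Set.range Φ = Set.range Ψ) :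
    ∃ σ : fareyGraph ≃g fareyGraph, ∀ v, Φ (σ v) = Ψ v := by
  have h1 : ∀ v, ∃ u, Φ u = Ψ v := fun v => h.symm.subset ⟨v, rfl⟩
  choose f hf using h1
  have hbij : Function.Bijective f := by
    refine ⟨fun u v huv => Ψ.injective ?_, fun u => ?_⟩
    · rw [← hf, ← hf, huv]
    · obtain ⟨v, hv⟩ := h.subset ⟨u, rfl⟩
      exact ⟨v, Φ.injective ((hf v).trans hv)⟩
  refine ⟨⟨Equiv.ofBijective f hbij, fun {u v} => ?_⟩, hf⟩
  change fareyGraph.Adj (f u) (f v) ↔ _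
  rw [← Φ.map_adj_iff, hf, hf, Ψ.map_adj_iff]

variable [Nonempty V]

/-- The configuration of `b i`, `b j`, `d` in `Φ` recurs for `d'` in a copy `Ψ`. The gates separate
`b i` from `b j`, so the distances force `Ψ` to agree with `Φ` at `p` and `q`, and to map `r` to
`w'`. Sharing two vertices, the copies have the same range, and the automorphism compares them. -/
theorem exists_automorphism_of_gates (hG : FareyModel G) (hsat : CountablySaturated G)
    (hc : SameConfig G b d d') (Φ : fareyGraph ↪g G) {i j : ι} (hi : G.Reachable (b i) d)
    (hj : G.Reachable (b j) d) {p q r : FareyVertex} (hpq : p ≠ q) (hpr : p ≠ r) (hqr : q ≠ r)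
    (hp : ∀ x ∈ Set.range Φ, Separates G (Φ p) (b i) x)
    (hq : ∀ x ∈ Set.range Φ, Separates G (Φ q) (b j) x)
    (hw : Separates G (Φ r) d (b i)) {w' : V} (hw' : Separates G w' d' (b i))
    (hdist : G.dist (b i) w' = G.dist (b i) (Φ r)) :
    ∃ σ : fareyGraph ≃g fareyGraph, σ p = p ∧ σ q = q ∧ Φ (σ r) = w' := by
  have hR := (hG.twoConnected_range Φ).reachable
  have hdr := hw.reachable hi.symm
  have hip := (hp (Φ r) ⟨r, rfl⟩).reachable (hi.trans hdr)
  have hjq := (hq (Φ r) ⟨r, rfl⟩).reachable (hj.trans hdr)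
  obtain ⟨Ψ, ⟨h1, h2⟩, ⟨h3, h4⟩, ⟨h5, h6⟩⟩ := (hc.config i j p q r _ _ _ hpq hpr hqr).1
    ⟨Φ, ⟨hip, rfl⟩, ⟨hjq, rfl⟩, ⟨hdr, rfl⟩⟩
  have hRΨ := (hG.twoConnected_range Ψ).reachable
  have d1 := dist_embedding hG hsat Φ Ψ p q
  have d2 := dist_embedding hG hsat Φ Ψ p r
  have hij := hi.trans hj.symm
  have s1 : Separates G (Φ p) (b i) (b j) := by
    intro h
    have hqp : ConnIn G {Φ p}ᶜ (b j) (Φ q) := by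
      by_contra hs
      exact hpq (Φ.injective (Separates.eq_of_separates hs (hq _ ⟨p, rfl⟩)
        (Separates.reachable hs hjq) hjq))
    exact hp (Φ q) ⟨q, rfl⟩ (h.trans hqp)
  have s2 : Separates G (Φ q) (b j) (b i) := by
    intro h
    have hqp : ConnIn G {Φ q}ᶜ (b i) (Φ p) := by
      by_contra hs
      exact hpq.symm (Φ.injective (Separates.eq_of_separates hs (hp _ ⟨q, rfl⟩)
        (Separates.reachable hs hip) hip))
    exact hq (Φ p) ⟨p, rfl⟩ (h.trans hqp)
  have e1 := s1.dist_eq hij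
  have e2 := s2.dist_eq hij.symm
  have e3 := (hq (Φ p) ⟨p, rfl⟩).dist_eq (hij.symm.trans hip)
  have t1 := dist_triangle_of_reachable (hRΨ (Ψ p) ⟨p, rfl⟩ (Ψ q) ⟨q, rfl⟩) h3.symm
  have t2 := dist_triangle_of_reachable (hRΨ (Ψ q) ⟨q, rfl⟩ (Ψ p) ⟨p, rfl⟩) h1.symm
  have c1 := G.dist_comm (u := Φ p) (v := b j)
  have c2 := G.dist_comm (u := Φ q) (v := Φ p)
  have c3 := G.dist_comm (u := Ψ q) (v := b j)
  have c4 := G.dist_comm (u := Ψ p) (v := b i)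
  have c5 := G.dist_comm (u := b j) (v := b i)
  have c6 := G.dist_comm (u := Ψ q) (v := Ψ p)
  have f1 : Ψ p = Φ p := s1.eq_of_geodesic h1 (h1.symm.trans hij) (by omega) h2
  have f2 : Ψ q = Φ q := s2.eq_of_geodesic h3 (h3.symm.trans hij.symm) (by omega) h4
  have hi' := hc.reachable hi
  have e4 := (hp (Φ r) ⟨r, rfl⟩).dist_eq (hi.trans hdr)
  have e5 := hw.symm.dist_eq hi
  have e6 := hw'.symm.dist_eq hi'
  have e7 := hc.dist_eq hi
  have e8 := hw'.dist_eq hi'.symm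
  have t3 := dist_triangle_of_reachable (hRΨ (Ψ r) ⟨r, rfl⟩ (Ψ p) ⟨p, rfl⟩) h1.symm
  have c7 := G.dist_comm (u := Ψ r) (v := Ψ p)
  have c8 := G.dist_comm (u := Φ r) (v := d)
  have c9 := G.dist_comm (u := w') (v := d')
  have c10 := G.dist_comm (u := w') (v := b i)
  have f3 : Ψ r = w' := hw'.eq_of_geodesic h5 (h5.symm.trans hi'.symm) (by omega) (by omega)
  obtain ⟨σ, hσ⟩ := exists_automorphism Φ Ψ (hG.range_eq (u := Φ p) (v := Φ q)
    (fun h => hpq (Φ.injective h)) ⟨p, rfl⟩ ⟨q, rfl⟩ ⟨p, f1⟩ ⟨q, f2⟩)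
  exact ⟨σ, Φ.injective ((hσ p).trans f1), Φ.injective ((hσ q).trans f2), (hσ r).trans f3⟩

/-- The extension theorem: indistinguishable elements correspond under a partial isomorphism fixing
the family `b`. -/
theorem SameConfig.exists_closedIso (hG : FareyModel G) (hsat : CountablySaturated G)
    [Finite ι] (hc : SameConfig G b d d') :
    ∃ r, ClosedIso G G r ∧ (∀ j, (b j, b j) ∈ r) ∧ (d, d') ∈ r := by
  by_cases hI : ∀ i, ¬ G.Reachable (b i) d
  · exact exists_closedIso_of_not_reachable hG hsat hc hI
  push Not at hI
  obtain ⟨i, hi⟩ := hI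
  -- A common separating vertex exists, namely `d` itself; one farthest from `d` is chosen.
  obtain ⟨w, hw, hmax⟩ : ∃ w, (∀ j, G.Reachable (b j) d → Separates G w d (b j)) ∧
      ∀ v, (∀ j, G.Reachable (b j) d → Separates G v d (b j)) → G.dist d v ≤ G.dist d w := by
    have hbdd : ∀ n, (∃ v, (∀ j, G.Reachable (b j) d → Separates G v d (b j)) ∧ G.dist d v = n) →
        n ≤ G.dist d (b i) := by
      rintro _ ⟨v, hv, rfl⟩
      have := (hv i hi).dist_eq hi.symm
      omega
    classical
    have h0 : ∃ v, (∀ j, G.Reachable (b j) d → Separates G v d (b j)) ∧ G.dist d v = 0 :=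
      ⟨d, fun _ _ => .left, SimpleGraph.dist_self⟩
    obtain ⟨w, hw, h⟩ := Nat.findGreatest_spec (P := fun n => ∃ v, (∀ j, G.Reachable (b j) d →
      Separates G v d (b j)) ∧ G.dist d v = n) (Nat.zero_le (G.dist d (b i))) h0
    refine ⟨w, hw, fun v hv => ?_⟩
    rw [h]
    exact Nat.le_findGreatest (hbdd _ ⟨v, hv, rfl⟩) ⟨v, hv, rfl⟩
  have hdw := (hw i hi).reachable hi.symm
  -- For a single `b j` the extension from the singleton already exists, and it carries `w` to a
  -- counterpart. `separating_eq` then shows that the counterpart does not depend on `j`.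
  have key : ∀ j, G.Reachable (b j) d → ∃ w', Separates G w' d' (b j) ∧
      G.dist (b j) w' = G.dist (b j) w := by
    intro j hj
    obtain ⟨t, hst, ht, hd⟩ := ClosedIso.extend hG hsat hc hj _ _ _ _
      (ClosedIso.singleton (b j) (b j)) rfl rfl (by
        rintro _ rfl
        exact .right) (by
        rintro _ rfl
        exact .right) rfl
    have hb := hst (Set.mem_singleton (b j, b j))
    obtain ⟨⟨w, w'⟩, hww', rfl⟩ := ht.gated_fst.mem_of_separates ⟨_, hd, rfl⟩ ⟨_, hb, rfl⟩ hj.symm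
      (hw j hj)
    exact ⟨w', ht.separates hww' hd hb (hw j hj), ((ht.distEq_iff hG hG hsat hsat hb hww' _).1
      ⟨hj.trans hdw, rfl⟩).2⟩
  obtain ⟨w', hw'i, hdi⟩ := key i hi
  have hw' : ∀ j, G.Reachable (b j) d → Separates G w' d' (b j) ∧
      G.dist (b j) w' = G.dist (b j) w := by
    intro j hj
    obtain ⟨w₂, h1, h2⟩ := key j hj
    rw [separating_eq hc hi hj hw hw'i h1 hdi h2]
    exact ⟨h1, h2⟩
  by_cases hww' : w' = w
  · subst hww'
    exact exists_closedIso_of_separates hG hsat hc hi hw fun j hj => (hw' j hj).1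
  have hwb : ∀ j, G.Reachable (b j) d → b j ≠ w := by
    rintro j hj rfl
    have h := (hw' j hj).2
    rw [SimpleGraph.dist_self] at h
    exact hww' (eq_of_reachable_of_dist ((hw' j hj).1.symm.reachable (hc.reachable hj)) h).symm
  obtain ⟨c, hcw, hbc⟩ := (ConnIn.univ_iff.2 (hi.trans hdw)).exists_last (hwb i hi)
  replace hbc := hbc.mono (T := {w}ᶜ) Set.inter_subset_right
  obtain ⟨Φ, hΦ, rfl⟩ := hG.exists_embedding_edge hcw.symm
  obtain ⟨r, rfl⟩ : ∃ r, Φ r = w := ⟨_, hΦ⟩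
  have hgate : ∀ j, ∃ p, G.Reachable (b j) d → ∀ x ∈ Set.range Φ, Separates G (Φ p) (b j) x := by
    intro j
    by_cases hj : G.Reachable (b j) d
    · obtain ⟨_, ⟨p, rfl⟩, hp⟩ := hG.gated_range Φ (b j) _ ⟨r, rfl⟩ (hj.trans hdw)
      exact ⟨p, fun _ => hp⟩
    · exact ⟨r, fun h => absurd h hj⟩
  choose g hg using hgate
  have hgreach : ∀ j, G.Reachable (b j) d → G.Reachable (b j) (Φ (g j)) := fun j hj =>
    (hg j hj _ ⟨r, rfl⟩).reachable (hj.trans hdw)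
  -- If the gate of `b j` were `w`, then `w` would separate `b j` from `b i`, and `w'` would be the
  -- vertex of a geodesic at the same place, hence `w`.
  have hgr : ∀ j, G.Reachable (b j) d → g j ≠ r := by
    intro j hj hgj
    have hgate := hg j hj
    rw [hgj] at hgate
    have hs : Separates G (Φ r) (b j) (b i) := fun h => hgate _ ⟨_, rfl⟩ (h.trans hbc)
    have hji := hj.trans hi.symm
    have e1 := hs.dist_eq hji
    have r1 := (hw' i hi).1.symm.reachable (hc.reachable hi)
    have c1 := G.dist_comm (u := w') (v := b i)
    have c2 := G.dist_comm (u := Φ r) (v := b i)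
    have e2 := (hw' j hj).2
    exact hww' (hs.eq_of_geodesic (hji.trans r1) r1.symm (by omega) e2)
  -- If all gates agreed, the common gate would be a common separating vertex farther from `d` than
  -- `w`.
  obtain ⟨j, hj, hji⟩ : ∃ j, G.Reachable (b j) d ∧ g i ≠ g j := by
    by_contra! hall
    have hsg : ∀ j, G.Reachable (b j) d → Separates G (Φ (g i)) d (b j) := by
      intro j hj h
      have hgj := hg j hj _ ⟨r, rfl⟩
      rw [← hall j hj] at hgj
      exact hgj (h.symm.trans (h.pass (hw j hj)))
    have h1 := hmax _ hsg
    have h2 := (hsg i hi).dist_eq hi.symm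
    have h3 := (hw i hi).dist_eq hi.symm
    have h4 := (hg i hi _ ⟨r, rfl⟩).dist_eq (hi.trans hdw)
    have c1 := G.dist_comm (u := Φ r) (v := b i)
    have c2 := G.dist_comm (u := Φ (g i)) (v := b i)
    have h5 : G.dist (Φ (g i)) (Φ r) = 0 := by omega
    exact hgr i hi (Φ.injective (eq_of_reachable_of_dist
      ((hG.twoConnected_range Φ).reachable _ ⟨_, rfl⟩ _ ⟨_, rfl⟩) h5))
  have haut : ∀ l, G.Reachable (b l) d → g i ≠ g l → ∃ σ : fareyGraph ≃g fareyGraph,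
      σ (g i) = g i ∧ σ (g l) = g l ∧ Φ (σ r) = w' := fun l hl hil =>
    exists_automorphism_of_gates hG hsat hc Φ hi hl hil (hgr i hi) (hgr l hl) (hg i hi) (hg l hl)
      (hw i hi) hw'i hdi
  obtain ⟨σ, hσi, hσj, hσr⟩ := haut j hj hji
  subst hσr
  have hfix := fun (σ : fareyGraph ≃g fareyGraph) (p q : FareyVertex) =>
    hG.fareyGraph_model.fix_two hG.fareyGraph_twoConnected σ (p := p) (q := q)
  have hinv := (hfix σ _ _ hji hσi hσj).1
  have hσne : σ r ≠ r := fun h => hww' (congrArg Φ h)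
  have hgσ : g i ≠ σ r := fun h => hgr i hi (σ.injective (hσi.trans h))
  refine exists_closedIso_of_automorphism hG hsat hc hi Φ σ hσne.symm rfl (hinv r) (hw i hi) hw'i g
    fun l hl => ⟨?_, hg l hl⟩
  by_cases hil : g i = g l
  · rw [← hil, hσi]
  -- The automorphisms belonging to `j` and `l` are involutions that both exchange `r` and `σ r` and
  -- fix `g i`. Their product fixes three points and is trivial, so `σ` fixes `g l` as well.
  obtain ⟨τ, hτi, hτl, hτr⟩ := haut l hl hil
  have hτr' : τ r = σ r := Φ.injective hτr
  have hτinv := (hfix τ _ _ hil hτi hτl).1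
  have h1 : (τ.trans σ) r = r := by
    simp [hτr', hinv]
  have h2 : (τ.trans σ) (σ r) = σ r := by
    simp [← hτr', hτinv]
  have h3 : (τ.trans σ) (g i) = g i := by
    simp [hτi, hσi]
  have h4 := (hfix _ _ _ hσne h2 h1).2 _ hgσ (hgr i hi) h3 (g l)
  simpa [hτl] using h4

end MainExtension

/-! ### Reading the axioms in a model -/

section Models

variable {M : Type*} [Language.graph.Structure M] [hM : M ⊨ fareyTheory]

theorem realize_edgeFormula {m : ℕ} (i j : Fin m) (v : Empty → M) (x : Fin m → M) :
    (edgeFormula i j).Realize v x ↔ (simpleGraphOfStructure M).Adj (x i) (x j) :=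
  BoundedFormula.realize_rel₂

omit hM in
theorem realize_eqFormula {m : ℕ} (i j : Fin m) (v : Empty → M) (x : Fin m → M) :
    (eqFormula i j).Realize v x ↔ x i = x j := by
  simp [eqFormula]

theorem fareyTheory_exists_adj (x : M) : ∃ y, (simpleGraphOfStructure M).Adj x y := by
  have h : M ⊨ noIsolatedVertex := Theory.realize_sentence_of_mem fareyTheory
    (.inl (.inr (.inl rfl)))
  simp only [noIsolatedVertex, Sentence.Realize, Formula.Realize, BoundedFormula.realize_all,
    BoundedFormula.realize_ex, realize_edgeFormula] at h
  exact h x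

theorem fareyTheory_thirds (x y : M) (hxy : (simpleGraphOfStructure M).Adj x y) :
    ∃ a b, a ≠ b ∧ ∀ z, ((simpleGraphOfStructure M).Adj x z ∧ (simpleGraphOfStructure M).Adj y z) ↔
      z = a ∨ z = b := by
  have h : M ⊨ exactlyTwoTriangles := Theory.realize_sentence_of_mem fareyTheory
    (.inl (.inr (.inr rfl)))
  simp only [exactlyTwoTriangles, Sentence.Realize, Formula.Realize, BoundedFormula.realize_all,
    BoundedFormula.realize_ex, BoundedFormula.realize_imp, BoundedFormula.realize_inf,
    BoundedFormula.realize_not, BoundedFormula.realize_iff, BoundedFormula.realize_sup,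
    realize_edgeFormula, realize_eqFormula] at h
  exact h x y hxy

theorem fareyTheory_removable (T : Finset M) (hT : T.Nonempty) : ∃ v ∈ T,
    (∀ s ∈ T, ∀ t ∈ T, (simpleGraphOfStructure M).Adj v s → (simpleGraphOfStructure M).Adj v t →
      s ≠ t → (simpleGraphOfStructure M).Adj s t) ∧
    ∀ r ∈ T, ∀ s ∈ T, ∀ t ∈ T, (simpleGraphOfStructure M).Adj v r →
      (simpleGraphOfStructure M).Adj v s → (simpleGraphOfStructure M).Adj v t →
      r = s ∨ r = t ∨ s = t := by
  obtain ⟨k, hk⟩ : ∃ k, T.card = k + 1 := Nat.exists_eq_add_one.2 hT.card_pos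
  have h : M ⊨ someRemovable k := Theory.realize_sentence_of_mem fareyTheory (.inr ⟨k, rfl⟩)
  replace h := BoundedFormula.realize_alls.1 h
  simp only [removableFormula, BoundedFormula.realize_imp, BoundedFormula.realize_inf,
    BoundedFormula.realize_not, BoundedFormula.realize_sup, BoundedFormula.realize_iInf,
    BoundedFormula.realize_iSup, realize_edgeFormula, realize_eqFormula] at h
  let e := (T.equivFinOfCardEq hk).symm
  have hmem : ∀ s ∈ T, ∃ i, (e i : M) = s := fun s hs => ⟨e.symm ⟨s, hs⟩, by simp⟩
  obtain ⟨i, hi⟩ := h (fun i => e i) fun p hp => p.2 (e.injective (Subtype.ext hp))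
  refine ⟨e i, (e i).2, ?_⟩
  rcases hi with h1 | ⟨⟨p, q⟩, ⟨⟨hp, hq⟩, hpq⟩, h2⟩
  · have key : ∀ s ∈ T, ∀ t ∈ T, (simpleGraphOfStructure M).Adj (e i) s →
        (simpleGraphOfStructure M).Adj (e i) t → s = t := by
      intro s hs t ht his hit
      obtain ⟨a, rfl⟩ := hmem s hs
      obtain ⟨b, rfl⟩ := hmem t ht
      by_contra hne
      exact h1 ⟨(a, b), fun hab => hne (by simp only at hab; rw [hab])⟩ ⟨his, hit⟩
    exact ⟨fun s hs t ht his hit hst => absurd (key s hs t ht his hit) hst,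
      fun r hr s hs t ht hir his hit => .inl (key r hr s hs hir his)⟩
  · have key : ∀ s ∈ T, (simpleGraphOfStructure M).Adj (e i) s → s = e p ∨ s = e q := by
      intro s hs his
      obtain ⟨a, rfl⟩ := hmem s hs
      by_contra! hne
      exact h2 ⟨a, fun h => hne.1 (by rw [h]), fun h => hne.2 (by rw [h])⟩ his
    refine ⟨fun s hs t ht his hit hst => ?_, fun r hr s hs t ht hir his hit => ?_⟩
    · rcases key s hs his with rfl | rfl <;> rcases key t ht hit with rfl | rfl
      · exact absurd rfl hst
      · exact hpq
      · exact hpq.symm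
      · exact absurd rfl hst
    · have := key r hr hir
      have := key s hs his
      have := key t ht hit
      grind

variable (M) in
theorem fareyModel_of_theory : FareyModel (simpleGraphOfStructure M) where
  exists_adj := fareyTheory_exists_adj
  thirds := fareyTheory_thirds
  removable := fareyTheory_removable

end Models

/-! ### Distances and configurations as atomic formulas -/

section Atoms

universe u

variable {V : Type u} [Nonempty V] {G : SimpleGraph V}

theorem FareyModel.exists_edgeType (hG : FareyModel G) : ∃ C : CycleType, C.1 = 1 ∧
    ∀ (W : Type u) (H : SimpleGraph W) (x y : W), PCycle H C x y ↔ H.Adj x y := by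
  obtain ⟨b, hb⟩ := hG.fareyGraph_exists_adj fareyZero
  have hedge : ∀ {W : Type u} {H : SimpleGraph W} {x y : W}, H.Adj x y →
      ∃ f : (⊤ : SimpleGraph (Fin 2)) ↪g H, f 0 = x ∧ f 1 = y := by
    intro W H x y h
    have h1 : ∀ i j : Fin 2, (![x, y] : Fin 2 → W) i = ![x, y] j → i = j := by
      simp [Fin.forall_fin_two, h.ne, h.ne']
    have h2 : ∀ i j : Fin 2, H.Adj ((![x, y] : Fin 2 → W) i) (![x, y] j) ↔ i ≠ j := by
      simp [Fin.forall_fin_two, h, h.symm]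
    exact ⟨⟨⟨![x, y], fun i j => h1 i j⟩, fun {i j} => h2 i j⟩, rfl, rfl⟩
  have hrem : {v | IsRemovable (⊤ : SimpleGraph (Fin 2)) v} = {0, 1} := by
    ext v
    refine iff_of_true (.inl ?_) (by fin_cases v <;> simp)
    refine Set.encard_le_one_iff.2 fun a b ha hb => ?_
    simp only [SimpleGraph.mem_neighborSet, SimpleGraph.top_adj] at ha hb
    omega
  have hfarey : Nonempty ((⊤ : SimpleGraph (Fin 2)) ↪g fareyGraph) := by
    have h1 : ∀ i j : Fin 2, (![fareyZero, b] : Fin 2 → FareyVertex) i = ![fareyZero, b] j → i = j := by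
      simp [Fin.forall_fin_two, hb.ne, hb.ne']
    have h2 : ∀ i j : Fin 2, fareyGraph.Adj ((![fareyZero, b] : Fin 2 → FareyVertex) i)
        (![fareyZero, b] j) ↔ i ≠ j := by
      simp [Fin.forall_fin_two, hb, hb.symm]
    exact ⟨⟨![fareyZero, b], fun i j => h1 i j⟩, fun {i j} => h2 i j⟩
  let E : MinimalCycle 1 := ⟨2, ⊤, .inl ⟨rfl, rfl⟩, hfarey, 0, 1, by simp, hrem,
    SimpleGraph.dist_eq_one_iff_adj.2 (by simp)⟩
  refine ⟨⟨1, ⟦E⟧⟩, rfl, fun W H x y => ⟨?_, fun h => ?_⟩⟩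
  · rintro ⟨D, hD, f, u, w, huw, rfl, rfl⟩
    obtain ⟨e⟩ : Nonempty (D.graph ≃g E.graph) := Quotient.exact hD
    -- `PCycle` does not require `u ≠ w` explicitly; this follows because a minimal cycle has two
    -- distinct removable vertices.
    obtain ⟨u', w', hne, huw', -⟩ := D.removable
    refine f.map_adj_iff.2 (e.map_adj_iff.1 ?_)
    change e u ≠ e w
    refine fun h => hne ?_
    rw [e.injective h, huw'] at huw
    have h1 : u' ∈ ({u', w'} : Set _) := .inl rfl
    have h2 : w' ∈ ({u', w'} : Set _) := .inr rfl
    rw [huw] at h1 h2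
    simp only [Set.mem_insert_iff, Set.mem_singleton_iff, or_self] at h1 h2
    rw [h1, h2]
  · obtain ⟨f, h0, h1⟩ := hedge h
    exact ⟨E, rfl, f, (0 : Fin 2), (1 : Fin 2), hrem, h0, h1⟩

/-- For a sequence of `k` single edges the chain is a walk of length `k`, and the condition on the
distance makes it a geodesic. -/
theorem FareyModel.exists_pSeq_iff (hG : FareyModel G) (k : ℕ) : ∃ δ : List CycleType,
    ∀ (W : Type u) (H : SimpleGraph W) (x y : W), PSeq H δ x y ↔ DistEq H k x y := by
  obtain ⟨C, hC, hadj⟩ := hG.exists_edgeType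
  refine ⟨List.replicate k C, fun W H x y => ⟨fun h => ⟨h.reachable, ?_⟩, ?_⟩⟩
  · simpa [hC] using h.2
  · rintro ⟨h, hk⟩
    refine ⟨?_, by simpa [hC] using hk⟩
    obtain ⟨p, hp⟩ := h.exists_walk_length_eq_dist
    refine ⟨fun i => p.getVert i, by simp, by simp [← hk, ← hp], fun i => ?_⟩
    have hi : (i : ℕ) < k := by simpa using i.2
    simp only [List.get_eq_getElem, List.getElem_replicate, hadj]
    exact p.adj_getVert_succ (show (i : ℕ) < p.length by omega)

/-- A finite level containing `p`, `q`, `r` is enough, because each of its embeddings extends to the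
whole Farey graph. Three-transitivity of the symmetric group brings the three vertices to the first
places of the enumeration. -/
theorem FareyModel.exists_dLevel_iff (hG : FareyModel G) {p q r : FareyVertex} (hpq : p ≠ q)
    (hpr : p ≠ r) (hqr : q ≠ r) : ∃ k σ, ∀ (W : Type u) (H : SimpleGraph W), FareyModel H →
      ∀ x y z, DLevel H k σ x y z ↔ ∃ Φ : fareyGraph ↪g H, Φ p = x ∧ Φ q = y ∧ Φ r = z := by
  obtain ⟨k, ι, u, v, w, rfl, rfl, rfl, hι⟩ := hG.exists_level_three p q r
  have hk := four_le_fareyCard k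
  have hinj : Function.Injective (![⟨0, by omega⟩, ⟨1, by omega⟩, ⟨2, by omega⟩] :
      Fin 3 → Fin (fareyCard k)) := by
    intro i j
    fin_cases i <;> fin_cases j <;> simp
  have hinj' : Function.Injective (![(fareyEnum k).symm u, (fareyEnum k).symm v,
      (fareyEnum k).symm w] : Fin 3 → Fin (fareyCard k)) := by
    have h1 : u ≠ v := fun h => hpq (congrArg ι h)
    have h2 : u ≠ w := fun h => hpr (congrArg ι h)
    have h3 : v ≠ w := fun h => hqr (congrArg ι h)
    intro i j
    fin_cases i <;> fin_cases j <;> simp [h1, h2, h3, h1.symm, h2.symm, h3.symm]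
  obtain ⟨σ, hσ⟩ := (Equiv.Perm.isMultiplyPretransitive (Fin (fareyCard k)) 3).exists_smul_eq
    ⟨_, hinj⟩ ⟨_, hinj'⟩
  have hσ' := fun i => DFunLike.congr_fun hσ i
  have h0 : fareyEnum k (σ ⟨0, by omega⟩) = u := (Equiv.eq_symm_apply _).1 (hσ' 0)
  have h1 : fareyEnum k (σ ⟨1, by omega⟩) = v := (Equiv.eq_symm_apply _).1 (hσ' 1)
  have h2 : fareyEnum k (σ ⟨2, by omega⟩) = w := (Equiv.eq_symm_apply _).1 (hσ' 2)
  refine ⟨k, σ, fun W H hH x y z => ⟨?_, ?_⟩⟩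
  · rintro ⟨t, rfl, rfl, rfl, ht, hadj⟩
    have key : ∀ a, fareyEnum k (σ (σ.symm ((fareyEnum k).symm a))) = a := by simp
    obtain ⟨Φ, hΦ⟩ := hH.exists_embedding k ⟨⟨fun a => t (σ.symm ((fareyEnum k).symm a)),
      fun a b hab => by simpa using ht hab⟩, fun {a b} => by
        change H.Adj (t _) (t _) ↔ _
        rw [hadj, key, key]⟩
    have hΦ' : ∀ i, Φ (ι (fareyEnum k (σ i))) = t i := fun i => by
      rw [hι, hΦ]
      change t _ = _
      simp
    exact ⟨Φ, by rw [← h0, hΦ'], by rw [← h1, hΦ'], by rw [← h2, hΦ']⟩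
  · rintro ⟨Φ, rfl, rfl, rfl⟩
    refine ⟨fun i => Φ (ι (fareyEnum k (σ i))), congrArg (fun a => Φ (ι a)) h0,
      congrArg (fun a => Φ (ι a)) h1, congrArg (fun a => Φ (ι a)) h2, ?_, ?_⟩
    · exact Φ.injective.comp (ι.injective.comp ((fareyEnum k).injective.comp σ.injective))
    · intro i j
      rw [Φ.map_adj_iff, ι.map_adj_iff]

theorem FareyModel.exists_yConfig_iff (hG : FareyModel G) {p q r : FareyVertex} (hpq : p ≠ q)
    (hpr : p ≠ r) (hqr : q ≠ r) (k l m : ℕ) : ∃ δ₁ δ₂ δ₃ n σ, ∀ (W : Type u) (H : SimpleGraph W),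
      FareyModel H → ∀ x y z, YConfig H δ₁ δ₂ δ₃ n σ x y z ↔ FareyConfig H p q r k l m x y z := by
  obtain ⟨δ₁, h1⟩ := hG.exists_pSeq_iff k
  obtain ⟨δ₂, h2⟩ := hG.exists_pSeq_iff l
  obtain ⟨δ₃, h3⟩ := hG.exists_pSeq_iff m
  obtain ⟨n, σ, h⟩ := hG.exists_dLevel_iff hpq hpr hqr
  refine ⟨δ₁, δ₂, δ₃, n, σ, fun W H hH x y z => ?_⟩
  simp only [YConfig, h1, h2, h3, h W H hH]
  constructor
  · rintro ⟨_, _, _, ⟨Φ, rfl, rfl, rfl⟩, h⟩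
    exact ⟨Φ, h⟩
  · rintro ⟨Φ, h⟩
    exact ⟨_, _, _, ⟨Φ, rfl, rfl, rfl⟩, h⟩

end Atoms

/-! ### Countable saturation of ultraproducts -/

section Ultraproducts

universe u

theorem holds_simpleGraphOfStructure {M : Type*} [Language.graph.Structure M]
    [M ⊨ Theory.simpleGraph] {α : Type*} (φ : Language.graph.Formula α) (v : α → M) :
    Holds (simpleGraphOfStructure M) φ v ↔ φ.Realize v := by
  rw [Holds, structure_simpleGraphOfStructure]

variable (M : ℕ → Type u) [∀ k, Language.graph.Structure (M k)] [∀ k, Nonempty (M k)]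

/-- The ultraproduct along a nonprincipal ultrafilter. -/
abbrev CountableUltraproduct : Type u := (Filter.hyperfilter ℕ : Filter ℕ).Product M

instance [∀ k, M k ⊨ fareyTheory] : CountableUltraproduct M ⊨ fareyTheory :=
  (Theory.model_iff _).2 fun _ hφ => (Ultraproduct.sentence_realize _).2
    (.of_forall fun _ => Theory.realize_sentence_of_mem fareyTheory hφ)

namespace CountableUltraproduct

variable {M}

/-- The element of the ultraproduct represented by a sequence. -/
noncomputable def mk (x : ∀ k, M k) : CountableUltraproduct M := (x : (Filter.hyperfilter ℕ : Filter ℕ).Product M)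

omit [∀ k, Language.graph.Structure (M k)] [∀ k, Nonempty (M k)] in
theorem exists_rep (a : CountableUltraproduct M) : ∃ x, mk x = a := Quotient.exists_rep a

theorem realize_mk {β : Type*} (φ : Language.graph.Formula β) (x : β → ∀ k, M k) :
    φ.Realize (fun i => mk (x i)) ↔
      ∀ᶠ k in Filter.hyperfilter ℕ, φ.Realize fun i => x i k :=
  Ultraproduct.realize_formula_cast φ x

variable (M) in
-- A diagonal choice: the `k`-th coordinate realizes the longest initial segment of the formulas, of
-- length at most `k`, that is realizable there. Each formula is then satisfied in almost all
-- coordinates.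
theorem saturated [∀ k, M k ⊨ fareyTheory] :
    CountablySaturated (simpleGraphOfStructure (CountableUltraproduct M)) := by
  classical
  intro θ hθ
  simp only [holds_simpleGraphOfStructure] at hθ ⊢
  choose p hp using exists_rep (M := M)
  have hlos : ∀ (y : ∀ k, M k) (j : ℕ), (θ j).Realize (Sum.elim id fun _ => mk y) ↔
      ∀ᶠ k in Filter.hyperfilter ℕ, (θ j).Realize (Sum.elim (fun q => p q k) fun _ => y k) := by
    intro y j
    have h1 : (Sum.elim id fun _ => mk y) =
        fun i : CountableUltraproduct M ⊕ Unit => mk (Sum.elim p (fun _ => y) i) := by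
      funext i
      rcases i with i | i
      · exact (hp i).symm
      · rfl
    have h2 : ∀ k, (fun i : CountableUltraproduct M ⊕ Unit => Sum.elim p (fun _ => y) i k) =
        Sum.elim (fun q => p q k) fun _ => y k := by
      intro k
      funext i
      rcases i with i | i <;> rfl
    rw [h1, realize_mk]
    simp only [h2]
  let A : ℕ → ℕ → Prop := fun n k => ∃ y : M k, ∀ j < n,
    (θ j).Realize (Sum.elim (fun q => p q k) fun _ => y)
  have hA : ∀ n, ∀ᶠ k in Filter.hyperfilter ℕ, A n k := by
    intro n
    obtain ⟨x, hx⟩ := hθ n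
    obtain ⟨y, rfl⟩ := exists_rep x
    have : ∀ᶠ k in Filter.hyperfilter ℕ, ∀ j ∈ Set.Iio n,
        (θ j).Realize (Sum.elim (fun q => p q k) fun _ => y k) :=
      (Filter.eventually_all_finite (Set.finite_Iio n)).2 fun j hj => (hlos y j).1 (hx j hj)
    exact this.mono fun k hk => ⟨y k, hk⟩
  have h0 : ∀ k, A 0 k := fun k => ⟨Classical.arbitrary _, fun j hj => absurd hj (Nat.not_lt_zero j)⟩
  have hmax : ∀ k, A (Nat.findGreatest (fun n => A n k) k) k := fun k =>
    Nat.findGreatest_spec (P := fun n => A n k) (Nat.zero_le k) (h0 k)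
  choose y hy using hmax
  refine ⟨mk y, fun j => (hlos y j).2 ?_⟩
  have hcof : ∀ᶠ k in Filter.hyperfilter ℕ, j + 1 ≤ k :=
    Filter.hyperfilter_le_cofinite (Nat.cofinite_eq_atTop ▸ Filter.eventually_ge_atTop (j + 1))
  filter_upwards [hA (j + 1), hcof] with k h1 h2
  exact hy k j (Nat.le_findGreatest (P := fun n => A n k) h2 h1)

end CountableUltraproduct

end Ultraproducts

/-! ### Types in saturated models -/

section Types

universe u

/-- The tuples `v` and `w` agree on distances and positions relative to copies of the Farey
graph. -/
structure SameConfigTuples {V W : Type u} (G : SimpleGraph V) (H : SimpleGraph W) {n : ℕ}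
    (v : Fin n → V) (w : Fin n → W) : Prop where
  dist : ∀ i j k, DistEq G k (v i) (v j) ↔ DistEq H k (w i) (w j)
  config : ∀ i j l p q r k₁ k₂ k₃, p ≠ q → p ≠ r → q ≠ r →
    (FareyConfig G p q r k₁ k₂ k₃ (v i) (v j) (v l) ↔
      FareyConfig H p q r k₁ k₂ k₃ (w i) (w j) (w l))

namespace SameConfigTuples

variable {U V W : Type u} {F : SimpleGraph U} {G : SimpleGraph V} {H : SimpleGraph W} {n : ℕ}
  {s : Fin n → U} {v : Fin n → V} {w : Fin n → W}

theorem symm (h : SameConfigTuples G H v w) : SameConfigTuples H G w v :=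
  ⟨fun i j k => (h.dist i j k).symm,
    fun i j l p q r k₁ k₂ k₃ h1 h2 h3 => (h.config i j l p q r k₁ k₂ k₃ h1 h2 h3).symm⟩

theorem trans (h : SameConfigTuples F G s v) (h' : SameConfigTuples G H v w) :
    SameConfigTuples F H s w :=
  ⟨fun i j k => (h.dist i j k).trans (h'.dist i j k),
    fun i j l p q r k₁ k₂ k₃ h1 h2 h3 =>
      (h.config i j l p q r k₁ k₂ k₃ h1 h2 h3).trans (h'.config i j l p q r k₁ k₂ k₃ h1 h2 h3)⟩

theorem _root_.FODef.iff_of_holds {α : Type} {R : ∀ V : Type u, SimpleGraph V → (α → V) → Prop}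
    (hR : FODef R) {v : α → V} {w : α → W}
    (h : ∀ φ : Language.graph.Formula α, Holds G φ v ↔ Holds H φ w) : R V G v ↔ R W H w := by
  obtain ⟨φ, hφ⟩ := hR
  rw [← hφ, ← hφ, h]

theorem of_holds [Nonempty V] (hG : FareyModel G) (hH : FareyModel H)
    (h : ∀ φ : Language.graph.Formula (Fin n), Holds G φ v ↔ Holds H φ w) :
    SameConfigTuples G H v w where
  dist i j k := (FODef.distEq k i j).iff_of_holds h
  config i j l p q r k₁ k₂ k₃ h1 h2 h3 := by
    obtain ⟨δ₁, δ₂, δ₃, n, σ, h'⟩ := hG.exists_yConfig_iff h1 h2 h3 k₁ k₂ k₃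
    rw [← h' _ G hG, ← h' _ H hH]
    exact (FODef.yConfig δ₁ δ₂ δ₃ n σ i j l).iff_of_holds h

theorem sameConfig {v w : Fin (n + 1) → V} (h : SameConfigTuples G G v w)
    (heq : ∀ i : Fin n, v i.castSucc = w i.castSucc) :
    SameConfig G (fun i : Fin n => v i.castSucc) (v (Fin.last n)) (w (Fin.last n)) where
  dist i k := by
    have := h.dist i.castSucc (Fin.last n) k
    rwa [← heq] at this
  config i j p q r k l m h1 h2 h3 := by
    have := h.config i.castSucc j.castSucc (Fin.last n) p q r k l m h1 h2 h3
    rwa [← heq, ← heq] at this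
  config_mid i p q r k l m h1 h2 h3 := by
    have := h.config i.castSucc (Fin.last n) i.castSucc p q r k l m h1 h2 h3
    rwa [← heq] at this

/-- In saturated models, distances and positions relative to copies of the Farey graph determine the
type of a tuple. -/
theorem holds_iff [Nonempty V] [Nonempty W] (hG : FareyModel G) (hH : FareyModel H)
    (hsG : CountablySaturated G) (hsH : CountablySaturated H) (h : SameConfigTuples G H v w)
    (φ : Language.graph.Formula (Fin n)) : Holds G φ v ↔ Holds H φ w := by
  induction n with
  | zero => exact ClosedIso.empty.holds_iff hG hH hsG hsH φ v w fun i => i.elim0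
  | succ n ih =>
    classical
    let f : Fin (n + 1) → Fin n ⊕ Unit := Fin.snoc Sum.inl (.inr ())
    have hf : ∀ {U : Type u} (a : Fin n → U) (c : U),
        Sum.elim a (fun _ => c) ∘ f = (Fin.snoc a c : Fin (n + 1) → U) := by
      intro U a c
      funext i
      refine Fin.lastCases ?_ (fun i => ?_) i <;> simp [f]
    have hsnoc : ∀ {U : Type u} (x : Fin (n + 1) → U),
        (Fin.snoc (fun i : Fin n => x i.castSucc) (x (Fin.last n)) : Fin (n + 1) → U) = x :=
      fun x => Fin.snoc_init_self x
    have ih' := ih (v := fun i => v i.castSucc) (w := fun i => w i.castSucc)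
      ⟨fun i j k => h.dist _ _ k, fun i j l p q r k₁ k₂ k₃ => h.config _ _ _ p q r k₁ k₂ k₃⟩
    have : Countable Language.graph.Symbols :=
      inferInstanceAs (Countable ((Σ l, Language.graph.Functions l) ⊕ _))
    -- A vertex `d` realizing in `H`, over the first `n` entries of `w`, what the last entry of `v`
    -- satisfies. Finite parts are realized because their existential closure is a formula in `n`
    -- variables, covered by induction.
    obtain ⟨d, hd⟩ := hsH.realize
      (ι := {φ : Language.graph.Formula (Fin (n + 1)) // Holds G φ v})
      (fun φ => φ.1.relabel f) (fun _ i => w i.castSucc) (by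
        intro s
        let R : ∀ V : Type u, SimpleGraph V → (Fin n → V) → Prop := fun V G a =>
          ∃ x, ∀ φ : s, Holds G (φ.1.1.relabel f) (Sum.elim a fun _ => x)
        have hR : FODef R := FODef.ex_one (R := fun V G a x => ∀ φ : s,
          Holds G (φ.1.1.relabel f) (Sum.elim a fun _ => x)) (FODef.all_finite fun φ =>
            ⟨φ.1.1.relabel f, fun V G a => by
              rw [← Sum.elim_comp_inl_inr a]
              rfl⟩)
        obtain ⟨θ, hθ⟩ := hR
        have h1 : R _ G fun i => v i.castSucc :=
          ⟨v (Fin.last n), fun φ => by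
            rw [Holds.relabel_iff, hf, hsnoc]
            exact φ.1.2⟩
        rw [← hθ, ih', hθ] at h1
        obtain ⟨x, hx⟩ := h1
        exact ⟨x, fun φ hφ => hx ⟨φ, hφ⟩⟩)
    have h1 : ∀ φ, Holds G φ v ↔ Holds H φ (Fin.snoc (fun i : Fin n => w i.castSucc) d :
        Fin (n + 1) → W) := by
      have key : ∀ φ, Holds G φ v → Holds H φ (Fin.snoc (fun i : Fin n => w i.castSucc) d :
          Fin (n + 1) → W) := by
        intro φ hφ
        have := hd ⟨φ, hφ⟩
        rwa [Holds.relabel_iff, hf] at this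
      refine fun φ => ⟨key φ, fun hφ => ?_⟩
      by_contra hn
      exact key φ.not hn hφ
    -- Now `d` and the last entry of `w` are compared inside `H` over the same tuple, which is the
    -- situation of the extension theorem.
    have h2 := ((of_holds hG hH h1).symm.trans h).sameConfig (by simp)
    simp only [Fin.snoc_castSucc, Fin.snoc_last] at h2
    obtain ⟨r, hr, hb, hdr⟩ := h2.exists_closedIso hH hsH
    rw [h1]
    refine hr.holds_iff hH hH hsH hsH φ _ _ fun i => ?_
    refine Fin.lastCases ?_ (fun i => ?_) i
    · simpa using hdr
    · simpa using hb i

end SameConfigTuples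

end Types

/-! ### Quantifier elimination by compactness -/

section Elimination

universe u

/-- A model of the theory of the Farey graph with a tuple of elements. -/
structure PointedModel (n : ℕ) : Type (u + 1) where
  /-- the universe of the model -/
  carrier : Type u
  [nonempty : Nonempty carrier]
  [str : Language.graph.Structure carrier]
  [model : carrier ⊨ fareyTheory]
  /-- the tuple -/
  tuple : Fin n → carrier

namespace PointedModel

attribute [instance] nonempty str model

variable {n : ℕ}

/-- The tuple satisfies the formula in the model. -/
def Sat (P : PointedModel.{u} n) (ψ : fareyLanguage.Formula (Fin n)) : Prop := ψ.Realize P.tuple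

/-- A property of tuples that depends only on finitely many quantifier-free formulas is given by a
quantifier-free formula. -/
theorem exists_isQF (θ : ℕ → fareyLanguage.Formula (Fin n)) (hθ : ∀ j, (θ j).IsQF) (k : ℕ)
    (R : PointedModel.{u} n → Prop)
    (hR : ∀ P Q, (∀ j < k, P.Sat (θ j) ↔ Q.Sat (θ j)) → R P → R Q) :
    ∃ ψ : fareyLanguage.Formula (Fin n), ψ.IsQF ∧ ∀ P : PointedModel.{u} n, R P ↔ P.Sat ψ := by
  induction k generalizing R with
  | zero =>
    by_cases hP : ∃ P, R P
    · obtain ⟨P, hP⟩ := hP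
      exact ⟨⊤, .top, fun Q => iff_of_true (hR P Q (by simp) hP) (Formula.realize_top.2 trivial)⟩
    · push Not at hP
      exact ⟨⊥, .falsum, fun Q => iff_of_false (hP Q) id⟩
  | succ k ih =>
    -- For a fixed truth value of the last formula, saturate the property under agreement on the
    -- first `k`; induction then applies to it.
    have key : ∀ p : Prop, ∃ ψ : fareyLanguage.Formula (Fin n), ψ.IsQF ∧ ∀ P : PointedModel.{u} n,
        (∃ Q : PointedModel.{u} n, (∀ j < k, Q.Sat (θ j) ↔ P.Sat (θ j)) ∧ (Q.Sat (θ k) ↔ p) ∧ R Q) ↔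
          P.Sat ψ := by
      refine fun p => ih _ ?_
      rintro P P' hPP' ⟨Q, h1, h2⟩
      exact ⟨Q, fun j hj => (h1 j hj).trans (hPP' j hj), h2⟩
    obtain ⟨ψ, hψ, h1⟩ := key True
    obtain ⟨χ, hχ, h2⟩ := key False
    refine ⟨(θ k ⊓ ψ) ⊔ (∼(θ k) ⊓ χ), ((hθ k).inf hψ).sup ((hθ k).not.inf hχ), fun P => ?_⟩
    have hrec : ∀ p : Prop, (P.Sat (θ k) ↔ p) → (R P ↔ ∃ Q : PointedModel.{u} n,
        (∀ j < k, Q.Sat (θ j) ↔ P.Sat (θ j)) ∧ (Q.Sat (θ k) ↔ p) ∧ R Q) := by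
      refine fun p hp => ⟨fun h => ⟨P, fun _ _ => Iff.rfl, hp, h⟩, ?_⟩
      rintro ⟨Q, h3, h4, h5⟩
      refine hR Q P (fun j hj => ?_) h5
      rcases Nat.lt_succ_iff_lt_or_eq.1 hj with hj | rfl
      · exact h3 j hj
      · exact h4.trans hp.symm
    have hsat : P.Sat ((θ k ⊓ ψ) ⊔ (∼(θ k) ⊓ χ)) ↔
        (P.Sat (θ k) ∧ P.Sat ψ) ∨ (¬ P.Sat (θ k) ∧ P.Sat χ) := by
      simp only [Sat, Formula.realize_sup, Formula.realize_inf, Formula.realize_not]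
    rw [hsat, ← h1, ← h2]
    by_cases hk : P.Sat (θ k)
    · rw [hrec True (iff_true_intro hk)]
      simp [hk]
    · rw [hrec False (iff_false_intro hk)]
      simp [hk]

end PointedModel

theorem SameConfigTuples.of_isQF {V W : Type u} [Nonempty V] {G : SimpleGraph V}
    {H : SimpleGraph W} (hG : FareyModel G) (hH : FareyModel H) {n : ℕ} {v : Fin n → V}
    {w : Fin n → W} (h : ∀ ψ : fareyLanguage.Formula (Fin n), ψ.IsQF →
      ((letI := G.fareyStructure; ψ.Realize v) ↔ (letI := H.fareyStructure; ψ.Realize w))) :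
    SameConfigTuples G H v w where
  dist i j k := by
    obtain ⟨δ, hδ⟩ := hG.exists_pSeq_iff k
    rw [← hδ, ← hδ]
    exact h (Relations.formula (L := fareyLanguage) (FareyRel.P δ) ![Term.var i, Term.var j])
      (.of_isAtomic (.rel _ _))
  config i j l p q r k₁ k₂ k₃ h1 h2 h3 := by
    obtain ⟨δ₁, δ₂, δ₃, k, σ, h'⟩ := hG.exists_yConfig_iff h1 h2 h3 k₁ k₂ k₃
    rw [← h' _ G hG, ← h' _ H hH]
    exact h (Relations.formula (L := fareyLanguage) (FareyRel.Y δ₁ δ₂ δ₃ k σ)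
      ![Term.var i, Term.var j, Term.var l]) (.of_isAtomic (.rel _ _))

namespace PointedModel

variable {n : ℕ}

/-- The tuple in the ultraproduct of a sequence of models with tuples. -/
noncomputable def limit (P : ℕ → PointedModel.{u} n) :
    Fin n → CountableUltraproduct fun k => (P k).carrier :=
  fun i => CountableUltraproduct.mk fun k => (P k).tuple i

theorem holds_limit (P : ℕ → PointedModel.{u} n) (θ : Language.graph.Formula (Fin n)) :
    Holds (simpleGraphOfStructure _) θ (limit P) ↔
      ∀ᶠ k in Filter.hyperfilter ℕ, Holds (simpleGraphOfStructure (P k).carrier) θ (P k).tuple := by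
  simp only [holds_simpleGraphOfStructure]
  exact CountableUltraproduct.realize_mk θ _

/-- Otherwise there are, for every `k`, tuples that agree on the first `k` quantifier-free formulas
but not on `φ`. The limits in the two ultraproducts agree on all quantifier-free formulas, hence on
`φ` by saturation, against Łoś's theorem. -/
theorem exists_isQF_sat_iff (φ : fareyLanguage.Formula (Fin n)) :
    ∃ ψ : fareyLanguage.Formula (Fin n), ψ.IsQF ∧ ∀ P : PointedModel.{u} n, P.Sat φ ↔ P.Sat ψ := by
  have : Countable Language.graph.Symbols :=
    inferInstanceAs (Countable ((Σ l, Language.graph.Functions l) ⊕ _))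
  -- Quantifier-free formulas are enumerated through their translations into the language of graphs,
  -- which has only countably many formulas.
  let Θ := {θ : Language.graph.Formula (Fin n) // ∃ ψ : fareyLanguage.Formula (Fin n), ψ.IsQF ∧
    ∀ (V : Type u) (G : SimpleGraph V) (v : Fin n → V),
      Holds G θ v ↔ (letI := G.fareyStructure; ψ.Realize v)}
  have hne : Nonempty Θ := ⟨⟨⊥, ⊥, .falsum, fun _ _ _ => Iff.rfl⟩⟩
  obtain ⟨e, he⟩ := exists_surjective_nat Θ
  choose ψ hψ hψe using fun k => (e k).2
  by_contra hno
  have hpair : ∀ k, ∃ P Q : PointedModel.{u} n, (∀ j < k, P.Sat (ψ j) ↔ Q.Sat (ψ j)) ∧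
      P.Sat φ ∧ ¬ Q.Sat φ := by
    intro k
    by_contra! hk
    exact hno (exists_isQF ψ hψ k _ hk)
  choose P Q hPQ hP hQ using hpair
  have hagree : ∀ χ : fareyLanguage.Formula (Fin n), χ.IsQF →
      ((letI := (simpleGraphOfStructure (CountableUltraproduct
        fun k => (P k).carrier)).fareyStructure; χ.Realize (limit P)) ↔
      (letI := (simpleGraphOfStructure (CountableUltraproduct
        fun k => (Q k).carrier)).fareyStructure; χ.Realize (limit Q))) := by
    intro χ hχ
    obtain ⟨θ, hθ⟩ := FODef.formula.{u} χ
    obtain ⟨j, hj⟩ := he ⟨θ, χ, hχ, hθ⟩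
    refine (hθ _ _ _).symm.trans (Iff.trans ?_ (hθ _ _ _))
    rw [holds_limit, holds_limit]
    refine Filter.eventually_congr ?_
    have hcof : ∀ᶠ k in Filter.hyperfilter ℕ, j + 1 ≤ k :=
      Filter.hyperfilter_le_cofinite (Nat.cofinite_eq_atTop ▸ Filter.eventually_ge_atTop (j + 1))
    filter_upwards [hcof] with k hk
    have h1 := hψe j
    rw [hj] at h1
    exact (h1 _ _ _).trans ((hPQ k j hk).trans (h1 _ _ _).symm)
  have hG := fareyModel_of_theory (CountableUltraproduct fun k => (P k).carrier)
  have hH := fareyModel_of_theory (CountableUltraproduct fun k => (Q k).carrier)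
  obtain ⟨θ, hθ⟩ := FODef.formula.{u} φ
  have key := (SameConfigTuples.of_isQF hG hH hagree).holds_iff hG hH
    (CountableUltraproduct.saturated _) (CountableUltraproduct.saturated _) θ
  rw [holds_limit, holds_limit] at key
  have h1 := key.1 (.of_forall fun k => (hθ _ _ _).2 (hP k))
  obtain ⟨k, hk⟩ := h1.exists
  exact hQ k ((hθ _ _ _).1 hk)

end PointedModel

end Elimination

theorem mainTheorem2 (n : ℕ) (φ : fareyLanguage.Formula (Fin n)) :
    ∃ ψ : fareyLanguage.Formula (Fin n), ψ.IsQF ∧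
      ∀ (M : Type*) [Nonempty M] [Language.graph.Structure M] [M ⊨ fareyTheory]
        (v : Fin n → M), φ.Realize v ↔ ψ.Realize v := by
  obtain ⟨ψ, hψ, h⟩ := PointedModel.exists_isQF_sat_iff φ
  exact ⟨ψ, hψ, fun M _ _ _ v => h ⟨M, v⟩⟩
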